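/- **Theorem 1.1 (Local boundedness).** *Setting.* Let $n\ge 1$, $0<s<t<1<p<\infty$ and $0<\nu\le 1\le L<\infty$. Let $\Omega\subset\mathbb R^n$ be a bounded domain. Let $K_{sp},K_{tp},a,b:\mathbb R^n\times\mathbb R^n\to\mathbb R$ be measurable and symmetric, $a,b\ge 0$, with $$\frac{\nu}{|x-y|^{n+sp}}\le K_{sp}(x,y)\le\frac{L}{|x-y|^{n+sp}},\qquad \frac{\nu}{|x-y|^{n+tp}}\le K_{tp}(x,y)\le\frac{L}{|x-y|^{n+tp}},\qquad \nu\le a(x,y)+b(x,y)\le L$$ for a.e. $x,y\in\mathbb R^n$ ($x\neq y$ in the first two). Put $\mathcal C_\Omega=(\mathbb R^n\times\mathbb R^n)\setminus((\mathbb R^n\setminus\Omega)\times(\mathbb R^n\setminus\Omega))$. Let $\mathcal A(\Omega)$ be the set of measurable $f:\mathbb R^n\to\mathbb R$ with $f|_\Omega\in L^p(\Omega)$ and $$\iint_{\mathcal C_\Omega}\Big(a(x,y)\frac{|f(x)-f(y)|^p}{|x-y|^{n+sp}}+b(x,y)\frac{|f(x)-f(y)|^p}{|x-y|^{n+tp}}\Big)dx\,dy<\infty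 .$$ A function $u\in\mathcal A(\Omega)$ is a weak solution of $$\mathrm{P.V.}\int_{\mathbb R^n}|u(x)-u(y)|^{p-2}(u(x)-u(y))\,[a(x,y)K_{sp}(x,y)+b(x,y)K_{tp}(x,y)]\,dy=0\quad\text{in }\Omega$$ if $$\iint_{\mathcal C_\Omega}a\,|u(x)-u(y)|^{p-2}(u(x)-u(y))(\varphi(x)-\varphi(y))K_{sp}\,dx\,dy+\iint_{\mathcal C_\Omega}b\,|u(x)-u(y)|^{p-2}(u(x)-u(y))(\varphi(x)-\varphi(y))K_{tp}\,dx\,dy=0$$ for every $\varphi\in\mathcal A(\Omega)$ with $\varphi=0$ a.e. in $\mathbb R^n\setminus\Omega$. It is a weak subsolution if the left-hand side is $\le 0$ for every such $\varphi$ that is moreover $\ge 0$ a.e. in $\mathbb R^n$. For $f:\mathbb R^n\to\mathbb R$, $x_0\in\mathbb R^n$ and $r,\rho>0$ the nonlocal tail is $$T(f;x_0,r,\rho)=\operatorname*{ess\,sup}_{x\in B_\rho(x_0)}\int_{\mathbb R^n\setminus B_r(x_0)}\Big(a(x,y)\frac{|f(y)|^{p-1}}{|y-x_0|^{n+sp}}+b(x,y)\frac{|f(y)|^{p-1}}{|y-x_0|^{n+tp}}\Big)dy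 .$$ Let $\mathcal T(\mathbb R^n)$ be the set of $f\in L^{p-1}_{\rm loc}(\mathbb R^n)$ with $T(f;x_0,r,\rho)<\infty$ for all $x_0\in\mathbb{R}^n$ and $r,\rho>0$. For a ball $B_r=B_r(x_0)$ and $\tau\ge0$ put $$G_{B_r}(\tau)=\operatorname*{ess\,sup}_{x,y\in B_r}\Big(a(x,y)\frac{\tau^p}{r^{sp}}+b(x,y)\frac{\tau^p}{r^{tp}}\Big),\qquad g_{B_r}(\tau)=\frac{G_{B_r}(\tau)}{\tau}\ \ (\tau>0),\quad g_{B_r}(0)=0 .$$ Balls are concentric, $T(f;r,\rho)$ stands for $T(f;x_0,r,\rho)$, and $u_+=\max\{u,0\}$. *Claim.* Let $u\in\mathcal A(\Omega)\cap\mathcal T(\mathbb R^n)$ be a weak subsolution, and let $B_r=B_r(x_0)\Subset\Omega$ be a ball with $0<r\le 1$. 1. With $\beta=\min\{sp/n,\,p-1\}$ and a constant $c>0$ depending only on $n,s,t,p,\nu,L$, $$\operatorname*{ess\,sup}_{B_{r/2}}u\le c\,r^{-(t-s)/\beta}\Big(\frac1{|B_r|}\int_{B_r}u_+^p\,dx\Big)^{1/p}+\big[r^{sp}\,T(u_+;r/2,r)\big]^{1/(p-1)}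 .\tag{A}$$ 2. Assume further that there are $\alpha\in(0,1]$ and $[b]_\alpha\ge0$ with $(t-s)p\le\alpha$ and $|b(x_1,y_1)-b(x_2,y_2)|\le[b]_\alpha(|x_1-x_2|+|y_1-y_2|)^\alpha$ for all $x_1,y_1,x_2,y_2\in\mathbb R^n$, and let $R_0\in(0,1)$ be such that $[b]_\alpha(2R_0)^\alpha\le\nu/8$. If $r\le R_0$, then $g_{B_r}:[0,\infty)\to[0,\infty)$ is a bijection and $$\operatorname*{ess\,sup}_{B_{r/2}}u\le c\Big(\frac1{|B_r|}\int_{B_r}u_+^p\,dx\Big)^{1/p}+\Big[\frac{T(u_+;r/2,r)}{G_{B_r}(1)}\Big]^{1/(p-1)}=c\Big(\frac1{|B_r|}\int_{B_r}u_+^p\,dx\Big)^{1/p}+g_{B_r}^{-1}\big(T(u_+;r/2,r)\big)\tag{B}$$ with a constant $c>0$ depending only on $n,s,t,p,\nu,L,\alpha,[b]_\alpha$. Consequently, if $u\in\mathcal A(\Omega)\cap\mathcal T(\mathbb R^n)$ is a weak solution, then $u\in L^\infty_{\rm loc}(\Omega)$, and under the respective assumptions (A) and (B) hold with $u$ and $u_+$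 both replaced by $|u|$. -/

import Mathlib

open MeasureTheory Metric Set
open scoped ENNReal

noncomputable section

/-- The Euclidean space `ℝⁿ`, with its Euclidean norm and Lebesgue measure. -/
abbrev Rn (n : ℕ) : Type := EuclideanSpace ℝ (Fin n)

/-- `K` is a symmetric (Lebesgue) measurable kernel of order `(σ, p)` with ellipticity
constants `ν ≤ L`: `ν |x-y|^{-n-σp} ≤ K(x,y) ≤ L |x-y|^{-n-σp}` for a.e. `(x,y)`, `x ≠ y`. -/
structure IsKernel {n : ℕ} (σ p ν L : ℝ) (K : Rn n → Rn n → ℝ) : Prop where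
  measurable : AEMeasurable (fun z : Rn n × Rn n => K z.1 z.2) volume
  symm : ∀ x y, K x y = K y x
  bounds : ∀ᵐ z : Rn n × Rn n, z.1 ≠ z.2 →
    ν / ‖z.1 - z.2‖ ^ ((n : ℝ) + σ * p) ≤ K z.1 z.2 ∧
      K z.1 z.2 ≤ L / ‖z.1 - z.2‖ ^ ((n : ℝ) + σ * p)

/-- `a` is a nonnegative, symmetric, (Lebesgue) measurable function on `ℝⁿ × ℝⁿ`. -/
structure IsCoefficient {n : ℕ} (a : Rn n → Rn n → ℝ) : Prop where
  measurable : AEMeasurable (fun z : Rn n × Rn n => a z.1 z.2) volume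
  symm : ∀ x y, a x y = a y x
  nonneg : ∀ x y, 0 ≤ a x y

/-- The assumptions on the kernels and on the two modulating coefficients. -/
structure IsData {n : ℕ} (s t p ν L : ℝ) (a b Ks Kt : Rn n → Rn n → ℝ) : Prop where
  kernel_s : IsKernel s p ν L Ks
  kernel_t : IsKernel t p ν L Kt
  coeff_a : IsCoefficient a
  coeff_b : IsCoefficient b
  bounds : ∀ᵐ z : Rn n × Rn n, ν ≤ a z.1 z.2 + b z.1 z.2 ∧ a z.1 z.2 + b z.1 z.2 ≤ L

/-- Hölder continuity of `b` on `ℝⁿ × ℝⁿ` with exponent `α` and constant `H`. -/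
def IsHolderCoeff {n : ℕ} (α H : ℝ) (b : Rn n → Rn n → ℝ) : Prop :=
  ∀ x₁ y₁ x₂ y₂, |b x₁ y₁ - b x₂ y₂| ≤ H * (‖x₁ - x₂‖ + ‖y₁ - y₂‖) ^ α

/-- `C_Ω = (ℝⁿ × ℝⁿ) \ ((ℝⁿ \ Ω) × (ℝⁿ \ Ω))`. -/
def interactionSet {n : ℕ} (Ω : Set (Rn n)) : Set (Rn n × Rn n) := (Ωᶜ ×ˢ Ωᶜ)ᶜ

/-- The admissible class `𝒜(Ω)`: measurable functions on `ℝⁿ` that are in `L^p(Ω)` and have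
finite energy on `C_Ω`. -/
def admissible {n : ℕ} (s t p : ℝ) (a b : Rn n → Rn n → ℝ) (Ω : Set (Rn n)) :
    Set (Rn n → ℝ) :=
  {f | AEMeasurable f volume ∧ MemLp f (ENNReal.ofReal p) (volume.restrict Ω) ∧
    ∫⁻ z in interactionSet Ω, ENNReal.ofReal
      (a z.1 z.2 * (|f z.1 - f z.2| ^ p / ‖z.1 - z.2‖ ^ ((n : ℝ) + s * p))
        + b z.1 z.2 * (|f z.1 - f z.2| ^ p / ‖z.1 - z.2‖ ^ ((n : ℝ) + t * p))) < ∞}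

/-- The left-hand side of the weak formulation. -/
def weakForm {n : ℕ} (p : ℝ) (a b Ks Kt : Rn n → Rn n → ℝ) (Ω : Set (Rn n))
    (u φ : Rn n → ℝ) : ℝ :=
  (∫ z in interactionSet Ω, a z.1 z.2 * (|u z.1 - u z.2| ^ (p - 2) * (u z.1 - u z.2))
      * (φ z.1 - φ z.2) * Ks z.1 z.2)
    + ∫ z in interactionSet Ω, b z.1 z.2 * (|u z.1 - u z.2| ^ (p - 2) * (u z.1 - u z.2))
      * (φ z.1 - φ z.2) * Kt z.1 z.2

/-- `u ∈ 𝒜(Ω)` is a weak solution. -/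
def IsWeakSolution {n : ℕ} (s t p : ℝ) (a b Ks Kt : Rn n → Rn n → ℝ) (Ω : Set (Rn n))
    (u : Rn n → ℝ) : Prop :=
  u ∈ admissible s t p a b Ω ∧
    ∀ φ ∈ admissible s t p a b Ω, (∀ᵐ x, x ∉ Ω → φ x = 0) →
      weakForm p a b Ks Kt Ω u φ = 0

/-- `u ∈ 𝒜(Ω)` is a weak subsolution. -/
def IsWeakSubsolution {n : ℕ} (s t p : ℝ) (a b Ks Kt : Rn n → Rn n → ℝ) (Ω : Set (Rn n))
    (u : Rn n → ℝ) : Prop :=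
  u ∈ admissible s t p a b Ω ∧
    ∀ φ ∈ admissible s t p a b Ω, (∀ᵐ x, 0 ≤ φ x) → (∀ᵐ x, x ∉ Ω → φ x = 0) →
      weakForm p a b Ks Kt Ω u φ ≤ 0

/-- The nonlocal tail `T(f; x₀, r, ρ)`. As the coefficients are only controlled almost
everywhere, the supremum over `x ∈ B_ρ(x₀)` is the essential one (it is at most the pointwise
one). -/
def nonlocalTail {n : ℕ} (s t p : ℝ) (a b : Rn n → Rn n → ℝ) (f : Rn n → ℝ) (x₀ : Rn n) (r ρ : ℝ) :
    ℝ≥0∞ :=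
  essSup (fun x => ∫⁻ y in (ball x₀ r)ᶜ, ENNReal.ofReal
      (a x y * (|f y| ^ (p - 1) / ‖y - x₀‖ ^ ((n : ℝ) + s * p))
        + b x y * (|f y| ^ (p - 1) / ‖y - x₀‖ ^ ((n : ℝ) + t * p))))
    (volume.restrict (ball x₀ ρ))

/-- The tail space `𝒯(ℝⁿ)`: functions in `L^{p-1}_loc(ℝⁿ)` all of whose tails are finite. -/
def tailSpace {n : ℕ} (s t p : ℝ) (a b : Rn n → Rn n → ℝ) : Set (Rn n → ℝ) :=
  {f | (∀ K : Set (Rn n), IsCompact K → MemLp f (ENNReal.ofReal (p - 1)) (volume.restrict K)) ∧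
    ∀ (x₀ : Rn n) (r ρ : ℝ), 0 < r → 0 < ρ → nonlocalTail s t p a b f x₀ r ρ < ∞}

/-- `G_{B_r(x₀)}(τ)`, the (essential) supremum over `x, y ∈ B_r(x₀)` of
`a(x,y) τ^p / r^{sp} + b(x,y) τ^p / r^{tp}`. -/
def bigG {n : ℕ} (s t p : ℝ) (a b : Rn n → Rn n → ℝ) (x₀ : Rn n) (r τ : ℝ) : ℝ :=
  (essSup (fun z : Rn n × Rn n => ENNReal.ofReal
      (a z.1 z.2 * (τ ^ p / r ^ (s * p)) + b z.1 z.2 * (τ ^ p / r ^ (t * p))))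
    (volume.restrict (ball x₀ r ×ˢ ball x₀ r))).toReal

/-- `g_{B_r(x₀)}(τ) = G_{B_r(x₀)}(τ) / τ` (with value `0` at `τ = 0`). -/
def smallG {n : ℕ} (s t p : ℝ) (a b : Rn n → Rn n → ℝ) (x₀ : Rn n) (r τ : ℝ) : ℝ :=
  bigG s t p a b x₀ r τ / τ

/-- The inverse of `g_{B_r(x₀)} : [0, ∞) → [0, ∞)`. -/
def smallGInv {n : ℕ} (s t p : ℝ) (a b : Rn n → Rn n → ℝ) (x₀ : Rn n) (r : ℝ) : ℝ → ℝ :=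
  Function.invFunOn (smallG s t p a b x₀ r) (Ici 0)

/-- The positive part `f₊ = max {f, 0}`. -/
def positivePart {n : ℕ} (f : Rn n → ℝ) : Rn n → ℝ := fun x => max (f x) 0

/-- The essential supremum of a real function over a set, as an extended real number. -/
def essSupOn {n : ℕ} (U : Set (Rn n)) (f : Rn n → ℝ) : EReal :=
  essSup (fun x => (f x : EReal)) (volume.restrict U)

/-- The averaged norm `(⨍_{B_r(x₀)} |f|^p dx)^{1/p}`. -/
def meanLp {n : ℕ} (p : ℝ) (f : Rn n → ℝ) (x₀ : Rn n) (r : ℝ) : ℝ :=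
  (⨍ x in ball x₀ r, |f x| ^ p) ^ (1 / p)

/-- `u ∈ L^∞_loc(Ω)`. -/
def IsLocallyBounded {n : ℕ} (Ω : Set (Rn n)) (u : Rn n → ℝ) : Prop :=
  ∀ K : Set (Rn n), K ⊆ Ω → IsCompact K → MemLp u ∞ (volume.restrict K)

/-- A bounded domain in `ℝⁿ`. -/
structure IsBoundedDomain {n : ℕ} (Ω : Set (Rn n)) : Prop where
  isOpen : IsOpen Ω
  isConnected : IsConnected Ω
  isBounded : Bornology.IsBounded Ω

/-- The first estimate, for `v` with the nonnegative function `w` on the right-hand side. -/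
def Estimate₁ {n : ℕ} (s t p : ℝ) (a b : Rn n → Rn n → ℝ) (c : ℝ) (x₀ : Rn n) (r : ℝ)
    (v w : Rn n → ℝ) : Prop :=
  essSupOn (ball x₀ (r / 2)) v ≤
    ((c * r ^ (-(t - s) / min (s * p / n) (p - 1)) * meanLp p w x₀ r
      + (r ^ (s * p) * (nonlocalTail s t p a b w x₀ (r / 2) r).toReal) ^ (1 / (p - 1)) : ℝ) : EReal)

/-- The second estimate, for `v` with the nonnegative function `w` on the right-hand side,
together with the identity that rewrites the tail term through `g⁻¹`. -/
def Estimate₂ {n : ℕ} (s t p : ℝ) (a b : Rn n → Rn n → ℝ) (c : ℝ) (x₀ : Rn n) (r : ℝ)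
    (v w : Rn n → ℝ) : Prop :=
  essSupOn (ball x₀ (r / 2)) v ≤
      ((c * meanLp p w x₀ r
        + (1 / bigG s t p a b x₀ r 1 * (nonlocalTail s t p a b w x₀ (r / 2) r).toReal)
            ^ (1 / (p - 1)) : ℝ) : EReal) ∧
    BijOn (smallG s t p a b x₀ r) (Ici 0) (Ici 0) ∧
    c * meanLp p w x₀ r
        + (1 / bigG s t p a b x₀ r 1 * (nonlocalTail s t p a b w x₀ (r / 2) r).toReal) ^ (1 / (p - 1))
      = c * meanLp p w x₀ r
        + smallGInv s t p a b x₀ r (nonlocalTail s t p a b w x₀ (r / 2) r).toReal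

end

/-! The proof is a De Giorgi iteration in which the two orders `s` and `t` enter only through one
pair of numbers. On `B_r × B_r` let `0 < m ≤ a r^{-sp} + b r^{-tp} ≤ M`. Since `|x - y| ≤ 2r` there,
the weight `a |x-y|^{-n-sp} + b |x-y|^{-n-tp}` is, up to constants, at least `m r^{sp}
|x-y|^{-n-sp}` and at most `M r^{tp} |x-y|^{-n-tp}` (`scaledCoeff_mul_le_density`,
`density_le_scaledCoeff_mul`).

Testing with `(u-k)₊ η^p`, where `η` is a Lipschitz cutoff, gives a Caccioppoli inequality
(`caccioppoli_of_mixedKernel`). Its left side controls `m r^{sp}` times a `W^{s,p}` energy of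
`(u-k)₊`. The right side consists of `M ∫ (u-k)₊^p` and the tail times `∫ (u-k)₊` (`caccioppoli`). A
Faber–Krahn inequality, `faber_krahn`, gains a power `sp/n` of the measure of `{u > k}`; it holds
for every relation between `sp` and `n`. Chebyshev's inequality between two levels turns this gain
into a superlinear recursion for `Y_j = ∫ (u-k_j)₊^p` on shrinking balls, and `geometric_decay`
forces `Y_j → 0` once `Y_0` is small.

The outcome is `ae_le_of_deGiorgi`: `u ≤ k` on `B_{r/2}` as soon as the tail is at most `M k^{p-1}`
and `c (M/m)^{n/(sp²)}` times the mean of `u₊` is at most `k`. For (A) one takes `m = ν r^{-sp}` and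
`M = L r^{-tp}`, so the ratio costs a negative power of `r`. For (B) one takes `M = G_{B_r}(1)`; the
Hölder condition with `(t-s)p ≤ α` makes `M/m` a constant (`scaledCoeff_le_mul`). Solutions are
handled by applying the subsolution bound to `u` and `-u`. -/

/-! ### Pointwise inequalities and the recursion lemma. -/

theorem mul_rpow_sub_one_mul_le {p X Y : ℝ} (hp : 1 < p) (hX : 0 ≤ X) (hY : 0 ≤ Y) :
    p * X ^ (p - 1) * Y ≤ X ^ p / 2 + (2 * p) ^ p * Y ^ p := by
  have hsplit : ∀ Z : ℝ, 0 ≤ Z → Z ^ p = Z ^ (p - 1) * Z := fun Z hZ => by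
    rw [← Real.rpow_add_one' hZ (by linarith)]; congr 1; ring
  -- Either `pY ≤ X/2` and the first term suffices, or `X ≤ 2pY` and the left side is at most half
  -- of `(2pY)^p`.
  rcases le_total (p * Y) (X / 2) with h | h
  · have h0 : 0 ≤ X ^ (p - 1) := by positivity
    have h1 : 0 ≤ (2 * p) ^ p * Y ^ p := by positivity
    rw [hsplit X hX]
    nlinarith
  · have h1 : X ^ (p - 1) ≤ (2 * p * Y) ^ (p - 1) :=
      Real.rpow_le_rpow hX (by linarith) (by linarith)
    have h2 : (2 * p) ^ p * Y ^ p = (2 * p * Y) ^ (p - 1) * (2 * p * Y) := by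
      rw [← Real.mul_rpow (by positivity) hY, hsplit _ (by positivity)]
    have h3 : 0 ≤ (2 * p * Y) ^ (p - 1) := by positivity
    have h4 : 0 ≤ X ^ p / 2 := by positivity
    have h5 : 0 ≤ p * Y := by positivity
    rw [h2]
    nlinarith [mul_le_mul_of_nonneg_right h1 h5, mul_nonneg h3 h5]

/-- Bernoulli's inequality for `x / y`, multiplied by `y ^ p`. -/
theorem rpow_sub_rpow_le {p x y : ℝ} (hp : 1 ≤ p) (hx : 0 ≤ x) (hxy : x ≤ y) :
    y ^ p - x ^ p ≤ p * y ^ (p - 1) * (y - x) := by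
  rcases hxy.eq_or_lt with rfl | hlt
  · simp
  have hy : 0 < y := hx.trans_lt hlt
  have h := one_add_mul_self_le_rpow_one_add (s := x / y - 1) (p := p)
    (by have := div_nonneg hx hy.le; linarith) hp
  rw [add_sub_cancel, Real.div_rpow hx hy.le, le_div_iff₀ (by positivity)] at h
  have h2 : y ^ p = y ^ (p - 1) * y := by
    rw [← Real.rpow_add_one' hy.le (by linarith)]; congr 1; ring
  have h3 : (1 + p * (x / y - 1)) * y ^ p = y ^ p + p * y ^ (p - 1) * (x - y) := by
    rw [h2]; field_simp
  rw [h3] at h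
  linarith

/-- The truncation `(τ - k)₊` as a function of `τ`. -/
noncomputable def trunc (k τ : ℝ) : ℝ := max (τ - k) 0

theorem trunc_nonneg (k τ : ℝ) : 0 ≤ trunc k τ := le_max_right _ _

theorem abs_trunc_sub_le (k τ σ : ℝ) : |trunc k τ - trunc k σ| ≤ |τ - σ| := by
  have := abs_max_sub_max_le_abs (τ - k) (σ - k) 0
  simpa [trunc] using this

theorem trunc_of_le {k τ : ℝ} (h : τ ≤ k) : trunc k τ = 0 := max_eq_right (by linarith)

theorem trunc_of_ge {k τ : ℝ} (h : k ≤ τ) : trunc k τ = τ - k := max_eq_left (by linarith)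

theorem trunc_mono {k τ σ : ℝ} (h : τ ≤ σ) : trunc k τ ≤ trunc k σ :=
  max_le_max (by linarith) le_rfl

theorem trunc_anti {k l τ : ℝ} (h : k ≤ l) : trunc l τ ≤ trunc k τ :=
  max_le_max (by linarith) le_rfl

theorem trunc_le_max {k τ : ℝ} (hk : 0 ≤ k) : trunc k τ ≤ max τ 0 :=
  max_le_max (by linarith) le_rfl

theorem trunc_le_abs {k τ : ℝ} (hk : 0 ≤ k) : trunc k τ ≤ |τ| :=
  (trunc_le_max hk).trans (max_le (le_abs_self _) (abs_nonneg _))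

/-- The monotone function `τ ↦ |τ|^{p-2} τ`. -/
noncomputable def signPow (p τ : ℝ) : ℝ := |τ| ^ (p - 2) * τ

theorem signPow_neg (p τ : ℝ) : signPow p (-τ) = -signPow p τ := by simp [signPow]

theorem signPow_of_nonneg {p τ : ℝ} (hp : 1 < p) (hτ : 0 ≤ τ) : signPow p τ = τ ^ (p - 1) := by
  rw [signPow, abs_of_nonneg hτ, ← Real.rpow_add_one' hτ (by linarith)]
  congr 1; ring

theorem abs_signPow {p : ℝ} (hp : 1 < p) (τ : ℝ) : |signPow p τ| = |τ| ^ (p - 1) := by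
  rw [signPow, abs_mul, abs_of_nonneg (by positivity : 0 ≤ |τ| ^ (p - 2)),
    ← Real.rpow_add_one' (abs_nonneg _) (by linarith)]
  congr 1; ring

/-- The algebraic core of the Caccioppoli inequality. Write `W ≥ V` for the truncations. If `e₂ ≤
e₁`, the product is already at least `(W-V)^p e₁^p`. If `e₁ ≤ e₂`, the defect `W (e₂^p - e₁^p)` is
linearized and absorbed by Young's inequality, which leaves half of the good term. -/
theorem caccioppoli_pointwise_of_le {p k u₁ u₂ e₁ e₂ : ℝ} (hp : 1 < p) (he₁ : 0 ≤ e₁)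
    (he₂ : 0 ≤ e₂) (hu : u₂ ≤ u₁) :
    |trunc k u₁ - trunc k u₂| ^ p * max e₁ e₂ ^ p / 2 ≤
      signPow p (u₁ - u₂) * (trunc k u₁ * e₁ ^ p - trunc k u₂ * e₂ ^ p)
        + (2 * p) ^ p * max (trunc k u₁) (trunc k u₂) ^ p * |e₁ - e₂| ^ p := by
  have hWV := trunc_mono (k := k) hu
  have hV := trunc_nonneg k u₂
  have hW := trunc_nonneg k u₁
  have hd : |trunc k u₁ - trunc k u₂| ≤ |u₁ - u₂| := abs_trunc_sub_le _ _ _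
  have hdeq : 0 < trunc k u₂ → u₁ - u₂ = trunc k u₁ - trunc k u₂ := fun h => by
    have h2 : k ≤ u₂ := by
      by_contra hc
      rw [trunc_of_le (by linarith)] at h
      exact lt_irrefl _ h
    rw [trunc_of_ge h2, trunc_of_ge (h2.trans hu)]; ring
  rw [signPow_of_nonneg hp (by linarith), max_eq_left hWV]
  rw [abs_of_nonneg (by linarith), abs_of_nonneg (by linarith)] at hd
  rw [abs_of_nonneg (by linarith : 0 ≤ trunc k u₁ - trunc k u₂)]
  generalize trunc k u₁ = W at *
  generalize trunc k u₂ = V at *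
  have hE₁ : 0 ≤ e₁ ^ p := by positivity
  have hE₂ : 0 ≤ e₂ ^ p := by positivity
  have hsplit : ∀ Z : ℝ, 0 ≤ Z → Z ^ p = Z ^ (p - 1) * Z := fun Z hZ => by
    rw [← Real.rpow_add_one' hZ (by linarith)]; congr 1; ring
  -- If `V > 0`, the increments of `u` and of its truncation coincide. If `V = 0`, the bracket is
  -- nonnegative, so truncating the increment only lowers the product.
  have key : (W - V) ^ (p - 1) * (W * e₁ ^ p - V * e₂ ^ p) ≤
      (u₁ - u₂) ^ (p - 1) * (W * e₁ ^ p - V * e₂ ^ p) := by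
    rcases hV.eq_or_lt with h | h
    · subst h
      apply mul_le_mul_of_nonneg_right (Real.rpow_le_rpow (by linarith) hd (by linarith))
      have := mul_nonneg hW hE₁
      linarith
    · rw [hdeq h]
  have hWVp : 0 ≤ W - V := by linarith
  have hrest : 0 ≤ (2 * p) ^ p * W ^ p * |e₁ - e₂| ^ p := by positivity
  rcases le_total e₂ e₁ with h | h
  · rw [max_eq_left h]
    have h2 : e₂ ^ p ≤ e₁ ^ p := Real.rpow_le_rpow he₂ h (by linarith)
    have h3 : (W - V) ^ p * e₁ ^ p ≤ (W - V) ^ (p - 1) * (W * e₁ ^ p - V * e₂ ^ p) := by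
      rw [hsplit _ hWVp, mul_assoc]
      apply mul_le_mul_of_nonneg_left _ (by positivity)
      nlinarith
    have h4 : 0 ≤ (W - V) ^ p * e₁ ^ p := by positivity
    linarith
  · rw [max_eq_right h, abs_of_nonpos (by linarith : e₁ - e₂ ≤ 0)]
    rw [abs_of_nonpos (by linarith : e₁ - e₂ ≤ 0)] at hrest
    have h2 := rpow_sub_rpow_le hp.le he₁ h
    have h3 := mul_rpow_sub_one_mul_le (X := (W - V) * e₂) (Y := W * (e₂ - e₁)) hp
      (by positivity) (mul_nonneg hW (by linarith))
    rw [Real.mul_rpow hWVp he₂, Real.mul_rpow hWVp he₂,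
      Real.mul_rpow hW (by linarith)] at h3
    have h4 : (W - V) ^ (p - 1) * (W * (e₂ ^ p - e₁ ^ p)) ≤
        (W - V) ^ (p - 1) * (W * (p * e₂ ^ (p - 1) * (e₂ - e₁))) := by
      gcongr
    have h5 : (W - V) ^ (p - 1) * (W * e₁ ^ p - V * e₂ ^ p) =
        (W - V) ^ p * e₂ ^ p - (W - V) ^ (p - 1) * (W * (e₂ ^ p - e₁ ^ p)) := by
      rw [hsplit _ hWVp]; ring
    rw [neg_sub]
    nlinarith

theorem caccioppoli_pointwise {p : ℝ} (k u₁ u₂ : ℝ) {e₁ e₂ : ℝ} (hp : 1 < p) (he₁ : 0 ≤ e₁)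
    (he₂ : 0 ≤ e₂) :
    |trunc k u₁ - trunc k u₂| ^ p * max e₁ e₂ ^ p / 2 ≤
      signPow p (u₁ - u₂) * (trunc k u₁ * e₁ ^ p - trunc k u₂ * e₂ ^ p)
        + (2 * p) ^ p * (trunc k u₁ ^ p + trunc k u₂ ^ p) * |e₁ - e₂| ^ p := by
  have hW := trunc_nonneg k u₁
  have hV := trunc_nonneg k u₂
  have hmax : max (trunc k u₁) (trunc k u₂) ^ p ≤ trunc k u₁ ^ p + trunc k u₂ ^ p := by
    have h1 : 0 ≤ trunc k u₁ ^ p := by positivity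
    have h2 : 0 ≤ trunc k u₂ ^ p := by positivity
    rcases max_choice (trunc k u₁) (trunc k u₂) with h | h <;> rw [h] <;> linarith
  have hfin : (2 * p) ^ p * max (trunc k u₁) (trunc k u₂) ^ p * |e₁ - e₂| ^ p ≤
      (2 * p) ^ p * (trunc k u₁ ^ p + trunc k u₂ ^ p) * |e₁ - e₂| ^ p := by gcongr
  rcases le_total u₂ u₁ with h | h
  · exact (caccioppoli_pointwise_of_le hp he₁ he₂ h).trans (by linarith)
  · have h1 := caccioppoli_pointwise_of_le (k := k) hp he₂ he₁ h
    rw [abs_sub_comm, max_comm, max_comm (trunc k u₂), abs_sub_comm e₂, ← neg_sub u₁,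
      signPow_neg] at h1
    linarith

/-- For pairs whose second point lies where the test function vanishes. The product is negative only
if `u₂ > u₁ > k`, and then `u₂ - u₁ ≤ (u₂ - k)₊`. This is the source of the tail. -/
theorem exterior_pointwise {p : ℝ} (k u₁ u₂ : ℝ) {E : ℝ} (hp : 1 < p) (hE : 0 ≤ E) :
    -(trunc k u₂ ^ (p - 1) * (trunc k u₁ * E)) ≤ signPow p (u₁ - u₂) * (trunc k u₁ * E) := by
  rw [← neg_mul]
  have hV := trunc_nonneg k u₂
  rcases le_total u₁ k with h | h
  · simp [trunc_of_le h]
  apply mul_le_mul_of_nonneg_right _ (mul_nonneg (trunc_nonneg _ _) hE)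
  rcases le_total u₂ u₁ with h2 | h2
  · rw [signPow_of_nonneg hp (by linarith)]
    have h1 : 0 ≤ (u₁ - u₂) ^ (p - 1) := Real.rpow_nonneg (by linarith) _
    have h3 : 0 ≤ trunc k u₂ ^ (p - 1) := by positivity
    linarith
  · rw [← neg_sub u₂, signPow_neg, signPow_of_nonneg hp (by linarith), neg_le_neg_iff]
    apply Real.rpow_le_rpow (by linarith) _ (by linarith)
    rw [trunc_of_ge (h.trans h2)]; linarith

/-- Above the level `l` the lower truncation is at least `l - k`. Both Chebyshev-type bounds of the
iteration rest on this. -/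
theorem trunc_level_le {k l τ : ℝ} (hkl : k < l) {q : ℝ} (hq : 0 ≤ q) (h : 0 < trunc l τ) :
    1 ≤ (trunc k τ / (l - k)) ^ q := by
  apply Real.one_le_rpow _ hq
  have h2 : l ≤ τ := by
    by_contra hc
    rw [trunc_of_le (by linarith)] at h
    exact lt_irrefl _ h
  rw [trunc_of_ge (by linarith), le_div_iff₀ (by linarith)]; linarith

theorem trunc_le_mul_rpow {p k l τ : ℝ} (hp : 1 < p) (hkl : k < l) :
    trunc l τ ≤ (l - k) ^ (1 - p) * trunc k τ ^ p := by
  have h0 := trunc_nonneg k τ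
  have hd : 0 < l - k := by linarith
  rcases (trunc_nonneg l τ).eq_or_lt with h | h
  · rw [← h]; positivity
  have h1 := trunc_level_le hkl (q := p - 1) (by linarith) h
  have h2 : trunc k τ ^ p = trunc k τ ^ (p - 1) * trunc k τ := by
    rw [← Real.rpow_add_one' h0 (by linarith)]; congr 1; ring
  calc trunc l τ ≤ trunc k τ := trunc_anti hkl.le
    _ ≤ (trunc k τ / (l - k)) ^ (p - 1) * trunc k τ := le_mul_of_one_le_left h0 h1
    _ = (l - k) ^ (1 - p) * trunc k τ ^ p := by
      rw [Real.div_rpow h0 hd.le, h2, ← neg_sub p 1, Real.rpow_neg hd.le]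
      field_simp

/-- The ratio `q = b^{-1/θ}` satisfies `q^θ = b⁻¹`. Hence the extra factor `(q^j)^θ` in the
superlinear term cancels the growth `b^j`, and the smallness of `Y 0` supplies one more factor `q`
at every step. -/
theorem geometric_decay {Y : ℕ → ℝ} {C b θ : ℝ} (hC : 0 ≤ C) (hb : 0 < b)
    (hθ : 0 < θ) (hY : ∀ j, 0 ≤ Y j)
    (hstep : ∀ j, Y (j + 1) ≤ C * b ^ j * Y j ^ (1 + θ))
    (h0 : C * Y 0 ^ θ ≤ b ^ (-(1 / θ))) (j : ℕ) :
    Y j ≤ (b ^ (-(1 / θ))) ^ j * Y 0 := by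
  set q := b ^ (-(1 / θ)) with hq
  have hqpos : 0 < q := by positivity
  have hqθ : q ^ θ = b⁻¹ := by
    rw [hq, ← Real.rpow_mul hb.le, ← Real.rpow_neg_one]; congr 1; field_simp
  induction j with
  | zero => simp
  | succ j ih =>
    have hY0 := hY 0
    have h1 : (q ^ j * Y 0) ^ (1 + θ) = (q ^ j * Y 0) * ((b⁻¹) ^ j * Y 0 ^ θ) := by
      rw [Real.rpow_one_add' (by positivity) (by linarith), Real.mul_rpow (by positivity) hY0,
        ← Real.rpow_natCast q j, ← Real.rpow_mul hqpos.le, mul_comm (j : ℝ) θ,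
        Real.rpow_mul hqpos.le, hqθ]
      norm_num
    calc Y (j + 1) ≤ C * b ^ j * Y j ^ (1 + θ) := hstep j
      _ ≤ C * b ^ j * (q ^ j * Y 0) ^ (1 + θ) := by
        gcongr
        exact hY j
      _ = (C * Y 0 ^ θ) * (q ^ j * Y 0) := by
        rw [h1, inv_pow]; field_simp
      _ ≤ q * (q ^ j * Y 0) := by gcongr
      _ = q ^ (j + 1) * Y 0 := by ring

/-! ### Integrals of radial kernels. -/

section KernelIntegrals

variable {n : ℕ}

theorem lintegral_sub_left_norm (x : Rn n) (f : ℝ → ℝ≥0∞) :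
    ∫⁻ y, f ‖x - y‖ = ∫⁻ y : Rn n, f ‖y‖ := by
  exact lintegral_sub_left_eq_self (fun y => f ‖y‖) x

theorem nontrivial_Rn (hn : 1 ≤ n) : Nontrivial (Rn n) := by
  have : Nonempty (Fin n) := ⟨⟨0, hn⟩⟩
  infer_instance

/-- Polar coordinates. It is needed with `γ = p - tp`: the Lipschitz bound of a cutoff contributes
`|x-y|^p` against the kernel `|x-y|^{-n-tp}`. -/
theorem exists_setLIntegral_ball_rpow_le (hn : 1 ≤ n) {γ : ℝ} (hγ : 0 < γ) :
    ∃ C : ℝ, 0 < C ∧ ∀ (x : Rn n) (R : ℝ), 0 < R →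
      ∫⁻ y in ball x R, ENNReal.ofReal (‖x - y‖ ^ (γ - n)) ≤ ENNReal.ofReal (C * R ^ γ) := by
  have := nontrivial_Rn hn
  set ω : ℝ := (volume : Measure (Rn n)).real (ball 0 1) with hω
  have hωpos : 0 < ω := by
    rw [hω, measureReal_def]
    exact ENNReal.toReal_pos (measure_ball_pos _ _ one_pos).ne' measure_ball_lt_top.ne
  have hn0 : (0 : ℝ) < n := by exact_mod_cast hn
  have hmul : ∀ y : ℝ, 0 < y → y ^ (n - 1) • y ^ (γ - n) = y ^ (γ - 1) := fun y hy => by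
    rw [smul_eq_mul, ← Real.rpow_natCast, ← Real.rpow_add hy]
    congr 1
    rw [Nat.cast_sub hn]; push_cast; ring
  refine ⟨n * ω / γ, by positivity, fun x R hR => ?_⟩
  have hint : IntegrableOn (fun y : ℝ => y ^ (γ - 1)) (Ioo 0 R) := by
    rw [intervalIntegral.integrableOn_Ioo_rpow_iff hR]; linarith
  have h1 : IntegrableOn (fun y : Rn n => ‖y‖ ^ (γ - n)) (ball 0 R) := by
    rw [integrableOn_fun_norm_addHaar volume (f := fun y : ℝ => y ^ (γ - n))]
    refine hint.congr_fun (fun y hy => ?_) measurableSet_Ioo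
    simp only [finrank_euclideanSpace_fin]
    exact (hmul y hy.1).symm
  have h2 : ∫ y in ball (0 : Rn n) R, ‖y‖ ^ (γ - n) = n * ω / γ * R ^ γ := by
    rw [← integral_indicator measurableSet_ball]
    have : (ball (0 : Rn n) R).indicator (fun y : Rn n => ‖y‖ ^ (γ - n)) =
        fun y : Rn n => (Iio R).indicator (fun y : ℝ => y ^ (γ - n)) ‖y‖ := by
      ext y; simp [indicator]
    rw [this, integral_fun_norm_addHaar]
    have h3 : ∫ y in Ioi (0 : ℝ), y ^ (Module.finrank ℝ (Rn n) - 1) •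
        (Iio R).indicator (fun y : ℝ => y ^ (γ - n)) y = ∫ y in (0 : ℝ)..R, y ^ (γ - 1) := by
      rw [intervalIntegral.integral_of_le hR.le, integral_Ioc_eq_integral_Ioo,
        ← integral_indicator measurableSet_Ioi, ← integral_indicator measurableSet_Ioo]
      congr 1
      ext y
      by_cases hy : 0 < y <;> by_cases hy2 : y < R <;> simp [indicator, hy, hy2]
      simpa using hmul y hy
    rw [h3, integral_rpow (Or.inl (by linarith))]
    simp [hγ.ne', ← hω]
    field_simp
  have h4 : ∫⁻ y in ball x R, ENNReal.ofReal (‖x - y‖ ^ (γ - n)) =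
      ∫⁻ y in ball (0 : Rn n) R, ENNReal.ofReal (‖y‖ ^ (γ - n)) := by
    rw [← lintegral_indicator measurableSet_ball, ← lintegral_indicator measurableSet_ball]
    have := lintegral_sub_left_norm x
      ((Iio R).indicator fun d => ENNReal.ofReal (d ^ (γ - n)))
    convert this using 2 with y
    · ext y
      simp [indicator, dist_eq_norm, norm_sub_rev x y]
    · ext y
      simp [indicator]
  rw [h4, ← h2, ofReal_integral_eq_lintegral_ofReal h1]
  exact Filter.Eventually.of_forall fun y => by positivity

/-- The factor `min 1 d ^ p` is what the increment of a bounded Lipschitz function provides.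
Convergence at the origin uses `σ < p`, at infinity `0 < σ`. The bound is uniform in `x` by
translation. -/
theorem lintegral_min_rpow_div_lt_top (hn : 1 ≤ n) {p σ : ℝ} (hσ : 0 < σ)
    (hσp : σ < p) (x : Rn n) :
    ∫⁻ y, ENNReal.ofReal (min 1 ‖x - y‖ ^ p / ‖x - y‖ ^ ((n : ℝ) + σ)) ≤
      ∫⁻ y : Rn n, ENNReal.ofReal (min 1 ‖y‖ ^ p / ‖y‖ ^ ((n : ℝ) + σ)) ∧
    ∫⁻ y : Rn n, ENNReal.ofReal (min 1 ‖y‖ ^ p / ‖y‖ ^ ((n : ℝ) + σ)) < ∞ := by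
  have := nontrivial_Rn hn
  refine ⟨(lintegral_sub_left_norm x
    (fun d => ENNReal.ofReal (min 1 d ^ p / d ^ ((n : ℝ) + σ)))).le, ?_⟩
  have h : Integrable (fun y : Rn n => min 1 ‖y‖ ^ p / ‖y‖ ^ ((n : ℝ) + σ)) := by
    rw [integrable_fun_norm_addHaar volume (f := fun d : ℝ => min 1 d ^ p / d ^ ((n : ℝ) + σ)),
      ← Ioo_union_Ici_eq_Ioi (zero_lt_one' ℝ)]
    have hmul : ∀ y : ℝ, 0 < y → y ^ (n - 1) / y ^ ((n : ℝ) + σ) = y ^ (-1 - σ) := fun y hy => by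
      rw [← Real.rpow_natCast, ← Real.rpow_sub hy]
      congr 1
      rw [Nat.cast_sub hn]; push_cast; ring
    apply IntegrableOn.union
    · have : IntegrableOn (fun y : ℝ => y ^ (p - σ - 1)) (Ioo 0 1) := by
        rw [intervalIntegral.integrableOn_Ioo_rpow_iff one_pos]; linarith
      refine this.congr_fun (fun y hy => ?_) measurableSet_Ioo
      simp only [finrank_euclideanSpace_fin, smul_eq_mul]
      rw [min_eq_right hy.2.le, mul_div_assoc', mul_div_right_comm, hmul y hy.1,
        ← Real.rpow_add hy.1]
      congr 1; ring
    · have : IntegrableOn (fun y : ℝ => y ^ (-1 - σ)) (Ici 1) := by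
        rw [integrableOn_Ici_iff_integrableOn_Ioi]
        exact integrableOn_Ioi_rpow_of_lt (by linarith) one_pos
      refine this.congr_fun (fun y hy => ?_) measurableSet_Ici
      have hy0 : (0 : ℝ) < y := lt_of_lt_of_le one_pos hy
      simp only [finrank_euclideanSpace_fin, smul_eq_mul]
      rw [min_eq_left hy, Real.one_rpow, mul_one_div, hmul y hy0]
  exact h.lintegral_lt_top

theorem ae_fst_ne_snd (hn : 1 ≤ n) : ∀ᵐ z : Rn n × Rn n, z.1 ≠ z.2 := by
  have := nontrivial_Rn hn
  have hm : MeasurableSet {z : Rn n × Rn n | z.1 ≠ z.2} :=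
    (measurableSet_eq_fun measurable_fst measurable_snd).compl
  rw [Measure.volume_eq_prod, Measure.ae_prod_iff_ae_ae hm]
  filter_upwards with x
  have : ({x} : Set (Rn n))ᶜ ∈ ae volume := compl_mem_ae_iff.mpr (measure_singleton x)
  filter_upwards [this] with y hy
  exact fun h => hy h.symm

end KernelIntegrals

/-! ### A fractional Faber–Krahn inequality. -/

/-- Take `R` with `|B_R| = 2|A|`, where `A` is the positivity set. Around each `x` at least half of
`B_R(x)` lies where `w = 0`; there `|w x - w y| = w x` and `|x - y| ≤ R`. Hence `w(x)^p |A|` is at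
most `R^{n+sp}` times the inner energy integral, and `R^{n+sp}` is proportional to `|A|^{1+sp/n}`.
-/
theorem faber_krahn {n : ℕ} (hn : 1 ≤ n) {p s : ℝ} (hp : 0 < p) (hs : 0 < s) :
    ∃ C : ℝ, 0 < C ∧ ∀ (x₀ : Rn n) (ρ' ρ : ℝ), ρ' < ρ → ∀ w : Rn n → ℝ,
      AEMeasurable w → (∀ x, 0 ≤ w x) →
      ∫⁻ x in ball x₀ ρ', ENNReal.ofReal (w x ^ p) ≤
        ENNReal.ofReal C * volume ({x | 0 < w x} ∩ ball x₀ ρ) ^ (s * p / n) *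
          ((∫⁻ x in ball x₀ ρ', ∫⁻ y in ball x₀ ρ,
              ENNReal.ofReal (|w x - w y| ^ p / ‖x - y‖ ^ ((n : ℝ) + s * p)))
            + ENNReal.ofReal ((ρ - ρ') ^ (-(s * p))) *
              ∫⁻ x in ball x₀ ρ', ENNReal.ofReal (w x ^ p)) := by
  set ω : ℝ := (volume : Measure (Rn n)).real (ball 0 1) with hω
  have hωpos : 0 < ω := by
    rw [hω, measureReal_def]
    exact ENNReal.toReal_pos (measure_ball_pos _ _ one_pos).ne' measure_ball_lt_top.ne
  have hn0 : (0 : ℝ) < n := by exact_mod_cast hn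
  -- The first factor comes from `R^{sp}` and `2 / ω` from `R^n = 2v / ω`; the added `1` covers the
  -- case of a large `R`.
  refine ⟨(2 / ω) ^ (s * p / n) * (2 / ω + 1), by positivity, fun x₀ ρ' ρ hρ w hw hw0 => ?_⟩
  set A := {x | 0 < w x} ∩ ball x₀ ρ with hA
  have hAnull : NullMeasurableSet A := by
    apply NullMeasurableSet.inter _ measurableSet_ball.nullMeasurableSet
    exact nullMeasurableSet_lt aemeasurable_const hw
  have hVtop : volume A ≠ ∞ := measure_ne_top_of_subset inter_subset_right measure_ball_lt_top.ne
  set I := ∫⁻ x in ball x₀ ρ', ENNReal.ofReal (w x ^ p) with hI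
  set E := ∫⁻ x in ball x₀ ρ', ∫⁻ y in ball x₀ ρ,
    ENNReal.ofReal (|w x - w y| ^ p / ‖x - y‖ ^ ((n : ℝ) + s * p)) with hE
  have hsub : ball x₀ ρ' ⊆ ball x₀ ρ := ball_subset_ball hρ.le
  rcases eq_or_ne (volume A) 0 with hV0 | hV0
  · have : I = 0 := by
      rw [hI, setLIntegral_congr_fun_ae measurableSet_ball (g := fun _ => 0), lintegral_zero]
      filter_upwards [measure_eq_zero_iff_ae_notMem.mp hV0] with x hx hxb
      have : ¬ 0 < w x := fun h => hx ⟨h, hsub hxb⟩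
      rw [le_antisymm (not_lt.mp this) (hw0 x), Real.zero_rpow hp.ne', ENNReal.ofReal_zero]
    rw [this]; exact zero_le
  set v := (volume A).toReal with hv
  have hvpos : 0 < v := ENNReal.toReal_pos hV0 hVtop
  have hVv : volume A = ENNReal.ofReal v := (ENNReal.ofReal_toReal hVtop).symm
  set R : ℝ := (2 * v / ω) ^ (1 / (n : ℝ)) with hR
  have hRpos : 0 < R := by positivity
  have hRn : R ^ n = 2 * v / ω := by
    rw [hR, ← Real.rpow_natCast, ← Real.rpow_mul (by positivity)]
    rw [one_div_mul_cancel hn0.ne', Real.rpow_one]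
  have hRsp : R ^ (s * p) = (2 / ω) ^ (s * p / n) * v ^ (s * p / n) := by
    rw [hR, ← Real.rpow_mul (by positivity), ← Real.mul_rpow (by positivity) hvpos.le]
    congr 1 <;> field_simp
  have hVpow : volume A ^ (s * p / n) = ENNReal.ofReal (v ^ (s * p / n)) := by
    rw [hVv, ENNReal.ofReal_rpow_of_pos hvpos]
  have hδ : 0 < ρ - ρ' := by linarith
  rw [hVpow, ← ENNReal.ofReal_mul (by positivity)]
  -- If `R ≤ ρ - ρ'`, the balls `B_R(x)` stay inside `B_ρ`. Otherwise `R^{sp} (ρ-ρ')^{-sp} ≥ 1` and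
  -- the zero-order term alone suffices.
  rcases le_or_gt R (ρ - ρ') with hcase | hcase
  · have hball : ∀ x, volume (ball x R) = volume A + volume A := fun x => by
      rw [Measure.addHaar_ball_of_pos (volume : Measure (Rn n)) x hRpos, finrank_euclideanSpace_fin, hRn, hVv,
        ← ENNReal.ofReal_toReal (measure_ball_lt_top (μ := volume) (x := (0 : Rn n)) (r := 1)).ne,
        ← measureReal_def, ← hω, ← ENNReal.ofReal_mul (by positivity),
        ← ENNReal.ofReal_add hvpos.le hvpos.le]
      congr 1
      field_simp
      ring
    have hx : ∀ x ∈ ball x₀ ρ', ENNReal.ofReal (w x ^ p) * volume A ≤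
        ENNReal.ofReal (R ^ ((n : ℝ) + s * p)) * ∫⁻ y in ball x₀ ρ,
          ENNReal.ofReal (|w x - w y| ^ p / ‖x - y‖ ^ ((n : ℝ) + s * p)) := by
      intro x hx
      have hSsub : ball x R ⊆ ball x₀ ρ := by
        apply ball_subset_ball'
        have := mem_ball.mp hx
        linarith
      have hvol : volume A ≤ volume (ball x R \ A) := by
        refine le_trans ?_ le_measure_sdiff
        rw [hball, ENNReal.add_sub_cancel_right hVtop]
      have hSnull : NullMeasurableSet (ball x R \ A) :=
        NullMeasurableSet.diff measurableSet_ball.nullMeasurableSet hAnull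
      calc ENNReal.ofReal (w x ^ p) * volume A
          ≤ ENNReal.ofReal (w x ^ p) * volume (ball x R \ A) := by gcongr
        _ = ∫⁻ _ in ball x R \ A, ENNReal.ofReal (w x ^ p) := (setLIntegral_const _ _).symm
        _ ≤ ∫⁻ y in ball x R \ A, ENNReal.ofReal (R ^ ((n : ℝ) + s * p)) *
              ENNReal.ofReal (|w x - w y| ^ p / ‖x - y‖ ^ ((n : ℝ) + s * p)) := by
          apply lintegral_mono_ae
          filter_upwards [ae_restrict_mem₀ hSnull] with y hy
          have hwy : w y = 0 := by
            have : ¬ 0 < w y := fun h => hy.2 ⟨h, hSsub hy.1⟩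
            exact le_antisymm (not_lt.mp this) (hw0 y)
          rw [← ENNReal.ofReal_mul (by positivity), hwy, sub_zero, abs_of_nonneg (hw0 x)]
          apply ENNReal.ofReal_le_ofReal
          rcases eq_or_ne x y with rfl | hxy
          · rw [hwy, Real.zero_rpow hp.ne']; simp
          have hd : 0 < ‖x - y‖ := norm_pos_iff.mpr (sub_ne_zero.mpr hxy)
          have hdR : ‖x - y‖ ≤ R := by
            have := mem_ball.mp hy.1
            rw [dist_comm, dist_eq_norm] at this
            exact this.le
          have h1 : ‖x - y‖ ^ ((n : ℝ) + s * p) ≤ R ^ ((n : ℝ) + s * p) := by gcongr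
          rw [mul_div_assoc', le_div_iff₀ (by positivity), mul_comm]
          have := hw0 x
          gcongr
        _ = ENNReal.ofReal (R ^ ((n : ℝ) + s * p)) * ∫⁻ y in ball x R \ A,
              ENNReal.ofReal (|w x - w y| ^ p / ‖x - y‖ ^ ((n : ℝ) + s * p)) :=
          lintegral_const_mul' _ _ ENNReal.ofReal_ne_top
        _ ≤ _ := by
          gcongr
          exact sdiff_subset.trans hSsub
    have h1 : I * volume A ≤ ENNReal.ofReal (R ^ ((n : ℝ) + s * p)) * E := by
      rw [hI, hE, ← lintegral_mul_const' _ _ hVtop, ← lintegral_const_mul' _ _ ENNReal.ofReal_ne_top]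
      exact setLIntegral_mono' measurableSet_ball hx
    have h2 : ENNReal.ofReal (R ^ ((n : ℝ) + s * p)) =
        ENNReal.ofReal ((2 / ω) ^ (s * p / n) * (2 / ω) * v ^ (s * p / n)) * volume A := by
      rw [hVv, ← ENNReal.ofReal_mul (by positivity), Real.rpow_add hRpos, Real.rpow_natCast, hRn,
        hRsp]
      congr 1; ring
    rw [h2, mul_right_comm] at h1
    have h3 := (ENNReal.mul_le_mul_iff_left hV0 hVtop).mp h1
    refine h3.trans (mul_le_mul' (ENNReal.ofReal_le_ofReal ?_) le_self_add)
    gcongr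
    linarith
  · have h1 : (1 : ℝ) ≤ R ^ (s * p) * (ρ - ρ') ^ (-(s * p)) := by
      rw [Real.rpow_neg hδ.le, ← div_eq_mul_inv, one_le_div (by positivity)]
      gcongr
    calc I ≤ ENNReal.ofReal (R ^ (s * p)) * (ENNReal.ofReal ((ρ - ρ') ^ (-(s * p))) * I) := by
          rw [← mul_assoc, ← ENNReal.ofReal_mul (by positivity)]
          exact le_mul_of_one_le_left' (ENNReal.one_le_ofReal.mpr h1)
      _ ≤ _ := by
        rw [hRsp]
        refine mul_le_mul' (ENNReal.ofReal_le_ofReal ?_) le_add_self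
        gcongr
        have : 0 < 2 / ω := by positivity
        nlinarith [Real.rpow_pos_of_pos this (s * p / n)]

theorem measurable_trunc (k : ℝ) : Measurable (trunc k) := by
  unfold trunc
  fun_prop

theorem measurable_signPow (p : ℝ) : Measurable (signPow p) := by
  unfold signPow
  fun_prop

/-! ### Lipschitz cutoffs. -/

section Cutoff

variable {n : ℕ}

/-- A Lipschitz cutoff, equal to `1` on `B_ρ(x₀)` and to `0` outside `B_{ρ+δ}(x₀)`. -/
noncomputable def cutoff (x₀ : Rn n) (ρ δ : ℝ) (x : Rn n) : ℝ :=
  max 0 (min 1 ((ρ + δ - ‖x - x₀‖) / δ))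

theorem cutoff_nonneg (x₀ : Rn n) (ρ δ : ℝ) (x : Rn n) : 0 ≤ cutoff x₀ ρ δ x := le_max_left _ _

theorem cutoff_le_one (x₀ : Rn n) (ρ δ : ℝ) (x : Rn n) : cutoff x₀ ρ δ x ≤ 1 :=
  max_le zero_le_one (min_le_left _ _)

theorem cutoff_eq_one {x₀ : Rn n} {ρ δ : ℝ} (hδ : 0 < δ) {x : Rn n} (hx : x ∈ ball x₀ ρ) :
    cutoff x₀ ρ δ x = 1 := by
  rw [mem_ball, dist_eq_norm] at hx
  rw [cutoff, min_eq_left, max_eq_right zero_le_one]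
  rw [one_le_div hδ]; linarith

theorem cutoff_eq_zero {x₀ : Rn n} {ρ δ : ℝ} (hδ : 0 < δ) {x : Rn n} (hx : x ∉ ball x₀ (ρ + δ)) :
    cutoff x₀ ρ δ x = 0 := by
  rw [mem_ball, dist_eq_norm, not_lt] at hx
  apply max_eq_left
  exact (min_le_right _ _).trans (div_nonpos_of_nonpos_of_nonneg (by linarith) hδ.le)

theorem measurable_cutoff (x₀ : Rn n) (ρ δ : ℝ) : Measurable (cutoff x₀ ρ δ) := by
  unfold cutoff
  fun_prop

theorem abs_cutoff_sub_le {x₀ : Rn n} {ρ δ : ℝ} (hδ : 0 < δ) (x y : Rn n) :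
    |cutoff x₀ ρ δ x - cutoff x₀ ρ δ y| ≤ ‖x - y‖ / δ := by
  have h1 : |cutoff x₀ ρ δ x - cutoff x₀ ρ δ y| ≤
      |(ρ + δ - ‖x - x₀‖) / δ - (ρ + δ - ‖y - x₀‖) / δ| := by
    unfold cutoff
    refine (abs_max_sub_max_le_max _ _ _ _).trans ?_
    rw [sub_self, abs_zero, max_eq_right (abs_nonneg _)]
    refine (abs_min_sub_min_le_max _ _ _ _).trans ?_
    rw [sub_self, abs_zero, max_eq_right (abs_nonneg _)]
  refine h1.trans ?_
  rw [← sub_div, abs_div, abs_of_pos hδ]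
  gcongr
  have := abs_norm_sub_norm_le (y - x₀) (x - x₀)
  rw [sub_sub_sub_cancel_right, norm_sub_rev y x] at this
  rwa [show ρ + δ - ‖x - x₀‖ - (ρ + δ - ‖y - x₀‖) = ‖y - x₀‖ - ‖x - x₀‖ by ring]

theorem abs_cutoff_rpow_sub_le {p : ℝ} (hp : 1 ≤ p) {x₀ : Rn n} {ρ δ : ℝ} (hδ : 0 < δ)
    (x y : Rn n) :
    |cutoff x₀ ρ δ x ^ p - cutoff x₀ ρ δ y ^ p| ≤ p / δ * ‖x - y‖ := by
  wlog h : cutoff x₀ ρ δ y ≤ cutoff x₀ ρ δ x generalizing x y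
  · rw [abs_sub_comm, norm_sub_rev]
    exact this y x (le_of_not_ge h)
  have h1 := rpow_sub_rpow_le hp (cutoff_nonneg _ _ _ y) h
  have h2 := abs_cutoff_sub_le (x₀ := x₀) (ρ := ρ) hδ x y
  rw [abs_of_nonneg (by linarith)] at h2
  have h3 : cutoff x₀ ρ δ x ^ (p - 1) ≤ 1 :=
    Real.rpow_le_one (cutoff_nonneg _ _ _ _) (cutoff_le_one _ _ _ _) (by linarith)
  have h0 : 0 ≤ cutoff x₀ ρ δ x ^ (p - 1) := Real.rpow_nonneg (cutoff_nonneg _ _ _ _) _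
  rw [abs_of_nonneg (sub_nonneg.mpr (Real.rpow_le_rpow (cutoff_nonneg _ _ _ _) h (by linarith)))]
  calc _ ≤ p * cutoff x₀ ρ δ x ^ (p - 1) * (cutoff x₀ ρ δ x - cutoff x₀ ρ δ y) := h1
    _ ≤ p * 1 * (‖x - y‖ / δ) := by gcongr
    _ = p / δ * ‖x - y‖ := by ring

end Cutoff

/-! ### The weight of the energy and the kernel of the equation. -/

section Density

variable {n : ℕ}

/-- The weight `a |x-y|^{-n-sp} + b |x-y|^{-n-tp}` of the energy. -/
noncomputable def density (s t p : ℝ) (a b : Rn n → Rn n → ℝ) (z : Rn n × Rn n) : ℝ :=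
  a z.1 z.2 / ‖z.1 - z.2‖ ^ ((n : ℝ) + s * p) + b z.1 z.2 / ‖z.1 - z.2‖ ^ ((n : ℝ) + t * p)

/-- The kernel `a K_{sp} + b K_{tp}` of the equation. -/
def mixedKernel (a b Ks Kt : Rn n → Rn n → ℝ) (z : Rn n × Rn n) : ℝ :=
  a z.1 z.2 * Ks z.1 z.2 + b z.1 z.2 * Kt z.1 z.2

/-- The integrand of the energy of `f`. -/
noncomputable def energyDensity (s t p : ℝ) (a b : Rn n → Rn n → ℝ) (f : Rn n → ℝ)
    (z : Rn n × Rn n) : ℝ :=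
  a z.1 z.2 * (|f z.1 - f z.2| ^ p / ‖z.1 - z.2‖ ^ ((n : ℝ) + s * p))
    + b z.1 z.2 * (|f z.1 - f z.2| ^ p / ‖z.1 - z.2‖ ^ ((n : ℝ) + t * p))

theorem energyDensity_eq (s t p : ℝ) (a b : Rn n → Rn n → ℝ) (f : Rn n → ℝ) (z : Rn n × Rn n) :
    energyDensity s t p a b f z = |f z.1 - f z.2| ^ p * density s t p a b z := by
  simp only [energyDensity, density]; ring

variable {s t p ν L : ℝ} {a b Ks Kt : Rn n → Rn n → ℝ}

theorem density_nonneg (ha : IsCoefficient a) (hb : IsCoefficient b) (z : Rn n × Rn n) :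
    0 ≤ density s t p a b z := by
  have h1 := ha.nonneg z.1 z.2
  have h2 := hb.nonneg z.1 z.2
  unfold density
  positivity

theorem energyDensity_nonneg (ha : IsCoefficient a) (hb : IsCoefficient b) (f : Rn n → ℝ)
    (z : Rn n × Rn n) : 0 ≤ energyDensity s t p a b f z := by
  have := density_nonneg (s := s) (t := t) (p := p) ha hb z
  rw [energyDensity_eq]
  positivity

theorem aemeasurable_fst {f : Rn n → ℝ} (hf : AEMeasurable f) :
    AEMeasurable (fun z : Rn n × Rn n => f z.1) := hf.comp_fst

theorem aemeasurable_snd {f : Rn n → ℝ} (hf : AEMeasurable f) :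
    AEMeasurable (fun z : Rn n × Rn n => f z.2) := hf.comp_snd

theorem aemeasurable_energyDensity (ha : IsCoefficient a) (hb : IsCoefficient b) {f : Rn n → ℝ}
    (hf : AEMeasurable f) : AEMeasurable (energyDensity s t p a b f) := by
  have h1 := ha.measurable
  have h2 := hb.measurable
  have h3 := aemeasurable_fst hf
  have h4 := aemeasurable_snd hf
  unfold energyDensity
  fun_prop

theorem aemeasurable_mixedKernel (h : IsData s t p ν L a b Ks Kt) :
    AEMeasurable (mixedKernel a b Ks Kt) := by
  have h1 := h.coeff_a.measurable
  have h2 := h.coeff_b.measurable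
  have h3 := h.kernel_s.measurable
  have h4 := h.kernel_t.measurable
  unfold mixedKernel
  fun_prop

theorem mixedKernel_swap (h : IsData s t p ν L a b Ks Kt) (z : Rn n × Rn n) :
    mixedKernel a b Ks Kt z.swap = mixedKernel a b Ks Kt z := by
  simp only [mixedKernel, Prod.fst_swap, Prod.snd_swap, h.coeff_a.symm z.2, h.coeff_b.symm z.2,
    h.kernel_s.symm z.2, h.kernel_t.symm z.2]

theorem ae_mixedKernel_bounds (hn : 1 ≤ n) (h : IsData s t p ν L a b Ks Kt) :
    ∀ᵐ z : Rn n × Rn n, ν * density s t p a b z ≤ mixedKernel a b Ks Kt z ∧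
      mixedKernel a b Ks Kt z ≤ L * density s t p a b z := by
  filter_upwards [ae_fst_ne_snd hn, h.kernel_s.bounds, h.kernel_t.bounds] with z hz h1 h2
  have ha := h.coeff_a.nonneg z.1 z.2
  have hb := h.coeff_b.nonneg z.1 z.2
  have e1 := mul_le_mul_of_nonneg_left (h1 hz).1 ha
  have e2 := mul_le_mul_of_nonneg_left (h1 hz).2 ha
  have e3 := mul_le_mul_of_nonneg_left (h2 hz).1 hb
  have e4 := mul_le_mul_of_nonneg_left (h2 hz).2 hb
  simp only [density, mixedKernel]
  constructor
  · calc _ = a z.1 z.2 * (ν / ‖z.1 - z.2‖ ^ ((n : ℝ) + s * p)) +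
        b z.1 z.2 * (ν / ‖z.1 - z.2‖ ^ ((n : ℝ) + t * p)) := by ring
      _ ≤ _ := add_le_add e1 e3
  · calc _ ≤ a z.1 z.2 * (L / ‖z.1 - z.2‖ ^ ((n : ℝ) + s * p)) +
        b z.1 z.2 * (L / ‖z.1 - z.2‖ ^ ((n : ℝ) + t * p)) := add_le_add e2 e4
      _ = _ := by ring

theorem ae_coeff_le (h : IsData s t p ν L a b Ks Kt) :
    ∀ᵐ z : Rn n × Rn n, a z.1 z.2 ≤ L ∧ b z.1 z.2 ≤ L := by
  filter_upwards [h.bounds] with z hz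
  have ha := h.coeff_a.nonneg z.1 z.2
  have hb := h.coeff_b.nonneg z.1 z.2
  constructor <;> linarith [hz.2]

end Density

/-! ### Admissible test functions and integrability of the weak form. -/

section Admissible

variable {n : ℕ} {s t p ν L : ℝ} {a b Ks Kt : Rn n → Rn n → ℝ} {Ω : Set (Rn n)}

theorem measurableSet_interactionSet (hΩ : MeasurableSet Ω) : MeasurableSet (interactionSet Ω) :=
  (hΩ.compl.prod hΩ.compl).compl

theorem integrableOn_energyDensity {f : Rn n → ℝ} (ha : IsCoefficient a) (hb : IsCoefficient b)
    (hf : f ∈ admissible s t p a b Ω) :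
    IntegrableOn (energyDensity s t p a b f) (interactionSet Ω) := by
  refine ⟨(aemeasurable_energyDensity ha hb hf.1).aestronglyMeasurable.restrict, ?_⟩
  rw [hasFiniteIntegral_iff_ofReal
    (Filter.Eventually.of_forall fun z => energyDensity_nonneg ha hb f z)]
  exact hf.2.2

theorem setLIntegral_rpow_lt_top (hp : 0 < p) {f : Rn n → ℝ}
    (hf : MemLp f (ENNReal.ofReal p) (volume.restrict Ω)) :
    ∫⁻ x in Ω, ENNReal.ofReal (|f x| ^ p) < ∞ := by
  have h := hf.integrable_norm_rpow (by simpa using hp) ENNReal.ofReal_ne_top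
  rw [ENNReal.toReal_ofReal hp.le] at h
  exact h.lintegral_lt_top

theorem add_rpow_le_two_rpow {A B : ℝ} (hp : 0 ≤ p) (hA : 0 ≤ A) (hB : 0 ≤ B) :
    (A + B) ^ p ≤ 2 ^ p * (A ^ p + B ^ p) := by
  have h : A + B ≤ 2 * max A B := by
    have := le_max_left A B
    have := le_max_right A B
    linarith
  calc (A + B) ^ p ≤ (2 * max A B) ^ p := by gcongr
    _ = 2 ^ p * max A B ^ p := Real.mul_rpow (by norm_num) (le_max_of_le_left hA)
    _ ≤ _ := by
      have h1 : 0 ≤ A ^ p := by positivity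
      have h2 : 0 ≤ B ^ p := by positivity
      gcongr
      rcases max_choice A B with h | h <;> rw [h] <;> linarith

theorem lintegral_fst_mul_lt_top {F : Rn n → ℝ≥0∞} {q : Rn n × Rn n → ℝ≥0∞} {D : ℝ≥0∞}
    (hF : ∫⁻ x, F x < ∞) (hD : D < ∞) (hq : ∀ x, ∫⁻ y, q (x, y) ≤ D) (hF' : ∀ x, F x ≠ ∞) :
    ∫⁻ z : Rn n × Rn n, F z.1 * q z < ∞ := by
  calc ∫⁻ z : Rn n × Rn n, F z.1 * q z ≤ ∫⁻ x, ∫⁻ y, F x * q (x, y) := lintegral_prod_le _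
    _ = ∫⁻ x, F x * ∫⁻ y, q (x, y) := by
      congr 1; ext x
      exact lintegral_const_mul' _ _ (hF' x)
    _ ≤ ∫⁻ x, F x * D := by gcongr with x; exact hq x
    _ = (∫⁻ x, F x) * D := lintegral_mul_const' _ _ hD.ne
    _ < ∞ := ENNReal.mul_lt_top hF hD

theorem lintegral_swap_eq (F : Rn n × Rn n → ℝ≥0∞) :
    ∫⁻ z : Rn n × Rn n, F z.swap = ∫⁻ z, F z := lintegral_prod_swap F

/-- A discrete product rule. The left side is symmetric in `x` and `y`, so exchanging them lets
either point carry the factor `|u|`. -/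
theorem abs_trunc_mul_sub_rpow_le {k Λ : ℝ} (hp : 1 < p) (hk : 0 ≤ k) (hΛ : 1 ≤ Λ) {ψ : Rn n → ℝ}
    (hψ0 : ∀ x, 0 ≤ ψ x) (hψ1 : ∀ x, ψ x ≤ 1) (hψL : ∀ x y, |ψ x - ψ y| ≤ Λ * ‖x - y‖)
    (u : Rn n → ℝ) (x y : Rn n) :
    |trunc k (u x) * ψ x - trunc k (u y) * ψ y| ^ p ≤
      2 ^ p * |u x - u y| ^ p + (2 * Λ) ^ p * |u y| ^ p * min 1 ‖x - y‖ ^ p := by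
  have hw := trunc_nonneg k (u y)
  have hlip : |ψ x - ψ y| ≤ Λ * min 1 ‖x - y‖ := by
    rcases min_choice 1 ‖x - y‖ with h | h <;> rw [h]
    · rw [mul_one]
      refine le_trans ?_ hΛ
      rw [abs_le]
      constructor <;> linarith [hψ0 x, hψ0 y, hψ1 x, hψ1 y]
    · exact hψL x y
  have h1 : |trunc k (u x) * ψ x - trunc k (u y) * ψ y| ≤
      |u x - u y| + |u y| * (Λ * min 1 ‖x - y‖) := by
    have : trunc k (u x) * ψ x - trunc k (u y) * ψ y =
        (trunc k (u x) - trunc k (u y)) * ψ x + trunc k (u y) * (ψ x - ψ y) := by ring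
    rw [this]
    refine (abs_add_le _ _).trans ?_
    rw [abs_mul, abs_mul, abs_of_nonneg (hψ0 x), abs_of_nonneg hw]
    apply add_le_add
    · calc _ ≤ |u x - u y| * 1 :=
            mul_le_mul (abs_trunc_sub_le _ _ _) (hψ1 x) (hψ0 x) (abs_nonneg _)
        _ = _ := mul_one _
    · exact mul_le_mul (trunc_le_abs hk) hlip (abs_nonneg _) (abs_nonneg _)
  have hm : 0 ≤ min 1 ‖x - y‖ := le_min zero_le_one (norm_nonneg _)
  calc _ ≤ (|u x - u y| + |u y| * (Λ * min 1 ‖x - y‖)) ^ p := by gcongr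
    _ ≤ 2 ^ p * (|u x - u y| ^ p + (|u y| * (Λ * min 1 ‖x - y‖)) ^ p) :=
      add_rpow_le_two_rpow (by linarith) (abs_nonneg _) (by positivity)
    _ = _ := by
      rw [Real.mul_rpow (abs_nonneg _) (by positivity), Real.mul_rpow (by positivity) hm,
        Real.mul_rpow (by norm_num) (by positivity)]
      ring

/-- Every pair in `C_Ω` has a point in `Ω`, where `u` is `p`-integrable. The error from the
increment of `ψ` is charged to that point and integrated in the other variable against a convergent
kernel. -/
theorem trunc_mul_mem_admissible (hn : 1 ≤ n) (hs : 0 < s) (hs1 : s < 1) (ht : 0 < t) (ht1 : t < 1)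
    (hp : 1 < p) (h : IsData s t p ν L a b Ks Kt) (hL : 0 ≤ L) (hΩ : MeasurableSet Ω)
    {u : Rn n → ℝ} (hu : u ∈ admissible s t p a b Ω) {k Λ : ℝ} (hk : 0 ≤ k) (hΛ : 1 ≤ Λ)
    {ψ : Rn n → ℝ} (hψm : Measurable ψ) (hψ0 : ∀ x, 0 ≤ ψ x) (hψ1 : ∀ x, ψ x ≤ 1)
    (hψL : ∀ x y, |ψ x - ψ y| ≤ Λ * ‖x - y‖) :
    (fun x => trunc k (u x) * ψ x) ∈ admissible s t p a b Ω := by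
  have hp0 : 0 < p := by linarith
  have hmeas : AEMeasurable (fun x => trunc k (u x) * ψ x) := by
    have := hu.1
    unfold trunc
    fun_prop
  refine ⟨hmeas, hu.2.1.mono hmeas.aestronglyMeasurable.restrict
    (Filter.Eventually.of_forall fun x => ?_), ?_⟩
  · rw [Real.norm_eq_abs, Real.norm_eq_abs, abs_of_nonneg (mul_nonneg (trunc_nonneg _ _) (hψ0 x))]
    calc _ ≤ |u x| * 1 := mul_le_mul (trunc_le_abs hk) (hψ1 x) (hψ0 x) (abs_nonneg _)
      _ = _ := mul_one _
  set φ := fun x => trunc k (u x) * ψ x with hφ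
  set q : ℝ → ℝ := fun d => L * (min 1 d ^ p / d ^ ((n : ℝ) + s * p)
    + min 1 d ^ p / d ^ ((n : ℝ) + t * p)) with hq
  set F : Rn n → ℝ≥0∞ := Ω.indicator fun x => ENNReal.ofReal ((2 * Λ) ^ p * |u x| ^ p) with hF
  set Q : Rn n × Rn n → ℝ≥0∞ := fun z => ENNReal.ofReal (q ‖z.1 - z.2‖) with hQ
  have hFm : AEMeasurable F := by
    have := hu.1
    refine AEMeasurable.indicator ?_ hΩ
    fun_prop
  have hQm : Measurable Q := by rw [hQ, hq]; fun_prop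
  have hFfin : ∫⁻ x, F x < ∞ := by
    rw [hF, lintegral_indicator hΩ]
    simp_rw [ENNReal.ofReal_mul (by positivity : 0 ≤ (2 * Λ) ^ p)]
    rw [lintegral_const_mul' _ _ ENNReal.ofReal_ne_top]
    exact ENNReal.mul_lt_top ENNReal.ofReal_lt_top (setLIntegral_rpow_lt_top hp0 hu.2.1)
  have hFtop : ∀ x, F x ≠ ∞ := fun x => by
    rw [hF]
    by_cases hx : x ∈ Ω <;> simp [hx]
  obtain ⟨D, hD, hqD⟩ : ∃ D : ℝ≥0∞, D < ∞ ∧ ∀ x, ∫⁻ y, Q (x, y) ≤ D := by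
    have h1 := fun x : Rn n => lintegral_min_rpow_div_lt_top hn (p := p) (σ := s * p)
      (by positivity) (by nlinarith) x
    have h2 := fun x : Rn n => lintegral_min_rpow_div_lt_top hn (p := p) (σ := t * p)
      (by positivity) (by nlinarith) x
    refine ⟨ENNReal.ofReal L * (_ + _), ENNReal.mul_lt_top ENNReal.ofReal_lt_top
      (ENNReal.add_lt_top.mpr ⟨(h1 0).2, (h2 0).2⟩), fun x => ?_⟩
    simp only [hQ, hq]
    have : ∀ y : Rn n, 0 ≤ min 1 ‖x - y‖ := fun y => le_min zero_le_one (norm_nonneg _)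
    simp_rw [ENNReal.ofReal_mul hL]
    rw [lintegral_const_mul' _ _ ENNReal.ofReal_ne_top]
    gcongr
    calc _ = ∫⁻ y : Rn n, (ENNReal.ofReal (min 1 ‖x - y‖ ^ p / ‖x - y‖ ^ ((n : ℝ) + s * p)) +
          ENNReal.ofReal (min 1 ‖x - y‖ ^ p / ‖x - y‖ ^ ((n : ℝ) + t * p))) := by
          congr 1; ext y
          have := this y
          exact ENNReal.ofReal_add (by positivity) (by positivity)
      _ = _ := lintegral_add_left (by fun_prop) _
      _ ≤ _ := add_le_add (h1 x).1 (h2 x).1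
  have hfin1 := lintegral_fst_mul_lt_top hFfin hD hqD hFtop
  have hfin2 : ∫⁻ z : Rn n × Rn n, F z.2 * Q z < ∞ := by
    rw [← lintegral_swap_eq]
    simp only [Prod.snd_swap]
    have : ∀ z : Rn n × Rn n, Q z.swap = Q z := fun z => by
      simp only [hQ, Prod.fst_swap, Prod.snd_swap, norm_sub_rev]
    simp_rw [this]
    exact hfin1
  have hbound : ∀ᵐ z : Rn n × Rn n, z ∈ interactionSet Ω →
      ENNReal.ofReal (energyDensity s t p a b φ z) ≤
        ENNReal.ofReal (2 ^ p) * ENNReal.ofReal (energyDensity s t p a b u z)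
          + (F z.1 * Q z + F z.2 * Q z) := by
    filter_upwards [ae_coeff_le h] with z hz hzΩ
    have ha := h.coeff_a.nonneg z.1 z.2
    have hb := h.coeff_b.nonneg z.1 z.2
    have hd0 := density_nonneg (s := s) (t := t) (p := p) h.coeff_a h.coeff_b z
    have hm : 0 ≤ min 1 ‖z.1 - z.2‖ := le_min zero_le_one (norm_nonneg _)
    have hdq : min 1 ‖z.1 - z.2‖ ^ p * density s t p a b z ≤ q ‖z.1 - z.2‖ := by
      simp only [density, hq, mul_add]
      apply add_le_add
      · rw [mul_div_assoc', mul_div_assoc', mul_comm]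
        gcongr
        exact hz.1
      · rw [mul_div_assoc', mul_div_assoc', mul_comm]
        gcongr
        exact hz.2
    have hE0 := energyDensity_nonneg (s := s) (t := t) (p := p) h.coeff_a h.coeff_b u z
    have main : ∀ v : ℝ, 0 ≤ v →
        |φ z.1 - φ z.2| ^ p ≤ 2 ^ p * |u z.1 - u z.2| ^ p
          + (2 * Λ) ^ p * |v| ^ p * min 1 ‖z.1 - z.2‖ ^ p →
        ENNReal.ofReal (energyDensity s t p a b φ z) ≤
          ENNReal.ofReal (2 ^ p) * ENNReal.ofReal (energyDensity s t p a b u z)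
          + ENNReal.ofReal ((2 * Λ) ^ p * |v| ^ p) * Q z := by
      intro v hv hle
      have hq0 : 0 ≤ q ‖z.1 - z.2‖ := le_trans (by positivity) hdq
      rw [hQ, ← ENNReal.ofReal_mul (by positivity), ← ENNReal.ofReal_mul (by positivity),
        ← ENNReal.ofReal_add (by positivity) (by positivity)]
      apply ENNReal.ofReal_le_ofReal
      rw [energyDensity_eq, energyDensity_eq]
      calc _ ≤ (2 ^ p * |u z.1 - u z.2| ^ p
            + (2 * Λ) ^ p * |v| ^ p * min 1 ‖z.1 - z.2‖ ^ p) * density s t p a b z := by gcongr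
        _ = 2 ^ p * (|u z.1 - u z.2| ^ p * density s t p a b z)
            + (2 * Λ) ^ p * |v| ^ p * (min 1 ‖z.1 - z.2‖ ^ p * density s t p a b z) := by ring
        _ ≤ _ := by gcongr
    -- The factor `|u|` is placed at whichever point lies in `Ω`.
    by_cases h2 : z.2 ∈ Ω
    · have h3 := main |u z.2| (abs_nonneg _) (by
        rw [abs_abs]
        exact abs_trunc_mul_sub_rpow_le hp hk hΛ hψ0 hψ1 hψL u z.1 z.2)
      refine h3.trans ?_
      gcongr
      refine le_trans ?_ le_add_self
      simp only [hF, indicator_of_mem h2, abs_abs, le_refl]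
    · have h1 : z.1 ∈ Ω := by
        by_contra h1
        exact hzΩ ⟨h1, h2⟩
      have h3 := main |u z.1| (abs_nonneg _) (by
        rw [abs_abs, abs_sub_comm, abs_sub_comm (u z.1), norm_sub_rev]
        exact abs_trunc_mul_sub_rpow_le hp hk hΛ hψ0 hψ1 hψL u z.2 z.1)
      refine h3.trans ?_
      gcongr
      refine le_trans ?_ le_self_add
      simp only [hF, indicator_of_mem h1, abs_abs, le_refl]
  have hm1 : AEMeasurable (fun z : Rn n × Rn n => F z.1 * Q z) :=
    hFm.comp_fst.mul hQm.aemeasurable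
  have hm2 : AEMeasurable (fun z : Rn n × Rn n => F z.2 * Q z) :=
    hFm.comp_snd.mul hQm.aemeasurable
  change ∫⁻ z in interactionSet Ω, ENNReal.ofReal (energyDensity s t p a b φ z) < ∞
  calc _ ≤ ∫⁻ z in interactionSet Ω,
        (ENNReal.ofReal (2 ^ p) * ENNReal.ofReal (energyDensity s t p a b u z)
          + (F z.1 * Q z + F z.2 * Q z)) :=
        setLIntegral_mono_ae' (measurableSet_interactionSet hΩ) hbound
    _ = (ENNReal.ofReal (2 ^ p) * ∫⁻ z in interactionSet Ω,
          ENNReal.ofReal (energyDensity s t p a b u z))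
        + ((∫⁻ z in interactionSet Ω, F z.1 * Q z) + ∫⁻ z in interactionSet Ω, F z.2 * Q z) := by
      have hm12 : AEMeasurable (fun z : Rn n × Rn n => F z.1 * Q z + F z.2 * Q z) := hm1.add hm2
      rw [lintegral_add_right' _ hm12.restrict, lintegral_add_right' _ hm2.restrict,
        lintegral_const_mul' _ _ ENNReal.ofReal_ne_top]
    _ < ∞ := by
      refine ENNReal.add_lt_top.mpr ⟨ENNReal.mul_lt_top ENNReal.ofReal_lt_top hu.2.2,
        ENNReal.add_lt_top.mpr ⟨?_, ?_⟩⟩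
      · exact (setLIntegral_le_lintegral _ _).trans_lt hfin1
      · exact (setLIntegral_le_lintegral _ _).trans_lt hfin2

theorem rpow_sub_one_mul_le_add {X Y : ℝ} (hp : 1 < p) (hX : 0 ≤ X) (hY : 0 ≤ Y) :
    X ^ (p - 1) * Y ≤ X ^ p + Y ^ p := by
  have hsplit : ∀ Z : ℝ, 0 ≤ Z → Z ^ p = Z ^ (p - 1) * Z := fun Z hZ => by
    rw [← Real.rpow_add_one' hZ (by linarith)]; congr 1; ring
  have h1 : 0 ≤ X ^ p := by positivity
  have h2 : 0 ≤ Y ^ p := by positivity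
  rcases le_total X Y with h | h
  · have : X ^ (p - 1) * Y ≤ Y ^ (p - 1) * Y := by gcongr
    rw [← hsplit Y hY] at this
    linarith
  · have : X ^ (p - 1) * Y ≤ X ^ (p - 1) * X := by gcongr
    rw [← hsplit X hX] at this
    linarith

/-- By Young's inequality each integrand is dominated by `L` times the sum of the energy densities
of `u` and `φ`. Without integrability the Bochner integrals in `weakForm` could take the default
value `0`, and they could not be added. -/
theorem integrableOn_weakForm_term (ha : IsCoefficient a) (hb : IsCoefficient b) (hp : 1 < p)
    (hL : 0 ≤ L) (hν : 0 ≤ ν) {σ : ℝ} {c K : Rn n → Rn n → ℝ}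
    (hc : IsCoefficient c) (hcd : ∀ z : Rn n × Rn n,
      c z.1 z.2 / ‖z.1 - z.2‖ ^ ((n : ℝ) + σ * p) ≤ density s t p a b z)
    (hK : IsKernel σ p ν L K) (hn : 1 ≤ n) {u φ : Rn n → ℝ}
    (hu : u ∈ admissible s t p a b Ω) (hφ : φ ∈ admissible s t p a b Ω) :
    IntegrableOn (fun z : Rn n × Rn n => c z.1 z.2 * (|u z.1 - u z.2| ^ (p - 2) * (u z.1 - u z.2))
      * (φ z.1 - φ z.2) * K z.1 z.2) (interactionSet Ω) := by
  have hg := ((integrableOn_energyDensity ha hb hu).add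
    (integrableOn_energyDensity ha hb hφ)).const_mul L
  refine hg.mono' ?_ (ae_restrict_of_ae ?_)
  · have h1 := hc.measurable
    have h2 := hK.measurable
    have h3 := aemeasurable_fst hu.1
    have h4 := aemeasurable_snd hu.1
    have h5 := aemeasurable_fst hφ.1
    have h6 := aemeasurable_snd hφ.1
    refine AEStronglyMeasurable.restrict (AEMeasurable.aestronglyMeasurable ?_)
    exact ((h1.mul ((measurable_signPow p).comp_aemeasurable (h3.sub h4))).mul (h5.sub h6)).mul h2
  · filter_upwards [ae_fst_ne_snd hn, hK.bounds] with z hz hKz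
    have hc0 := hc.nonneg z.1 z.2
    have hK0 : 0 ≤ K z.1 z.2 := le_trans (by positivity) (hKz hz).1
    have hJ := abs_signPow hp (u z.1 - u z.2)
    rw [signPow] at hJ
    rw [Real.norm_eq_abs, abs_mul, abs_mul, abs_mul, hJ, abs_of_nonneg hc0, abs_of_nonneg hK0]
    have hY := rpow_sub_one_mul_le_add hp (abs_nonneg (u z.1 - u z.2)) (abs_nonneg (φ z.1 - φ z.2))
    simp only [Pi.add_apply, energyDensity_eq]
    calc _ = (|u z.1 - u z.2| ^ (p - 1) * |φ z.1 - φ z.2|) * (c z.1 z.2 * K z.1 z.2) := by ring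
      _ ≤ (|u z.1 - u z.2| ^ p + |φ z.1 - φ z.2| ^ p) *
          (c z.1 z.2 * (L / ‖z.1 - z.2‖ ^ ((n : ℝ) + σ * p))) := by
        gcongr
        exact (hKz hz).2
      _ = L * ((|u z.1 - u z.2| ^ p + |φ z.1 - φ z.2| ^ p) *
          (c z.1 z.2 / ‖z.1 - z.2‖ ^ ((n : ℝ) + σ * p))) := by ring
      _ ≤ L * ((|u z.1 - u z.2| ^ p + |φ z.1 - φ z.2| ^ p) * density s t p a b z) := by
        gcongr
        exact hcd z
      _ = _ := by ring

theorem weakForm_eq_setIntegral (hn : 1 ≤ n) (h : IsData s t p ν L a b Ks Kt) (hp : 1 < p)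
    (hL : 0 ≤ L) (hν : 0 ≤ ν) {u φ : Rn n → ℝ}
    (hu : u ∈ admissible s t p a b Ω) (hφ : φ ∈ admissible s t p a b Ω) :
    IntegrableOn (fun z : Rn n × Rn n => signPow p (u z.1 - u z.2) * (φ z.1 - φ z.2)
      * mixedKernel a b Ks Kt z) (interactionSet Ω) ∧
    weakForm p a b Ks Kt Ω u φ = ∫ z in interactionSet Ω,
      signPow p (u z.1 - u z.2) * (φ z.1 - φ z.2) * mixedKernel a b Ks Kt z := by
  have h1 := integrableOn_weakForm_term h.coeff_a h.coeff_b hp hL hν (s := s) (t := t)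
    h.coeff_a (fun z => by
      have := h.coeff_b.nonneg z.1 z.2
      rw [density]
      exact le_add_of_nonneg_right (by positivity)) h.kernel_s hn hu hφ
  have h2 := integrableOn_weakForm_term h.coeff_a h.coeff_b hp hL hν (s := s) (t := t)
    h.coeff_b (fun z => by
      have := h.coeff_a.nonneg z.1 z.2
      rw [density]
      exact le_add_of_nonneg_left (by positivity)) h.kernel_t hn hu hφ
  have he : (fun z : Rn n × Rn n => signPow p (u z.1 - u z.2) * (φ z.1 - φ z.2)
      * mixedKernel a b Ks Kt z) = fun z => a z.1 z.2 *
        (|u z.1 - u z.2| ^ (p - 2) * (u z.1 - u z.2)) * (φ z.1 - φ z.2) * Ks z.1 z.2 +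
      b z.1 z.2 * (|u z.1 - u z.2| ^ (p - 2) * (u z.1 - u z.2)) * (φ z.1 - φ z.2) * Kt z.1 z.2 := by
    ext z
    simp only [signPow, mixedKernel]
    ring
  rw [he]
  exact ⟨h1.add h2, (integral_add h1 h2).symm⟩

end Admissible

/-! ### The Caccioppoli inequality. -/

/-- Passes from the signed weak inequality to integrals in `[0, ∞]`, where the error `N` may have
infinite integral. Pointwise `P + f⁻ ≤ N + f⁺`, and `∫ f⁺ ≤ ∫ f⁻ < ∞`, so `∫ f⁻` can be cancelled.
-/
theorem lintegral_ofReal_le_of_integral_nonpos {α : Type*} [MeasurableSpace α] {μ : Measure α}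
    {f P N : α → ℝ} (hf : Integrable f μ) (hf0 : ∫ x, f x ∂μ ≤ 0) (hP : ∀ᵐ x ∂μ, 0 ≤ P x)
    (hN : ∀ᵐ x ∂μ, 0 ≤ N x) (h : ∀ᵐ x ∂μ, P x ≤ f x + N x) :
    ∫⁻ x, ENNReal.ofReal (P x) ∂μ ≤ ∫⁻ x, ENNReal.ofReal (N x) ∂μ := by
  have hfm := hf.aestronglyMeasurable.aemeasurable
  have hpos : ∫⁻ x, ENNReal.ofReal (f x) ∂μ < ∞ := hf.lintegral_lt_top
  have hneg : ∫⁻ x, ENNReal.ofReal (-f x) ∂μ < ∞ := hf.neg.lintegral_lt_top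
  have hle : ∫⁻ x, ENNReal.ofReal (f x) ∂μ ≤ ∫⁻ x, ENNReal.ofReal (-f x) ∂μ := by
    rw [integral_eq_lintegral_pos_part_sub_lintegral_neg_part hf, sub_nonpos] at hf0
    exact (ENNReal.toReal_le_toReal hpos.ne hneg.ne).mp hf0
  have hsum : ∫⁻ x, ENNReal.ofReal (P x) ∂μ + ∫⁻ x, ENNReal.ofReal (-f x) ∂μ ≤
      ∫⁻ x, ENNReal.ofReal (N x) ∂μ + ∫⁻ x, ENNReal.ofReal (f x) ∂μ := by
    have hfm' : AEMeasurable (fun x => -f x) μ := hfm.neg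
    rw [← lintegral_add_right' _ hfm'.ennreal_ofReal, ← lintegral_add_right' _ hfm.ennreal_ofReal]
    apply lintegral_mono_ae
    filter_upwards [hP, hN, h] with x h1 h2 h3
    rcases le_total 0 (f x) with h4 | h4
    · rw [ENNReal.ofReal_of_nonpos (neg_nonpos.mpr h4), add_zero, ← ENNReal.ofReal_add h2 h4]
      exact ENNReal.ofReal_le_ofReal (by linarith)
    · rw [ENNReal.ofReal_of_nonpos h4, add_zero, ← ENNReal.ofReal_add h1 (neg_nonneg.mpr h4)]
      exact ENNReal.ofReal_le_ofReal (by linarith)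
  have := hsum.trans (add_le_add le_rfl hle)
  exact (ENNReal.add_le_add_iff_right hneg.ne).mp this

section Caccioppoli

variable {n : ℕ} {s t p ν L : ℝ} {a b Ks Kt : Rn n → Rn n → ℝ} {Ω : Set (Rn n)}

theorem lintegral_indicator_add_three_le {α : Type*} [MeasurableSpace α] {μ : Measure α}
    {S₁ S₂ S₃ : Set α} (h₁ : MeasurableSet S₁) (h₂ : MeasurableSet S₂) (h₃ : MeasurableSet S₃)
    {F₁ F₂ F₃ : α → ℝ} (hF₁ : AEMeasurable F₁ μ) (hF₂ : AEMeasurable F₂ μ) :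
    ∫⁻ x, ENNReal.ofReal (S₁.indicator F₁ x + S₂.indicator F₂ x + S₃.indicator F₃ x) ∂μ ≤
      ∫⁻ x in S₁, ENNReal.ofReal (F₁ x) ∂μ + ∫⁻ x in S₂, ENNReal.ofReal (F₂ x) ∂μ
        + ∫⁻ x in S₃, ENNReal.ofReal (F₃ x) ∂μ := by
  have hind : ∀ (S : Set α) (F : α → ℝ) (x : α),
      ENNReal.ofReal (S.indicator F x) = S.indicator (fun x => ENNReal.ofReal (F x)) x := by
    intro S F x
    by_cases hx : x ∈ S <;> simp [hx]
  calc _ ≤ ∫⁻ x, (S₁.indicator (fun x => ENNReal.ofReal (F₁ x)) x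
        + S₂.indicator (fun x => ENNReal.ofReal (F₂ x)) x
        + S₃.indicator (fun x => ENNReal.ofReal (F₃ x)) x) ∂μ := by
        apply lintegral_mono
        intro x
        simp only [← hind]
        exact ENNReal.ofReal_add_le.trans (add_le_add ENNReal.ofReal_add_le le_rfl)
    _ = _ := by
      have h12 : AEMeasurable (fun x => S₁.indicator (fun x => ENNReal.ofReal (F₁ x)) x
          + S₂.indicator (fun x => ENNReal.ofReal (F₂ x)) x) μ :=
        (hF₁.ennreal_ofReal.indicator h₁).add (hF₂.ennreal_ofReal.indicator h₂)
      rw [lintegral_add_left' h12,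
        lintegral_add_left' (hF₁.ennreal_ofReal.indicator h₁), lintegral_indicator h₁,
        lintegral_indicator h₂, lintegral_indicator h₃]

theorem setLIntegral_prod_swap {S T : Set (Rn n)} (hS : MeasurableSet S) (hT : MeasurableSet T)
    (F : Rn n × Rn n → ℝ≥0∞) : ∫⁻ z in T ×ˢ S, F z.swap = ∫⁻ z in S ×ˢ T, F z := by
  rw [← lintegral_indicator (hT.prod hS), ← lintegral_indicator (hS.prod hT), ← lintegral_swap_eq]
  congr 1
  ext z
  by_cases h1 : z.1 ∈ S <;> by_cases h2 : z.2 ∈ T <;> simp [indicator, h1, h2]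

/-- Testing with `(u-k)₊ η^p`. Pairs inside `B × B` are handled by `caccioppoli_pointwise`, mixed
pairs by `exterior_pointwise`. Symmetry of the kernel makes the two mixed regions contribute
equally, whence the factor `2`. -/
theorem caccioppoli_of_mixedKernel (hn : 1 ≤ n) (hs : 0 < s) (hs1 : s < 1) (ht : 0 < t)
    (ht1 : t < 1) (hp : 1 < p) (hν : 0 ≤ ν) (hL : 0 ≤ L) (hΩ : MeasurableSet Ω)
    (h : IsData s t p ν L a b Ks Kt) {u : Rn n → ℝ}
    (hu : IsWeakSubsolution s t p a b Ks Kt Ω u) {x₀ : Rn n} {ρ' ρ δ k : ℝ} (hδ : 0 < δ)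
    (hρ : ρ' + δ ≤ ρ) (hB : ball x₀ ρ ⊆ Ω) (hk : 0 ≤ k) :
    ∫⁻ z in ball x₀ ρ' ×ˢ ball x₀ ρ, ENNReal.ofReal
        (|trunc k (u z.1) - trunc k (u z.2)| ^ p / 2 * mixedKernel a b Ks Kt z) ≤
      (∫⁻ z in ball x₀ ρ ×ˢ ball x₀ ρ, ENNReal.ofReal
        ((2 * p) ^ p * (trunc k (u z.1) ^ p + trunc k (u z.2) ^ p) *
          |cutoff x₀ ρ' δ z.1 - cutoff x₀ ρ' δ z.2| ^ p * mixedKernel a b Ks Kt z))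
      + 2 * ∫⁻ z in ball x₀ ρ ×ˢ (ball x₀ ρ)ᶜ, ENNReal.ofReal
        (trunc k (u z.2) ^ (p - 1) * (trunc k (u z.1) * cutoff x₀ ρ' δ z.1 ^ p)
          * mixedKernel a b Ks Kt z) := by
  set η := cutoff x₀ ρ' δ with hη
  set κ := mixedKernel a b Ks Kt with hκ
  set B := ball x₀ ρ with hBdef
  set B' := ball x₀ ρ' with hB'def
  have hBm : MeasurableSet B := measurableSet_ball
  have hB'm : MeasurableSet B' := measurableSet_ball
  have hB'B : B' ⊆ B := ball_subset_ball (by linarith)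
  have hη0 : ∀ x, 0 ≤ η x := cutoff_nonneg _ _ _
  have hηB : ∀ x, x ∉ B → η x = 0 := fun x hx =>
    cutoff_eq_zero hδ fun hx' => hx (ball_subset_ball hρ hx')
  have hη1 : ∀ x ∈ B', η x = 1 := fun x hx => cutoff_eq_one hδ hx
  have hp0 : 0 < p := by linarith
  set φ : Rn n → ℝ := fun x => trunc k (u x) * η x ^ p with hφ
  have hφB : ∀ x, x ∉ B → φ x = 0 := fun x hx => by
    simp only [hφ, hηB x hx, Real.zero_rpow hp0.ne', mul_zero]
  have hφadm : φ ∈ admissible s t p a b Ω := by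
    -- `η ^ p` has Lipschitz constant `p / δ`; the maximum with `1` secures `1 ≤ Λ`.
    refine trunc_mul_mem_admissible hn hs hs1 ht ht1 hp h hL hΩ hu.1 hk (Λ := max 1 (p / δ))
      (le_max_left _ _) ((measurable_cutoff _ _ _).pow_const p)
      (fun x => Real.rpow_nonneg (hη0 x) _)
      (fun x => Real.rpow_le_one (hη0 x) (cutoff_le_one _ _ _ _) hp0.le) (fun x y => ?_)
    refine (abs_cutoff_rpow_sub_le hp.le hδ x y).trans ?_
    gcongr
    exact le_max_right _ _
  have hweak := hu.2 φ hφadm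
    (Filter.Eventually.of_forall fun x => mul_nonneg (trunc_nonneg _ _)
      (Real.rpow_nonneg (hη0 x) _))
    (Filter.Eventually.of_forall fun x hx => hφB x fun hx' => hx (hB hx'))
  obtain ⟨hint, heq⟩ := weakForm_eq_setIntegral hn h hp hL hν hu.1 hφadm
  rw [heq] at hweak
  set P₀ : Rn n × Rn n → ℝ := fun z => |trunc k (u z.1) - trunc k (u z.2)| ^ p / 2 * κ z with hP₀
  set N₁ : Rn n × Rn n → ℝ := fun z => (2 * p) ^ p * (trunc k (u z.1) ^ p + trunc k (u z.2) ^ p) *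
    |η z.1 - η z.2| ^ p * κ z with hN₁
  set N₂ : Rn n × Rn n → ℝ := fun z =>
    trunc k (u z.2) ^ (p - 1) * (trunc k (u z.1) * η z.1 ^ p) * κ z with hN₂
  have hκ0 : ∀ᵐ z, 0 ≤ κ z := by
    filter_upwards [ae_mixedKernel_bounds hn h] with z hz
    exact le_trans (mul_nonneg hν (density_nonneg h.coeff_a h.coeff_b z)) hz.1
  have hT0 := fun x => trunc_nonneg k (u x)
  have hP0 : ∀ᵐ z : Rn n × Rn n, 0 ≤ (B' ×ˢ B).indicator P₀ z := by
    filter_upwards [hκ0] with z hz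
    refine indicator_apply_nonneg fun _ => ?_
    simp only [hP₀]
    positivity
  have hN₁0 : ∀ᵐ z : Rn n × Rn n, 0 ≤ N₁ z := by
    filter_upwards [hκ0] with z hz
    have h1 := hT0 z.1
    have h2 := hT0 z.2
    simp only [hN₁]
    positivity
  have hN₂0 : ∀ z, 0 ≤ κ z → 0 ≤ N₂ z := by
    intro z hz
    have h1 := hT0 z.1
    have h2 := hT0 z.2
    have h3 := hη0 z.1
    simp only [hN₂]
    positivity
  have hκs : ∀ z, κ z.swap = κ z := mixedKernel_swap h
  set N : Rn n × Rn n → ℝ := fun z => (B ×ˢ B).indicator N₁ z + (B ×ˢ Bᶜ).indicator N₂ z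
    + (Bᶜ ×ˢ B).indicator (fun z => N₂ z.swap) z with hN
  have hN0 : ∀ᵐ z : Rn n × Rn n, 0 ≤ N z := by
    filter_upwards [hκ0, hN₁0] with z hz h1
    have h2 := hN₂0 z hz
    have h3 := hN₂0 z.swap (by rw [hκs]; exact hz)
    refine add_nonneg (add_nonneg ?_ ?_) ?_ <;> exact indicator_apply_nonneg fun _ => by assumption
  have hmain : ∀ᵐ z : Rn n × Rn n, (B' ×ˢ B).indicator P₀ z ≤
      signPow p (u z.1 - u z.2) * (φ z.1 - φ z.2) * κ z + N z := by
    filter_upwards [hκ0] with z hz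
    by_cases h1 : z.1 ∈ B <;> by_cases h2 : z.2 ∈ B
    · have hpt := caccioppoli_pointwise k (u z.1) (u z.2) hp (hη0 z.1) (hη0 z.2)
      have hpt' := mul_le_mul_of_nonneg_right hpt hz
      have hNz : N z = N₁ z := by simp [hN, indicator, h1, h2]
      rw [hNz]
      refine le_trans ?_ (hpt'.trans (le_of_eq (by simp only [hφ, hN₁]; ring)))
      -- On `B' × B` the larger of the two cutoff values is `1`; for `z.1 ∉ B'` the good term is
      -- simply dropped.
      by_cases h3 : z.1 ∈ B'
      · have hmem : z ∈ B' ×ˢ B := ⟨h3, h2⟩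
        rw [indicator_of_mem hmem, hη1 _ h3, max_eq_left (cutoff_le_one _ _ _ _), Real.one_rpow,
          mul_one]
      · have hmem : z ∉ B' ×ˢ B := fun hm => h3 hm.1
        rw [indicator_of_notMem hmem]
        have := hη0 z.1
        positivity
    · have hmem : z ∉ B' ×ˢ B := fun hm => h2 hm.2
      have hNz : N z = N₂ z := by simp [hN, indicator, h1, h2]
      rw [indicator_of_notMem hmem, hNz, hφB _ h2, sub_zero]
      have hpt := mul_le_mul_of_nonneg_right
        (exterior_pointwise k (u z.1) (u z.2) hp (Real.rpow_nonneg (hη0 z.1) p)) hz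
      simp only [hφ, hN₂]
      linarith
    · have hmem : z ∉ B' ×ˢ B := fun hm => h1 (hB'B hm.1)
      have hNz : N z = N₂ z.swap := by simp [hN, indicator, h1, h2]
      rw [indicator_of_notMem hmem, hNz, hφB _ h1, zero_sub, ← neg_sub (u z.2), signPow_neg]
      have hpt := mul_le_mul_of_nonneg_right
        (exterior_pointwise k (u z.2) (u z.1) hp (Real.rpow_nonneg (hη0 z.2) p)) hz
      simp only [hφ, hN₂, hκs, Prod.fst_swap, Prod.snd_swap]
      linarith
    · have hmem : z ∉ B' ×ˢ B := fun hm => h2 hm.2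
      have hNz : N z = 0 := by simp [hN, indicator, h1, h2]
      rw [indicator_of_notMem hmem, hNz, hφB _ h1, hφB _ h2]
      simp
  have hle := lintegral_ofReal_le_of_integral_nonpos hint hweak (ae_restrict_of_ae hP0)
    (ae_restrict_of_ae hN0) (ae_restrict_of_ae hmain)
  have hPle : ∫⁻ z in B' ×ˢ B, ENNReal.ofReal (P₀ z) ≤
      ∫⁻ z in interactionSet Ω, ENNReal.ofReal ((B' ×ˢ B).indicator P₀ z) := by
    have hsub : B' ×ˢ B ⊆ interactionSet Ω := fun z hz hc => hc.2 (hB hz.2)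
    have : ∀ z, ENNReal.ofReal ((B' ×ˢ B).indicator P₀ z) =
        (B' ×ˢ B).indicator (fun z => ENNReal.ofReal (P₀ z)) z := fun z => by
      by_cases hx : z ∈ B' ×ˢ B
      · rw [indicator_of_mem hx, indicator_of_mem hx]
      · rw [indicator_of_notMem hx, indicator_of_notMem hx, ENNReal.ofReal_zero]
    simp_rw [this]
    rw [lintegral_indicator (hB'm.prod hBm), Measure.restrict_restrict (hB'm.prod hBm),
      inter_eq_self_of_subset_left hsub]
  have htrunc := measurable_trunc k
  have hw1 := htrunc.comp_aemeasurable (aemeasurable_fst hu.1.1)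
  have hw2 := htrunc.comp_aemeasurable (aemeasurable_snd hu.1.1)
  have hκm : AEMeasurable κ := aemeasurable_mixedKernel h
  have hηm : Measurable η := measurable_cutoff _ _ _
  have hη12 : Measurable fun z : Rn n × Rn n => |η z.1 - η z.2| ^ p := by fun_prop
  have hη1m : Measurable fun z : Rn n × Rn n => η z.1 ^ p := by fun_prop
  have hN₁m : AEMeasurable N₁ :=
    (((hw1.pow_const p).add (hw2.pow_const p)).const_mul _ |>.mul hη12.aemeasurable).mul hκm
  have hN₂m : AEMeasurable N₂ :=
    ((hw2.pow_const (p - 1)).mul (hw1.mul hη1m.aemeasurable)).mul hκm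
  refine hPle.trans (hle.trans ((setLIntegral_le_lintegral _ _).trans ?_))
  refine (lintegral_indicator_add_three_le (hBm.prod hBm) (hBm.prod hBm.compl)
    (hBm.compl.prod hBm) hN₁m hN₂m).trans (le_of_eq ?_)
  rw [setLIntegral_prod_swap hBm hBm.compl (fun z => ENNReal.ofReal (N₂ z)), add_assoc, ← two_mul]

end Caccioppoli

/-! ### The Caccioppoli inequality in scaled form. -/

section ScaledCaccioppoli

variable {n : ℕ} {s t p ν L : ℝ} {a b Ks Kt : Rn n → Rn n → ℝ} {Ω : Set (Rn n)}

/-- The quotient of the two sides is `(2r/d)^{(t-s)p} ≥ 1`. The `2` is there because points of `B_r`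
may be up to `2r` apart. -/
theorem div_rpow_exponent_le {r d : ℝ} (hst : s ≤ t) (hp : 0 ≤ p) (hr : 0 < r) (hd : 0 < d)
    (hdr : d ≤ 2 * r) :
    r ^ (s * p) / d ^ ((n : ℝ) + s * p) ≤
      2 ^ ((t - s) * p) * (r ^ (t * p) / d ^ ((n : ℝ) + t * p)) := by
  have h1 : (1 : ℝ) ≤ (2 * r / d) ^ ((t - s) * p) :=
    Real.one_le_rpow ((one_le_div hd).mpr hdr) (mul_nonneg (by linarith) hp)
  have h2 : (2 : ℝ) ^ ((t - s) * p) * (r ^ (t * p) / d ^ ((n : ℝ) + t * p)) =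
      (2 * r / d) ^ ((t - s) * p) * (r ^ (s * p) / d ^ ((n : ℝ) + s * p)) := by
    rw [Real.div_rpow (by positivity) hd.le, Real.mul_rpow (by norm_num) hr.le,
      show t * p = (t - s) * p + s * p by ring, Real.rpow_add hr,
      show (n : ℝ) + ((t - s) * p + s * p) = (t - s) * p + ((n : ℝ) + s * p) by ring,
      Real.rpow_add hd]
    field_simp
  rw [h2]
  exact le_mul_of_one_le_left (by positivity) h1

/-- The quantity `a(x,y) r^{-sp} + b(x,y) r^{-tp}`. -/
noncomputable def scaledCoeff (s t p : ℝ) (a b : Rn n → Rn n → ℝ) (r : ℝ) (z : Rn n × Rn n) : ℝ :=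
  a z.1 z.2 / r ^ (s * p) + b z.1 z.2 / r ^ (t * p)

/-- Together with `density_le_scaledCoeff_mul` this sandwiches the two-order weight between
normalized kernels of a single order, `s` below and `t` above, with the same coefficient
`scaledCoeff`. No later estimate needs `a` and `b` separately inside the ball. -/
theorem scaledCoeff_mul_le_density (ha : IsCoefficient a) (hb : IsCoefficient b) (hst : s ≤ t)
    (hp : 0 ≤ p) {r : ℝ} (hr : 0 < r) {z : Rn n × Rn n} (hz : z.1 ≠ z.2)
    (hzr : ‖z.1 - z.2‖ ≤ 2 * r) :
    scaledCoeff s t p a b r z * (r ^ (s * p) / ‖z.1 - z.2‖ ^ ((n : ℝ) + s * p)) ≤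
      2 ^ ((t - s) * p) * density s t p a b z := by
  have hd : 0 < ‖z.1 - z.2‖ := norm_pos_iff.mpr (sub_ne_zero.mpr hz)
  have ha0 := ha.nonneg z.1 z.2
  have hb0 := hb.nonneg z.1 z.2
  have h1 := div_rpow_exponent_le (n := n) hst hp hr hd hzr
  have h2 : (1 : ℝ) ≤ 2 ^ ((t - s) * p) :=
    Real.one_le_rpow (by norm_num) (mul_nonneg (by linarith) hp)
  simp only [scaledCoeff, density]
  rw [add_mul, mul_add]
  apply add_le_add
  · calc _ = a z.1 z.2 / ‖z.1 - z.2‖ ^ ((n : ℝ) + s * p) := by field_simp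
      _ ≤ _ := le_mul_of_one_le_left (by positivity) h2
  · calc _ ≤ b z.1 z.2 / r ^ (t * p) *
        (2 ^ ((t - s) * p) * (r ^ (t * p) / ‖z.1 - z.2‖ ^ ((n : ℝ) + t * p))) := by gcongr
      _ = _ := by field_simp

theorem density_le_scaledCoeff_mul (ha : IsCoefficient a) (hb : IsCoefficient b) (hst : s ≤ t)
    (hp : 0 ≤ p) {r : ℝ} (hr : 0 < r) {z : Rn n × Rn n} (hz : z.1 ≠ z.2)
    (hzr : ‖z.1 - z.2‖ ≤ 2 * r) :
    density s t p a b z ≤ 2 ^ ((t - s) * p) *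
      (scaledCoeff s t p a b r z * (r ^ (t * p) / ‖z.1 - z.2‖ ^ ((n : ℝ) + t * p))) := by
  have hd : 0 < ‖z.1 - z.2‖ := norm_pos_iff.mpr (sub_ne_zero.mpr hz)
  have ha0 := ha.nonneg z.1 z.2
  have hb0 := hb.nonneg z.1 z.2
  have h1 := div_rpow_exponent_le (n := n) hst hp hr hd hzr
  have h2 : (1 : ℝ) ≤ 2 ^ ((t - s) * p) :=
    Real.one_le_rpow (by norm_num) (mul_nonneg (by linarith) hp)
  simp only [scaledCoeff, density]
  rw [add_mul, mul_add]
  apply add_le_add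
  · calc _ = a z.1 z.2 / r ^ (s * p) *
        (r ^ (s * p) / ‖z.1 - z.2‖ ^ ((n : ℝ) + s * p)) := by field_simp
      _ ≤ a z.1 z.2 / r ^ (s * p) *
        (2 ^ ((t - s) * p) * (r ^ (t * p) / ‖z.1 - z.2‖ ^ ((n : ℝ) + t * p))) := by gcongr
      _ = _ := by ring
  · calc _ = b z.1 z.2 / ‖z.1 - z.2‖ ^ ((n : ℝ) + t * p) := by ring
      _ ≤ 2 ^ ((t - s) * p) * (b z.1 z.2 / ‖z.1 - z.2‖ ^ ((n : ℝ) + t * p)) :=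
        le_mul_of_one_le_left (by positivity) h2
      _ = _ := by field_simp

/-- The integrand of the nonlocal tail. -/
noncomputable def tailDensity (s t p : ℝ) (a b : Rn n → Rn n → ℝ) (f : Rn n → ℝ) (x₀ : Rn n)
    (z : Rn n × Rn n) : ℝ :=
  a z.1 z.2 * (|f z.2| ^ (p - 1) / ‖z.2 - x₀‖ ^ ((n : ℝ) + s * p))
    + b z.1 z.2 * (|f z.2| ^ (p - 1) / ‖z.2 - x₀‖ ^ ((n : ℝ) + t * p))

/-- The shell of width `δ` between `x` and `y` gives `|x-y| ≥ |y-x₀| - (ρ'+δ) ≥ (δ/r) |y-x₀|`. Since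
`r/δ ≥ 1` and `σ ≤ p`, the power `n + p` serves both orders. -/
theorem one_div_rpow_le_of_exterior {x₀ x y : Rn n} {r ρ' δ σ : ℝ} (hδ : 0 < δ) (hρ' : 0 ≤ ρ')
    (hr : ρ' + 2 * δ ≤ r) (hσ0 : 0 ≤ σ) (hσ : σ ≤ p) (hx : x ∈ ball x₀ (ρ' + δ))
    (hy : y ∉ ball x₀ (ρ' + 2 * δ)) :
    1 / ‖x - y‖ ^ ((n : ℝ) + σ) ≤ (r / δ) ^ ((n : ℝ) + p) * (1 / ‖y - x₀‖ ^ ((n : ℝ) + σ)) := by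
  rw [mem_ball, dist_eq_norm] at hx hy
  have htri : ‖y - x₀‖ ≤ ‖x - y‖ + ‖x - x₀‖ := by
    have := norm_add_le (y - x) (x - x₀)
    rwa [sub_add_sub_cancel, norm_sub_rev y x] at this
  have hd : 0 < ‖x - y‖ := by linarith
  have hY : 0 < ‖y - x₀‖ := by linarith
  have hr0 : 0 < r := by linarith
  have hrδ : 1 ≤ r / δ := by rw [one_le_div hδ]; linarith
  have hle : ‖y - x₀‖ ≤ r / δ * ‖x - y‖ := by
    rw [div_mul_eq_mul_div, le_div_iff₀ hδ]
    have h1 : ‖y - x₀‖ - (ρ' + δ) ≤ ‖x - y‖ := by linarith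
    calc ‖y - x₀‖ * δ ≤ (ρ' + 2 * δ) * (‖y - x₀‖ - (ρ' + δ)) := by nlinarith
      _ ≤ r * ‖x - y‖ := by
        apply mul_le_mul hr h1 (by linarith) hr0.le
  have hpow : ‖y - x₀‖ ^ ((n : ℝ) + σ) ≤ (r / δ) ^ ((n : ℝ) + p) * ‖x - y‖ ^ ((n : ℝ) + σ) :=
    calc _ ≤ (r / δ * ‖x - y‖) ^ ((n : ℝ) + σ) := by gcongr
      _ = (r / δ) ^ ((n : ℝ) + σ) * ‖x - y‖ ^ ((n : ℝ) + σ) :=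
        Real.mul_rpow (by positivity) hd.le
      _ ≤ _ := by
        gcongr
  rw [mul_one_div, div_le_div_iff₀ (by positivity) (by positivity), one_mul]
  exact hpow

/-- The cutoff lives in `B_{ρ'+δ}`, so the kernel may be recentred at `x₀`. The integral in `y` is
then bounded by the tail for almost every `x`, and `∫ (u-k)₊` remains. -/
theorem setLIntegral_exterior_le (hn : 1 ≤ n) (hs : 0 ≤ s) (hs1 : s ≤ 1) (ht : 0 ≤ t)
    (ht1 : t ≤ 1) (hp : 1 < p) (hL : 0 ≤ L) (h : IsData s t p ν L a b Ks Kt) {u : Rn n → ℝ}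
    (hu : AEMeasurable u) {x₀ : Rn n} {r ρ' δ k : ℝ} (hδ : 0 < δ) (hρ' : r / 2 ≤ ρ') (hr0 : 0 < r)
    (hr : ρ' + 2 * δ ≤ r) (hk : 0 ≤ k) :
    ∫⁻ z in ball x₀ (ρ' + 2 * δ) ×ˢ (ball x₀ (ρ' + 2 * δ))ᶜ, ENNReal.ofReal
        (trunc k (u z.2) ^ (p - 1) * (trunc k (u z.1) * cutoff x₀ ρ' δ z.1 ^ p)
          * mixedKernel a b Ks Kt z) ≤
      ENNReal.ofReal (L * (r / δ) ^ ((n : ℝ) + p)) *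
        (nonlocalTail s t p a b (positivePart u) x₀ (r / 2) r *
          ∫⁻ x in ball x₀ (ρ' + 2 * δ), ENNReal.ofReal (trunc k (u x))) := by
  set B := ball x₀ (ρ' + 2 * δ) with hB
  have hBm : MeasurableSet B := measurableSet_ball
  set T := nonlocalTail s t p a b (positivePart u) x₀ (r / 2) r with hT
  have hTx : ∀ᵐ x, x ∈ B → ∫⁻ y in Bᶜ,
      ENNReal.ofReal (tailDensity s t p a b (positivePart u) x₀ (x, y)) ≤ T := by
    have h1 := ENNReal.ae_le_essSup (μ := volume.restrict (ball x₀ r))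
      (fun x => ∫⁻ y in (ball x₀ (r / 2))ᶜ,
        ENNReal.ofReal (tailDensity s t p a b (positivePart u) x₀ (x, y)))
    rw [ae_restrict_iff' measurableSet_ball] at h1
    filter_upwards [h1] with x hx hxB
    refine le_trans (lintegral_mono_set ?_) (hx (ball_subset_ball hr hxB))
    exact compl_subset_compl.mpr (ball_subset_ball (by linarith))
  have hpt : ∀ᵐ z : Rn n × Rn n, z ∈ B ×ˢ Bᶜ → ENNReal.ofReal
      (trunc k (u z.2) ^ (p - 1) * (trunc k (u z.1) * cutoff x₀ ρ' δ z.1 ^ p)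
          * mixedKernel a b Ks Kt z) ≤
      ENNReal.ofReal (L * (r / δ) ^ ((n : ℝ) + p) * trunc k (u z.1)) *
        ENNReal.ofReal (tailDensity s t p a b (positivePart u) x₀ z) := by
    filter_upwards [ae_mixedKernel_bounds hn h] with z hz hzB
    have ha0 := h.coeff_a.nonneg z.1 z.2
    have hb0 := h.coeff_b.nonneg z.1 z.2
    have hw1 := trunc_nonneg k (u z.1)
    have hw2 := trunc_nonneg k (u z.2)
    have hη0 := cutoff_nonneg x₀ ρ' δ z.1
    have hd0 := density_nonneg (s := s) (t := t) (p := p) h.coeff_a h.coeff_b z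
    rw [← ENNReal.ofReal_mul (by positivity)]
    by_cases hx : z.1 ∈ ball x₀ (ρ' + δ)
    · apply ENNReal.ofReal_le_ofReal
      have hη1 : cutoff x₀ ρ' δ z.1 ^ p ≤ 1 :=
        Real.rpow_le_one hη0 (cutoff_le_one _ _ _ _) (by linarith)
      have e1 := one_div_rpow_le_of_exterior (p := p) (σ := s * p) hδ (by linarith) hr
        (by positivity) (by nlinarith) hx hzB.2
      have e2 := one_div_rpow_le_of_exterior (p := p) (σ := t * p) hδ (by linarith) hr
        (by positivity) (by nlinarith) hx hzB.2
      have hw2' : trunc k (u z.2) ≤ |positivePart u z.2| :=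
        (trunc_le_max hk).trans (le_abs_self _)
      have hW : trunc k (u z.2) ^ (p - 1) ≤ |positivePart u z.2| ^ (p - 1) :=
        Real.rpow_le_rpow hw2 hw2' (by linarith)
      have hdens : density s t p a b z ≤ (r / δ) ^ ((n : ℝ) + p) *
          (a z.1 z.2 * (1 / ‖z.2 - x₀‖ ^ ((n : ℝ) + s * p)) +
            b z.1 z.2 * (1 / ‖z.2 - x₀‖ ^ ((n : ℝ) + t * p))) := by
        rw [density, div_eq_mul_one_div, div_eq_mul_one_div (b z.1 z.2)]
        calc _ ≤ a z.1 z.2 * ((r / δ) ^ ((n : ℝ) + p) * (1 / ‖z.2 - x₀‖ ^ ((n : ℝ) + s * p)))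
            + b z.1 z.2 * ((r / δ) ^ ((n : ℝ) + p) * (1 / ‖z.2 - x₀‖ ^ ((n : ℝ) + t * p))) := by
              gcongr
          _ = _ := by ring
      calc _ ≤ trunc k (u z.2) ^ (p - 1) * (trunc k (u z.1) * cutoff x₀ ρ' δ z.1 ^ p)
            * (L * density s t p a b z) := by
            gcongr
            exact hz.2
        _ ≤ |positivePart u z.2| ^ (p - 1) * (trunc k (u z.1) * 1) * (L *
            ((r / δ) ^ ((n : ℝ) + p) *
            (a z.1 z.2 * (1 / ‖z.2 - x₀‖ ^ ((n : ℝ) + s * p)) +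
            b z.1 z.2 * (1 / ‖z.2 - x₀‖ ^ ((n : ℝ) + t * p))))) := by gcongr
        _ = _ := by simp only [tailDensity]; ring
    · rw [cutoff_eq_zero hδ hx, Real.zero_rpow (by linarith)]
      simp
  calc _ ≤ ∫⁻ z in B ×ˢ Bᶜ, ENNReal.ofReal (L * (r / δ) ^ ((n : ℝ) + p) * trunc k (u z.1)) *
        ENNReal.ofReal (tailDensity s t p a b (positivePart u) x₀ z) :=
        setLIntegral_mono_ae' (hBm.prod hBm.compl) hpt
    _ ≤ ∫⁻ x in B, ∫⁻ y in Bᶜ, ENNReal.ofReal (L * (r / δ) ^ ((n : ℝ) + p) * trunc k (u x)) *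
        ENNReal.ofReal (tailDensity s t p a b (positivePart u) x₀ (x, y)) := by
      rw [Measure.volume_eq_prod, ← Measure.prod_restrict]
      exact lintegral_prod_le _
    _ = ∫⁻ x in B, ENNReal.ofReal (L * (r / δ) ^ ((n : ℝ) + p) * trunc k (u x)) *
        ∫⁻ y in Bᶜ, ENNReal.ofReal (tailDensity s t p a b (positivePart u) x₀ (x, y)) := by
      congr 1; ext x
      exact lintegral_const_mul' _ _ ENNReal.ofReal_ne_top
    _ ≤ ∫⁻ x in B, ENNReal.ofReal (L * (r / δ) ^ ((n : ℝ) + p)) *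
        (T * ENNReal.ofReal (trunc k (u x))) := by
      refine setLIntegral_mono_ae' hBm ?_
      filter_upwards [hTx] with x hx hxB
      rw [ENNReal.ofReal_mul (by positivity), mul_assoc, mul_comm T]
      gcongr
      exact hx hxB
    _ ≤ _ := by
      rw [lintegral_const_mul' _ _ ENNReal.ofReal_ne_top]
      gcongr
      have htrunc := measurable_trunc k
      have hm : AEMeasurable (fun x => ENNReal.ofReal (trunc k (u x))) :=
        (htrunc.comp_aemeasurable hu).ennreal_ofReal
      rw [lintegral_const_mul'' _ hm.restrict]

/-- The cutoff gives `(|x-y|/δ)^p` and the kernel at most a multiple of `M r^{tp} |x-y|^{-n-tp}`. As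
`t < 1`, the product is integrable in one variable over a ball of radius `2r`, with result
proportional to `M (r/δ)^p`. -/
theorem setLIntegral_interior_le (hn : 1 ≤ n) (hst : s ≤ t) (ht1 : t < 1) (hp : 1 < p)
    (hL : 0 < L) : ∃ C : ℝ, 0 < C ∧ ∀ {Ω : Set (Rn n)} {a b Ks Kt : Rn n → Rn n → ℝ}
      (_ : IsData s t p ν L a b Ks Kt) {u : Rn n → ℝ} (_ : AEMeasurable u) {x₀ : Rn n}
      {r ρ' ρ δ k M : ℝ}, 0 < δ → 0 < r → ρ ≤ r → 0 ≤ M →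
      (∀ᵐ z : Rn n × Rn n, z ∈ ball x₀ r ×ˢ ball x₀ r → scaledCoeff s t p a b r z ≤ M) →
      ∫⁻ z in ball x₀ ρ ×ˢ ball x₀ ρ, ENNReal.ofReal
        ((2 * p) ^ p * (trunc k (u z.1) ^ p + trunc k (u z.2) ^ p) *
          |cutoff x₀ ρ' δ z.1 - cutoff x₀ ρ' δ z.2| ^ p * mixedKernel a b Ks Kt z) ≤
      ENNReal.ofReal (C * (r / δ) ^ p * M) *
        ∫⁻ x in ball x₀ ρ, ENNReal.ofReal (trunc k (u x) ^ p) := by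
  have hγ : 0 < p - t * p := by nlinarith
  obtain ⟨C₁, hC₁, hker⟩ := exists_setLIntegral_ball_rpow_le hn hγ
  refine ⟨2 * ((2 * p) ^ p * L * 2 ^ ((t - s) * p) * C₁ * 2 ^ (p - t * p)), by positivity, ?_⟩
  intro Ω a b Ks Kt h u hu x₀ r ρ' ρ δ k M hδ hr hρr hM hcoeff
  set B := ball x₀ ρ with hB
  have hBm : MeasurableSet B := measurableSet_ball
  set A : ℝ := (2 * p) ^ p * L * 2 ^ ((t - s) * p) * M * r ^ (t * p) / δ ^ p with hA
  have hA0 : 0 ≤ A := by positivity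
  set Q : Rn n × Rn n → ℝ≥0∞ := fun z => ENNReal.ofReal (‖z.1 - z.2‖ ^ (p - t * p - n)) with hQ
  set F : Rn n → ℝ≥0∞ := fun x => ENNReal.ofReal (trunc k (u x) ^ p) with hF
  have hpt : ∀ᵐ z : Rn n × Rn n, z ∈ B ×ˢ B → ENNReal.ofReal
        ((2 * p) ^ p * (trunc k (u z.1) ^ p + trunc k (u z.2) ^ p) *
          |cutoff x₀ ρ' δ z.1 - cutoff x₀ ρ' δ z.2| ^ p * mixedKernel a b Ks Kt z) ≤
      ENNReal.ofReal A * (F z.1 * Q z + F z.2 * Q z) := by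
    filter_upwards [ae_mixedKernel_bounds hn h, ae_fst_ne_snd hn, hcoeff] with z hz hne hc hzB
    have hd : 0 < ‖z.1 - z.2‖ := norm_pos_iff.mpr (sub_ne_zero.mpr hne)
    have hsub : B ⊆ ball x₀ r := ball_subset_ball hρr
    have hdr : ‖z.1 - z.2‖ ≤ 2 * r := by
      have h1 := mem_ball.mp (hsub hzB.1)
      have h2 := mem_ball.mp (hsub hzB.2)
      rw [← dist_eq_norm]
      have := dist_triangle_right z.1 z.2 x₀
      linarith
    have hc' := hc ⟨hsub hzB.1, hsub hzB.2⟩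
    have hd0 := density_nonneg (s := s) (t := t) (p := p) h.coeff_a h.coeff_b z
    have hdens := density_le_scaledCoeff_mul h.coeff_a h.coeff_b hst (by linarith : 0 ≤ p) hr hne hdr
    have hw1 := trunc_nonneg k (u z.1)
    have hw2 := trunc_nonneg k (u z.2)
    rw [hQ, hF, ← add_mul, ← ENNReal.ofReal_add (by positivity) (by positivity),
      ← ENNReal.ofReal_mul (by positivity), ← ENNReal.ofReal_mul (by positivity)]
    apply ENNReal.ofReal_le_ofReal
    have hpow : ‖z.1 - z.2‖ ^ (p - t * p - n) =
        ‖z.1 - z.2‖ ^ p / ‖z.1 - z.2‖ ^ ((n : ℝ) + t * p) := by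
      rw [← Real.rpow_sub hd]; congr 1; ring
    calc _ ≤ (2 * p) ^ p * (trunc k (u z.1) ^ p + trunc k (u z.2) ^ p) *
          (‖z.1 - z.2‖ / δ) ^ p * (L * (2 ^ ((t - s) * p) *
            (M * (r ^ (t * p) / ‖z.1 - z.2‖ ^ ((n : ℝ) + t * p))))) := by
          have hκ0 : mixedKernel a b Ks Kt z ≤ L * (2 ^ ((t - s) * p) *
            (M * (r ^ (t * p) / ‖z.1 - z.2‖ ^ ((n : ℝ) + t * p)))) := by
            refine hz.2.trans (mul_le_mul_of_nonneg_left (hdens.trans ?_) hL.le)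
            gcongr
          have hlip : |cutoff x₀ ρ' δ z.1 - cutoff x₀ ρ' δ z.2| ^ p ≤ (‖z.1 - z.2‖ / δ) ^ p :=
            Real.rpow_le_rpow (abs_nonneg _) (abs_cutoff_sub_le hδ _ _) (by linarith)
          refine (mul_le_mul_of_nonneg_left hκ0 (by positivity)).trans ?_
          gcongr
      _ = _ := by
        rw [hpow, Real.div_rpow hd.le hδ.le, hA]
        ring
  have htrunc := measurable_trunc k
  have hFm : AEMeasurable F := ((htrunc.comp_aemeasurable hu).pow_const p).ennreal_ofReal
  have hQm : Measurable Q := by rw [hQ]; fun_prop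
  have hinner : ∫⁻ z in B ×ˢ B, F z.1 * Q z ≤
      (∫⁻ x in B, F x) * ENNReal.ofReal (C₁ * (2 * r) ^ (p - t * p)) := by
    calc _ ≤ ∫⁻ x in B, ∫⁻ y in B, F x * Q (x, y) := by
          rw [Measure.volume_eq_prod, ← Measure.prod_restrict]
          exact lintegral_prod_le _
      _ = ∫⁻ x in B, F x * ∫⁻ y in B, Q (x, y) := by
        congr 1; ext x
        exact lintegral_const_mul' _ _ ENNReal.ofReal_ne_top
      _ ≤ ∫⁻ x in B, F x * ENNReal.ofReal (C₁ * (2 * r) ^ (p - t * p)) := by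
        refine setLIntegral_mono' hBm fun x hx => ?_
        gcongr
        refine le_trans (lintegral_mono_set ?_) (hker x (2 * r) (by positivity))
        intro y hy
        rw [hB, mem_ball] at *
        have := dist_triangle_right y x x₀
        linarith
      _ = _ := lintegral_mul_const' _ _ ENNReal.ofReal_ne_top
  have hswap : ∫⁻ z in B ×ˢ B, F z.2 * Q z = ∫⁻ z in B ×ˢ B, F z.1 * Q z := by
    rw [← setLIntegral_prod_swap hBm hBm]
    simp only [hQ, Prod.fst_swap, Prod.snd_swap, norm_sub_rev]
  have hm1 : AEMeasurable (fun z : Rn n × Rn n => F z.1 * Q z) :=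
    hFm.comp_fst.mul hQm.aemeasurable
  calc _ ≤ ∫⁻ z in B ×ˢ B, ENNReal.ofReal A * (F z.1 * Q z + F z.2 * Q z) :=
        setLIntegral_mono_ae' (hBm.prod hBm) hpt
    _ = ENNReal.ofReal A * (2 * ∫⁻ z in B ×ˢ B, F z.1 * Q z) := by
      rw [lintegral_const_mul' _ _ ENNReal.ofReal_ne_top, lintegral_add_left' hm1.restrict, hswap,
        ← two_mul]
    _ ≤ ENNReal.ofReal A * (2 * ((∫⁻ x in B, F x) *
          ENNReal.ofReal (C₁ * (2 * r) ^ (p - t * p)))) := by gcongr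
    _ = ENNReal.ofReal (A * (2 * (C₁ * (2 * r) ^ (p - t * p)))) * ∫⁻ x in B, F x := by
      rw [ENNReal.ofReal_mul hA0, ENNReal.ofReal_mul zero_le_two, ENNReal.ofReal_ofNat]
      ring
    _ = _ := by
      congr 2
      have h1 : r ^ (t * p) * r ^ (p - t * p) = r ^ p := by
        rw [← Real.rpow_add hr]; congr 1; ring
      rw [hA, Real.mul_rpow (by norm_num) hr.le, Real.div_rpow hr.le hδ.le, ← h1]
      ring

theorem caccioppoli (hn : 1 ≤ n) (hs : 0 < s) (hst : s < t) (ht1 : t < 1) (hp : 1 < p)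
    (hν : 0 < ν) (hL : 0 < L) : ∃ C : ℝ, 0 < C ∧ ∀ {Ω : Set (Rn n)}
      {a b Ks Kt : Rn n → Rn n → ℝ} (_ : MeasurableSet Ω) (_ : IsData s t p ν L a b Ks Kt)
      {u : Rn n → ℝ} (_ : IsWeakSubsolution s t p a b Ks Kt Ω u) {x₀ : Rn n}
      {r ρ' δ k m M : ℝ}, 0 < r → ball x₀ r ⊆ Ω → 0 < δ → r / 2 ≤ ρ' → ρ' + 2 * δ ≤ r → 0 ≤ k →
      0 ≤ m → 0 ≤ M →
      (∀ᵐ z : Rn n × Rn n, z ∈ ball x₀ r ×ˢ ball x₀ r →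
        m ≤ scaledCoeff s t p a b r z ∧ scaledCoeff s t p a b r z ≤ M) →
      ENNReal.ofReal (m * r ^ (s * p)) *
          ∫⁻ x in ball x₀ ρ', ∫⁻ y in ball x₀ (ρ' + 2 * δ), ENNReal.ofReal
            (|trunc k (u x) - trunc k (u y)| ^ p / ‖x - y‖ ^ ((n : ℝ) + s * p)) ≤
        ENNReal.ofReal (C * (r / δ) ^ ((n : ℝ) + p)) *
          (ENNReal.ofReal M * (∫⁻ x in ball x₀ (ρ' + 2 * δ), ENNReal.ofReal (trunc k (u x) ^ p))
            + nonlocalTail s t p a b (positivePart u) x₀ (r / 2) r *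
              ∫⁻ x in ball x₀ (ρ' + 2 * δ), ENNReal.ofReal (trunc k (u x))) := by
  obtain ⟨C₁, hC₁, hint⟩ := setLIntegral_interior_le (ν := ν) hn hst.le ht1 hp hL
  -- `2` undoes the halving in the good term, the power of `2` comes from comparing the weights, and
  -- `1 / ν` from ellipticity.
  set D : ℝ := 2 * 2 ^ ((t - s) * p) / ν with hD
  refine ⟨D * (C₁ + 2 * L), by positivity, ?_⟩
  intro Ω a b Ks Kt hΩ h u hu x₀ r ρ' δ k m M hr hB hδ hρ' hρr hk hm hM hcoeff
  have hraw := caccioppoli_of_mixedKernel hn hs (hst.trans ht1) (hs.trans hst) ht1 hp hν.le hL.le hΩ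
    h hu hδ (by linarith : ρ' + δ ≤ ρ' + 2 * δ) ((ball_subset_ball hρr).trans hB) hk
  have h1 := hint (Ω := Ω) h hu.1.1 (ρ' := ρ') (k := k) hδ hr hρr hM
    (hcoeff.mono fun z hz hzB => (hz hzB).2)
  have h2 := setLIntegral_exterior_le hn hs.le (hst.trans ht1).le (hs.trans hst).le ht1.le hp hL.le h
    hu.1.1 (x₀ := x₀) hδ hρ' hr hρr hk
  set B := ball x₀ (ρ' + 2 * δ) with hBdef
  set B' := ball x₀ ρ' with hB'def
  have hBm : MeasurableSet B := measurableSet_ball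
  have hB'm : MeasurableSet B' := measurableSet_ball
  set w : Rn n → ℝ := fun x => trunc k (u x) with hw
  have hrδ : 1 ≤ r / δ := by rw [one_le_div hδ]; linarith
  have htrunc := measurable_trunc k
  have hw1 : AEMeasurable fun z : Rn n × Rn n => w z.1 :=
    htrunc.comp_aemeasurable (aemeasurable_fst hu.1.1)
  have hw2 : AEMeasurable fun z : Rn n × Rn n => w z.2 :=
    htrunc.comp_aemeasurable (aemeasurable_snd hu.1.1)
  have hEm : AEMeasurable fun z : Rn n × Rn n => ENNReal.ofReal
      (|w z.1 - w z.2| ^ p / ‖z.1 - z.2‖ ^ ((n : ℝ) + s * p)) := by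
    have hnum : AEMeasurable fun z : Rn n × Rn n => |w z.1 - w z.2| ^ p :=
      (continuous_abs.measurable.comp_aemeasurable (hw1.sub hw2)).pow_const p
    have hden : Measurable fun z : Rn n × Rn n => ‖z.1 - z.2‖ ^ ((n : ℝ) + s * p) := by fun_prop
    exact (hnum.div hden.aemeasurable).ennreal_ofReal
  have hlow : ENNReal.ofReal (m * r ^ (s * p)) *
      (∫⁻ x in B', ∫⁻ y in B, ENNReal.ofReal (|w x - w y| ^ p / ‖x - y‖ ^ ((n : ℝ) + s * p))) ≤
      ENNReal.ofReal D * ∫⁻ z in B' ×ˢ B, ENNReal.ofReal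
        (|w z.1 - w z.2| ^ p / 2 * mixedKernel a b Ks Kt z) := by
    have hprod : ∫⁻ x in B', ∫⁻ y in B,
        ENNReal.ofReal (|w x - w y| ^ p / ‖x - y‖ ^ ((n : ℝ) + s * p)) =
        ∫⁻ z in B' ×ˢ B, ENNReal.ofReal
          (|w z.1 - w z.2| ^ p / ‖z.1 - z.2‖ ^ ((n : ℝ) + s * p)) := by
      rw [Measure.volume_eq_prod, ← Measure.prod_restrict, lintegral_prod]
      rw [Measure.prod_restrict]
      exact hEm.restrict
    rw [hprod, ← lintegral_const_mul' _ _ ENNReal.ofReal_ne_top,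
      ← lintegral_const_mul' _ _ ENNReal.ofReal_ne_top]
    refine setLIntegral_mono_ae' (hB'm.prod hBm) ?_
    filter_upwards [ae_mixedKernel_bounds hn h, ae_fst_ne_snd hn, hcoeff] with z hz hne hc hzB
    have hz1 : z.1 ∈ ball x₀ r := ball_subset_ball (by linarith) hzB.1
    have hz2 : z.2 ∈ ball x₀ r := ball_subset_ball hρr hzB.2
    have hdr : ‖z.1 - z.2‖ ≤ 2 * r := by
      have h1 := mem_ball.mp hz1
      have h2 := mem_ball.mp hz2
      rw [← dist_eq_norm]
      have := dist_triangle_right z.1 z.2 x₀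
      linarith
    have hdens := scaledCoeff_mul_le_density h.coeff_a h.coeff_b hst.le (by linarith : 0 ≤ p) hr hne
      hdr
    rw [← ENNReal.ofReal_mul (by positivity), ← ENNReal.ofReal_mul (by positivity)]
    apply ENNReal.ofReal_le_ofReal
    calc _ = |w z.1 - w z.2| ^ p *
          (m * (r ^ (s * p) / ‖z.1 - z.2‖ ^ ((n : ℝ) + s * p))) := by ring
      _ ≤ |w z.1 - w z.2| ^ p *
          (scaledCoeff s t p a b r z * (r ^ (s * p) / ‖z.1 - z.2‖ ^ ((n : ℝ) + s * p))) := by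
        gcongr
        exact (hc ⟨hz1, hz2⟩).1
      _ ≤ |w z.1 - w z.2| ^ p * (2 ^ ((t - s) * p) * density s t p a b z) := by gcongr
      _ = D * (|w z.1 - w z.2| ^ p / 2 * (ν * density s t p a b z)) := by
        rw [hD]; field_simp
      _ ≤ _ := by
        gcongr
        exact hz.1
  set I := ∫⁻ x in B, ENNReal.ofReal (w x ^ p) with hI
  set J := nonlocalTail s t p a b (positivePart u) x₀ (r / 2) r *
    ∫⁻ x in B, ENNReal.ofReal (w x) with hJ
  have hX : (r / δ) ^ p ≤ (r / δ) ^ ((n : ℝ) + p) :=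
    Real.rpow_le_rpow_of_exponent_le hrδ (by linarith [(Nat.cast_nonneg n : (0 : ℝ) ≤ n)])
  set X := (r / δ) ^ ((n : ℝ) + p) with hXdef
  have hX0 : 0 ≤ X := by positivity
  calc _ ≤ _ := hlow
    _ ≤ ENNReal.ofReal D * (ENNReal.ofReal (C₁ * (r / δ) ^ p * M) * I
        + 2 * (ENNReal.ofReal (L * X) * J)) := by
      gcongr
      refine hraw.trans (add_le_add h1 ?_)
      gcongr
    _ ≤ ENNReal.ofReal D * (ENNReal.ofReal ((C₁ + 2 * L) * X * M) * I
        + ENNReal.ofReal ((C₁ + 2 * L) * X) * J) := by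
      refine mul_le_mul' le_rfl (add_le_add ?_ ?_)
      · gcongr
        linarith
      · rw [← mul_assoc, ← ENNReal.ofReal_ofNat, ← ENNReal.ofReal_mul zero_le_two]
        refine mul_le_mul' (ENNReal.ofReal_le_ofReal ?_) le_rfl
        nlinarith [mul_nonneg hC₁.le hX0]
    _ = _ := by
      rw [mul_assoc D, ENNReal.ofReal_mul (by positivity : 0 ≤ D),
        ENNReal.ofReal_mul (by positivity : 0 ≤ (C₁ + 2 * L) * X)]
      ring

end ScaledCaccioppoli

/-! ### One step of the iteration. -/

section ExcessDecay

variable {n : ℕ} {s t p ν L : ℝ}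

/-- Faber–Krahn followed by Caccioppoli. Dividing by `m r^{sp}` produces the ratio `M / m`.
Measuring the tail as `M τ` gives both terms of the right side the same prefactor. -/
theorem excess_le_of_caccioppoli (hn : 1 ≤ n) (hs : 0 < s) (hst : s < t) (ht1 : t < 1) (hp : 1 < p)
    (hν : 0 < ν) (hL : 0 < L) : ∃ C : ℝ, 0 < C ∧ ∀ {Ω : Set (Rn n)}
      {a b Ks Kt : Rn n → Rn n → ℝ} (_ : MeasurableSet Ω) (_ : IsData s t p ν L a b Ks Kt)
      {u : Rn n → ℝ} (_ : IsWeakSubsolution s t p a b Ks Kt Ω u) {x₀ : Rn n}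
      {r ρ' δ k m M τ : ℝ}, 0 < r → ball x₀ r ⊆ Ω → 0 < δ → r / 2 ≤ ρ' → ρ' + 2 * δ ≤ r → 0 ≤ k →
      0 < m → m ≤ M → 0 ≤ τ →
      (∀ᵐ z : Rn n × Rn n, z ∈ ball x₀ r ×ˢ ball x₀ r →
        m ≤ scaledCoeff s t p a b r z ∧ scaledCoeff s t p a b r z ≤ M) →
      nonlocalTail s t p a b (positivePart u) x₀ (r / 2) r ≤ ENNReal.ofReal (M * τ) →
      ∫⁻ x in ball x₀ ρ', ENNReal.ofReal (trunc k (u x) ^ p) ≤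
        ENNReal.ofReal (C * (r / δ) ^ ((n : ℝ) + p) * (M / m) / r ^ (s * p)) *
          volume ({x | 0 < trunc k (u x)} ∩ ball x₀ (ρ' + 2 * δ)) ^ (s * p / n) *
          ((∫⁻ x in ball x₀ (ρ' + 2 * δ), ENNReal.ofReal (trunc k (u x) ^ p))
            + ENNReal.ofReal τ * ∫⁻ x in ball x₀ (ρ' + 2 * δ), ENNReal.ofReal (trunc k (u x))) := by
  obtain ⟨C₁, hC₁, hFK⟩ := faber_krahn hn (by linarith : 0 < p) hs
  obtain ⟨C₂, hC₂, hCac⟩ := caccioppoli (ν := ν) hn hs hst ht1 hp hν hL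
  refine ⟨C₁ * (C₂ + 1), by positivity, ?_⟩
  intro Ω a b Ks Kt hΩ h u hu x₀ r ρ' δ k m M τ hr hB hδ hρ' hρr hk hm hmM hτ hcoeff htail
  have hM : 0 < M := hm.trans_le hmM
  have h1 := hCac hΩ h hu hr hB hδ hρ' hρr hk hm.le hM.le hcoeff
  have hwm : AEMeasurable (fun x => trunc k (u x)) :=
    (measurable_trunc k).comp_aemeasurable hu.1.1
  have h2 := hFK x₀ ρ' (ρ' + 2 * δ) (by linarith) (fun x => trunc k (u x)) hwm
    (fun x => trunc_nonneg _ _)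
  set w : Rn n → ℝ := fun x => trunc k (u x) with hw
  set E := ∫⁻ x in ball x₀ ρ', ∫⁻ y in ball x₀ (ρ' + 2 * δ), ENNReal.ofReal
    (|w x - w y| ^ p / ‖x - y‖ ^ ((n : ℝ) + s * p)) with hE
  set I := ∫⁻ x in ball x₀ (ρ' + 2 * δ), ENNReal.ofReal (w x ^ p) with hI
  set J := ∫⁻ x in ball x₀ (ρ' + 2 * δ), ENNReal.ofReal (w x) with hJ
  set I' := ∫⁻ x in ball x₀ ρ', ENNReal.ofReal (w x ^ p) with hI'
  set V := volume ({x | 0 < w x} ∩ ball x₀ (ρ' + 2 * δ)) ^ (s * p / n) with hV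
  set X := (r / δ) ^ ((n : ℝ) + p) with hX
  have hrδ : 1 ≤ r / δ := by rw [one_le_div hδ]; linarith
  have hX0 : 0 < X := by positivity
  have hsp : 0 < s * p := by positivity
  have hII : I' ≤ I := lintegral_mono_set (ball_subset_ball (by linarith))
  have hrsp : 0 < r ^ (s * p) := by positivity
  have hEle : E ≤ ENNReal.ofReal (C₂ * X * (M / m) / r ^ (s * p)) * (I + ENNReal.ofReal τ * J) := by
    have hmr : 0 < m * r ^ (s * p) := by positivity
    have h3 : ENNReal.ofReal (m * r ^ (s * p)) * E ≤
        ENNReal.ofReal (m * r ^ (s * p)) *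
          (ENNReal.ofReal (C₂ * X * (M / m) / r ^ (s * p)) * (I + ENNReal.ofReal τ * J)) := by
      refine h1.trans ?_
      calc _ ≤ ENNReal.ofReal (C₂ * X) * (ENNReal.ofReal M * I + ENNReal.ofReal (M * τ) * J) := by
            gcongr
        _ = ENNReal.ofReal (C₂ * X * M) * (I + ENNReal.ofReal τ * J) := by
          rw [ENNReal.ofReal_mul hM.le, ENNReal.ofReal_mul (by positivity : 0 ≤ C₂ * X)]
          ring
        _ = _ := by
          rw [← mul_assoc, ← ENNReal.ofReal_mul hmr.le]
          congr 2
          field_simp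
    exact (ENNReal.mul_le_mul_iff_right (by simpa using hmr) ENNReal.ofReal_ne_top).mp h3
  -- The zero-order Faber–Krahn term fits under the same prefactor because `M / m ≥ 1` and `r / δ ≥
  -- 1`.
  have hδle : (ρ' + 2 * δ - ρ') ^ (-(s * p)) ≤ X * (M / m) / r ^ (s * p) := by
    have e1 : (ρ' + 2 * δ - ρ') ^ (-(s * p)) ≤ δ ^ (-(s * p)) :=
      Real.rpow_le_rpow_of_nonpos hδ (by linarith) (by linarith)
    have e2 : δ ^ (-(s * p)) = (r / δ) ^ (s * p) / r ^ (s * p) := by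
      rw [Real.div_rpow hr.le hδ.le, Real.rpow_neg hδ.le]
      field_simp
    have e3 : (r / δ) ^ (s * p) ≤ X := by
      refine Real.rpow_le_rpow_of_exponent_le hrδ ?_
      have : s * p ≤ p := by nlinarith
      linarith [(Nat.cast_nonneg n : (0 : ℝ) ≤ n)]
    have e4 : 1 ≤ M / m := by rwa [one_le_div hm]
    refine e1.trans ?_
    rw [e2]
    gcongr
    exact e3.trans (le_mul_of_one_le_right hX0.le e4)
  calc I' ≤ _ := h2
    _ ≤ ENNReal.ofReal C₁ * V * (ENNReal.ofReal (C₂ * X * (M / m) / r ^ (s * p)) *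
          (I + ENNReal.ofReal τ * J)
        + ENNReal.ofReal (X * (M / m) / r ^ (s * p)) * (I + ENNReal.ofReal τ * J)) := by
      gcongr
      exact hII.trans le_self_add
    _ = ENNReal.ofReal C₁ * V * (ENNReal.ofReal ((C₂ + 1) * X * (M / m) / r ^ (s * p)) *
          (I + ENNReal.ofReal τ * J)) := by
      rw [← add_mul, ← ENNReal.ofReal_add (by positivity) (by positivity)]
      congr 3
      ring
    _ = _ := by
      rw [show C₁ * (C₂ + 1) * X * (M / m) / r ^ (s * p) =
        C₁ * ((C₂ + 1) * X * (M / m) / r ^ (s * p)) by ring, ENNReal.ofReal_mul hC₁.le]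
      ring

/-- Chebyshev's inequality between two levels; raised to the power `sp/n` it makes the recursion
superlinear. -/
theorem volume_level_le {k l : ℝ} (hkl : k < l) (hp : 0 ≤ p) {u : Rn n → ℝ} (hu : AEMeasurable u)
    {B : Set (Rn n)} :
    volume ({x | 0 < trunc l (u x)} ∩ B) ≤
      ENNReal.ofReal ((l - k) ^ (-p)) * ∫⁻ x in B, ENNReal.ofReal (trunc k (u x) ^ p) := by
  have hd : 0 < l - k := by linarith
  have hlm : AEMeasurable (fun x => trunc l (u x)) := (measurable_trunc l).comp_aemeasurable hu
  have hnull : NullMeasurableSet {x | 0 < trunc l (u x)} :=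
    nullMeasurableSet_lt aemeasurable_const hlm
  rw [← lintegral_const_mul' _ _ ENNReal.ofReal_ne_top]
  calc volume ({x | 0 < trunc l (u x)} ∩ B)
      ≤ volume.restrict B {x | 0 < trunc l (u x)} := Measure.le_restrict_apply _ _
    _ = ∫⁻ x in {x | 0 < trunc l (u x)}, 1 ∂(volume.restrict B) := by simp
    _ ≤ ∫⁻ x in {x | 0 < trunc l (u x)}, ENNReal.ofReal ((l - k) ^ (-p)) *
        ENNReal.ofReal (trunc k (u x) ^ p) ∂(volume.restrict B) := by
      apply lintegral_mono_ae
      have hn' : NullMeasurableSet {x | 0 < trunc l (u x)} (volume.restrict B) :=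
        hnull.mono_ac Measure.restrict_le_self.absolutelyContinuous
      filter_upwards [ae_restrict_mem₀ hn'] with x hx
      rw [← ENNReal.ofReal_mul (by positivity), ENNReal.one_le_ofReal, Real.rpow_neg hd.le,
        mul_comm, ← div_eq_mul_inv, ← Real.div_rpow (trunc_nonneg _ _) hd.le]
      exact trunc_level_le hkl hp hx
    _ ≤ _ := setLIntegral_le_lintegral _ _

theorem setLIntegral_level_le {k l : ℝ} (hkl : k < l) (hp : 1 < p) (u : Rn n → ℝ)
    (B : Set (Rn n)) :
    ∫⁻ x in B, ENNReal.ofReal (trunc l (u x)) ≤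
      ENNReal.ofReal ((l - k) ^ (1 - p)) * ∫⁻ x in B, ENNReal.ofReal (trunc k (u x) ^ p) := by
  rw [← lintegral_const_mul' _ _ ENNReal.ofReal_ne_top]
  apply lintegral_mono
  intro x
  beta_reduce
  have : 0 < l - k := by linarith
  rw [← ENNReal.ofReal_mul (by positivity)]
  exact ENNReal.ofReal_le_ofReal (trunc_le_mul_rpow hp hkl)

theorem volume_real_ball_pos (n : ℕ) : 0 < (volume : Measure (Rn n)).real (ball 0 1) := by
  rw [measureReal_def]
  exact ENNReal.toReal_pos (measure_ball_pos _ _ one_pos).ne' measure_ball_lt_top.ne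

theorem integrableOn_positivePart_rpow (hp : 1 < p) {Ω : Set (Rn n)} {u : Rn n → ℝ}
    (hu : MemLp u (ENNReal.ofReal p) (volume.restrict Ω)) (hum : AEMeasurable u) {B : Set (Rn n)}
    (hB : B ⊆ Ω) : IntegrableOn (fun x => |positivePart u x| ^ p) B := by
  have h := hu.integrable_norm_rpow (by simpa using (by linarith : 0 < p)) ENNReal.ofReal_ne_top
  rw [ENNReal.toReal_ofReal (by linarith)] at h
  have h' : IntegrableOn (fun x => ‖u x‖ ^ p) B := IntegrableOn.mono_set h hB
  refine Integrable.mono' h' ?_ (Filter.Eventually.of_forall fun x => ?_)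
  · refine AEMeasurable.aestronglyMeasurable (AEMeasurable.restrict ?_)
    have hm : AEMeasurable (positivePart u) := hum.max aemeasurable_const
    exact (continuous_abs.measurable.comp_aemeasurable hm).pow_const p
  · rw [Real.norm_eq_abs, Real.norm_eq_abs, abs_of_nonneg (by positivity)]
    refine Real.rpow_le_rpow (abs_nonneg _) ?_ (by linarith)
    rw [positivePart, abs_of_nonneg (le_max_right _ _)]
    exact max_le (le_abs_self _) (abs_nonneg _)

theorem setIntegral_rpow_eq_meanLp (hp : 0 < p) (f : Rn n → ℝ) (x₀ : Rn n) {r : ℝ} (hr : 0 < r) :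
    ∫ x in ball x₀ r, |f x| ^ p =
      (volume : Measure (Rn n)).real (ball 0 1) * r ^ n * meanLp p f x₀ r ^ p := by
  have hω := volume_real_ball_pos n
  have hvol : (volume : Measure (Rn n)).real (ball x₀ r) = volume.real (ball (0 : Rn n) 1) * r ^ n := by
    rw [measureReal_def, measureReal_def, Measure.addHaar_ball_of_pos _ _ hr,
      finrank_euclideanSpace_fin, ENNReal.toReal_mul, ENNReal.toReal_ofReal (by positivity), mul_comm]
  have hint : 0 ≤ ∫ x in ball x₀ r, |f x| ^ p := integral_nonneg fun x => by positivity
  rw [meanLp, setAverage_eq, smul_eq_mul, hvol, ← Real.rpow_mul (by positivity),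
    one_div_mul_cancel hp.ne', Real.rpow_one]
  field_simp

theorem meanLp_nonneg (f : Rn n → ℝ) (x₀ : Rn n) (r : ℝ) : 0 ≤ meanLp p f x₀ r := by
  unfold meanLp
  refine Real.rpow_nonneg ?_ _
  rw [setAverage_eq]
  exact smul_nonneg (by positivity) (integral_nonneg fun x => by positivity)

end ExcessDecay

/-! ### The De Giorgi iteration. -/

section DeGiorgi

variable {n : ℕ} {s t p ν L : ℝ}

/-- Bookkeeping with `e = 2^j`: the width is `δ = r / (8e)` and the level gap is `k / (2e)`. In the
tail term `k^{p-1}` cancels against the power of the gap, so `k` survives only as `k^{-pθ}`.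
Collecting the powers of `e` gives the base of the recursion. -/
theorem deGiorgi_factor_le {p θ C S R r k y : ℝ} (hp : 1 < p) (hθ0 : 0 < θ) (hC : 0 ≤ C)
    (hS : 0 ≤ S) (hR : 0 ≤ R) (hr : 0 < r) (hk : 0 < k) (hy : 0 ≤ y) (N : ℝ) (j : ℕ) :
    C * (r / (r / 8 * (1 / 2) ^ j)) ^ (N + p) * S / R *
        ((k * (1 / 2) ^ (j + 1)) ^ (-p) * y) ^ θ *
        (y + k ^ (p - 1) * ((k * (1 / 2) ^ (j + 1)) ^ (1 - p) * y)) ≤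
      C * (2 ^ (3 * (N + p)) * 2 ^ (p * θ) * (2 * 2 ^ (p - 1))) * S / R * k ^ (-(p * θ)) *
        (2 ^ (N + p + p * θ + (p - 1))) ^ j * y ^ (1 + θ) := by
  set δ : ℝ := r / 8 * (1 / 2) ^ j with hδ
  set Δ : ℝ := k * (1 / 2) ^ (j + 1) with hΔ
  have hδ0 : 0 < δ := by positivity
  have hΔ0 : 0 < Δ := by positivity
  have hrδ : r / δ = 2 ^ (3 : ℝ) * 2 ^ (j : ℝ) := by
    rw [hδ, Real.rpow_natCast, one_div, inv_pow]
    field_simp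
    norm_num
  have hΔ' : Δ = k / (2 * 2 ^ (j : ℝ)) := by
    rw [hΔ, Real.rpow_natCast, pow_succ, one_div, inv_pow]
    field_simp
  set e : ℝ := 2 ^ (j : ℝ) with he
  have he0 : 0 < e := by positivity
  have he1 : 1 ≤ e := Real.one_le_rpow (by norm_num) (Nat.cast_nonneg j)
  have e1 : (r / δ) ^ (N + p) = 2 ^ (3 * (N + p)) * e ^ (N + p) := by
    rw [hrδ, Real.mul_rpow (by positivity) he0.le, ← Real.rpow_mul (by norm_num)]
  have e2 : (Δ ^ (-p) * y) ^ θ = k ^ (-(p * θ)) * (2 ^ (p * θ) * e ^ (p * θ)) * y ^ θ := by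
    rw [Real.mul_rpow (by positivity) hy, ← Real.rpow_mul hΔ0.le, neg_mul, hΔ',
      Real.div_rpow hk.le (by positivity), ← Real.mul_rpow (by norm_num) he0.le,
      Real.rpow_neg (by positivity : 0 ≤ 2 * e), div_inv_eq_mul]
  have e3 : k ^ (p - 1) * (Δ ^ (1 - p) * y) = 2 ^ (p - 1) * e ^ (p - 1) * y := by
    rw [hΔ', Real.div_rpow hk.le (by positivity), ← neg_sub p 1, Real.rpow_neg hk.le,
      Real.rpow_neg (by positivity : 0 ≤ 2 * e), Real.mul_rpow (by norm_num) he0.le]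
    field_simp
  have e4 : y + k ^ (p - 1) * (Δ ^ (1 - p) * y) ≤ 2 * 2 ^ (p - 1) * e ^ (p - 1) * y := by
    rw [e3]
    have f1 : (1 : ℝ) ≤ 2 ^ (p - 1) := Real.one_le_rpow (by norm_num) (by linarith)
    have f2 : (1 : ℝ) ≤ e ^ (p - 1) := Real.one_le_rpow he1 (by linarith)
    have f3 := le_mul_of_one_le_left hy (one_le_mul_of_one_le_of_one_le f1 f2)
    linarith
  have e5 : (2 ^ (N + p + p * θ + (p - 1)) : ℝ) ^ j = e ^ (N + p) * e ^ (p * θ) * e ^ (p - 1) := by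
    rw [← Real.rpow_add he0, ← Real.rpow_add he0, he, ← Real.rpow_natCast,
      ← Real.rpow_mul (by norm_num), ← Real.rpow_mul (by norm_num), mul_comm]
  calc _ ≤ C * (2 ^ (3 * (N + p)) * e ^ (N + p)) * S / R *
        (k ^ (-(p * θ)) * (2 ^ (p * θ) * e ^ (p * θ)) * y ^ θ) *
        (2 * 2 ^ (p - 1) * e ^ (p - 1) * y) := by
        rw [e1, e2]
        gcongr
    _ = _ := by
      rw [e5, Real.rpow_one_add' hy (by linarith)]
      ring

/-- The smallness condition for `Y 0`, solved for `k`. As `θ = sp/n`, the power `r^{nθ}` cancels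
`r^{-sp}`, and the exponent `n/(sp²)` of `S` times `pθ` equals `1`. -/
theorem deGiorgi_initial_le {n : ℕ} {s p K S ω b₀ r k μ : ℝ} (hn : 1 ≤ n) (hs : 0 < s)
    (hp : 0 < p) (hK0 : 0 < K) (hS : 0 < S) (hω : 0 < ω) (hb₀0 : 0 < b₀) (hr : 0 < r) (hk : 0 < k)
    (hμ0 : 0 ≤ μ) (hmean : (K * ω ^ (s * p / n) * b₀ ^ (1 / (s * p / n))) ^ (1 / (p * (s * p / n))) *
      S ^ (n / (s * p * p)) * μ ≤ k) :
    K * S / r ^ (s * p) * k ^ (-(p * (s * p / n))) * (ω * r ^ n * μ ^ p) ^ (s * p / n) ≤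
      b₀ ^ (-(1 / (s * p / n))) := by
  have hn0 : (0 : ℝ) < n := by exact_mod_cast hn
  set θ : ℝ := s * p / n with hθ
  have hθ0 : 0 < θ := by positivity
  have hpθ : 0 < p * θ := by positivity
  have g1 : ((n : ℝ) / (s * p * p)) * (p * θ) = 1 := by
    rw [hθ]; field_simp
  have g2 : K * ω ^ θ * b₀ ^ (1 / θ) * S * μ ^ (p * θ) ≤ k ^ (p * θ) := by
    have := Real.rpow_le_rpow (by positivity) hmean hpθ.le
    rwa [Real.mul_rpow (by positivity) hμ0, Real.mul_rpow (by positivity) (by positivity),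
      ← Real.rpow_mul (by positivity), ← Real.rpow_mul hS.le, g1, one_div_mul_cancel hpθ.ne',
      Real.rpow_one, Real.rpow_one] at this
  have g3 : (ω * r ^ n * μ ^ p) ^ θ = ω ^ θ * r ^ (s * p) * μ ^ (p * θ) := by
    rw [Real.mul_rpow (by positivity) (by positivity),
      Real.mul_rpow (by positivity) (by positivity), ← Real.rpow_mul hμ0, ← Real.rpow_natCast,
      ← Real.rpow_mul hr.le, hθ, mul_div_cancel₀ _ hn0.ne']
  have hkp : 0 < k ^ (p * θ) := by positivity
  rw [g3, Real.rpow_neg hk.le, Real.rpow_neg hb₀0.le]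
  have hrsp : 0 < r ^ (s * p) := by positivity
  rw [show K * S / r ^ (s * p) * (k ^ (p * θ))⁻¹ * (ω ^ θ * r ^ (s * p) * μ ^ (p * θ)) =
    K * ω ^ θ * S * μ ^ (p * θ) / k ^ (p * θ) by field_simp, ← one_div (b₀ ^ (1 / θ)),
    div_le_div_iff₀ hkp (by positivity)]
  linarith

theorem ae_le_of_deGiorgi (hn : 1 ≤ n) (hs : 0 < s) (hst : s < t) (ht1 : t < 1) (hp : 1 < p)
    (hν : 0 < ν) (hL : 0 < L) : ∃ c : ℝ, 0 < c ∧ ∀ {Ω : Set (Rn n)}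
      {a b Ks Kt : Rn n → Rn n → ℝ} (_ : MeasurableSet Ω) (_ : IsData s t p ν L a b Ks Kt)
      {u : Rn n → ℝ} (_ : IsWeakSubsolution s t p a b Ks Kt Ω u) {x₀ : Rn n}
      {r k m M : ℝ}, 0 < r → ball x₀ r ⊆ Ω → 0 < k → 0 < m → m ≤ M →
      (∀ᵐ z : Rn n × Rn n, z ∈ ball x₀ r ×ˢ ball x₀ r →
        m ≤ scaledCoeff s t p a b r z ∧ scaledCoeff s t p a b r z ≤ M) →
      nonlocalTail s t p a b (positivePart u) x₀ (r / 2) r ≤ ENNReal.ofReal (M * k ^ (p - 1)) →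
      c * (M / m) ^ (n / (s * p * p)) * meanLp p (positivePart u) x₀ r ≤ k →
      ∀ᵐ x, x ∈ ball x₀ (r / 2) → u x ≤ k := by
  obtain ⟨C, hC, hstep⟩ := excess_le_of_caccioppoli (ν := ν) hn hs hst ht1 hp hν hL
  set ω : ℝ := (volume : Measure (Rn n)).real (ball 0 1) with hω
  have hωpos : 0 < ω := volume_real_ball_pos n
  have hn0 : (0 : ℝ) < n := by exact_mod_cast hn
  have hp0 : 0 < p := by linarith
  set θ : ℝ := s * p / n with hθ
  have hθ0 : 0 < θ := by positivity
  set β : ℝ := (n + p) + p * θ + (p - 1) with hβ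
  have hβ0 : 0 < β := by rw [hβ]; have := mul_pos hp0 hθ0; linarith
  set b₀ : ℝ := 2 ^ β with hb₀
  have hb₀1 : 1 < b₀ := Real.one_lt_rpow (by norm_num) hβ0
  have hb₀0 : 0 < b₀ := by linarith
  set K : ℝ := C * (2 ^ (3 * (n + p)) * 2 ^ (p * θ) * (2 * 2 ^ (p - 1))) with hK
  have hK0 : 0 < K := by positivity
  refine ⟨(K * ω ^ θ * b₀ ^ (1 / θ)) ^ (1 / (p * θ)), by positivity, ?_⟩
  intro Ω a b Ks Kt hΩ h u hu x₀ r k m M hr hB hk hm hmM hcoeff htail hmean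
  have hM : 0 < M := hm.trans_le hmM
  have hMm : 0 < M / m := by positivity
  set μ := meanLp p (positivePart u) x₀ r with hμ
  have hμ0 : 0 ≤ μ := meanLp_nonneg _ _ _
  have hint := integrableOn_positivePart_rpow hp hu.1.2.1 hu.1.1 hB
  -- Radii decrease from `r` to `r/2` while levels rise from `0` to `k`. Since `κ 0 = 0`, `Y 0` is
  -- the integral of `u₊^p`.
  set ρ : ℕ → ℝ := fun j => r / 2 + r / 2 * (1 / 2) ^ j with hρ
  set κ : ℕ → ℝ := fun j => k * (1 - (1 / 2) ^ j) with hκ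
  set Y : ℕ → ℝ≥0∞ := fun j => ∫⁻ x in ball x₀ (ρ j), ENNReal.ofReal (trunc (κ j) (u x) ^ p)
    with hY
  have hhalf : ∀ j : ℕ, (0 : ℝ) < (1 / 2) ^ j := fun j => by positivity
  have hhalf1 : ∀ j : ℕ, ((1 : ℝ) / 2) ^ j ≤ 1 := fun j => pow_le_one₀ (by norm_num) (by norm_num)
  have hκ0 : ∀ j, 0 ≤ κ j := fun j => mul_nonneg hk.le (by linarith [hhalf1 j])
  have hρr : ∀ j, ρ j ≤ r := fun j => by
    have := mul_le_mul_of_nonneg_left (hhalf1 j) (by positivity : 0 ≤ r / 2)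
    simp only [hρ]; linarith
  have hY0 : Y 0 = ENNReal.ofReal (ω * r ^ n * μ ^ p) := by
    rw [← setIntegral_rpow_eq_meanLp hp0 _ _ hr,
      ofReal_integral_eq_lintegral_ofReal hint (Filter.Eventually.of_forall fun x => by positivity)]
    simp only [hY, hρ, hκ, pow_zero, mul_one, sub_self, mul_zero, add_halves]
    congr 1
    ext x
    rw [trunc, positivePart, sub_zero, abs_of_nonneg (le_max_right _ _)]
  have hYle : ∀ j, Y j ≤ Y 0 := fun j => by
    simp only [hY]
    refine (lintegral_mono_set (ball_subset_ball (?_ : ρ j ≤ ρ 0))).trans (lintegral_mono fun x => ?_)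
    · refine (hρr j).trans (le_of_eq ?_)
      simp [hρ]
    · beta_reduce
      gcongr
      · exact trunc_nonneg _ _
      · refine trunc_anti ?_
        simpa [hκ] using hκ0 j
  have hYtop : ∀ j, Y j ≠ ∞ := fun j =>
    ((hYle j).trans_lt (hY0 ▸ ENNReal.ofReal_lt_top)).ne
  set y : ℕ → ℝ := fun j => (Y j).toReal with hy
  have hyY : ∀ j, Y j = ENNReal.ofReal (y j) := fun j => (ENNReal.ofReal_toReal (hYtop j)).symm
  have hy0 : ∀ j, 0 ≤ y j := fun j => ENNReal.toReal_nonneg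
  have hy0eq : y 0 = ω * r ^ n * μ ^ p := by
    simp only [hy, hY0]
    exact ENNReal.toReal_ofReal (by positivity)
  set C₀ : ℝ := K * (M / m) / r ^ (s * p) * k ^ (-(p * θ)) with hC₀
  have hC₀0 : 0 ≤ C₀ := by positivity
  have hiter : ∀ j, y (j + 1) ≤ C₀ * b₀ ^ j * y j ^ (1 + θ) := by
    intro j
    -- Half of the gap between consecutive radii, so that `ρ (j + 1) + 2 * δ` is exactly `ρ j`.
    set δ : ℝ := r / 8 * (1 / 2) ^ j with hδ
    have hδ0 : 0 < δ := by positivity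
    have hρj : ρ (j + 1) + 2 * δ = ρ j := by simp only [hρ, hδ, pow_succ]; ring
    have hρhalf : r / 2 ≤ ρ (j + 1) := by
      have := mul_pos (by positivity : 0 < r / 2) (hhalf (j + 1))
      simp only [hρ]; linarith
    have h1 := hstep hΩ h hu hr hB hδ0 hρhalf (by rw [hρj]; exact hρr j) (hκ0 (j + 1)) hm hmM
      (by positivity : 0 ≤ k ^ (p - 1)) hcoeff htail
    rw [hρj] at h1
    set Δ : ℝ := k * (1 / 2) ^ (j + 1) with hΔ
    have hΔ0 : 0 < Δ := by positivity
    have hκΔ : κ (j + 1) - κ j = Δ := by simp only [hκ, hΔ, pow_succ]; ring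
    have hκlt : κ j < κ (j + 1) := by linarith
    have hV := volume_level_le (B := ball x₀ (ρ j)) hκlt hp0.le hu.1.1
    have hJ := setLIntegral_level_le hκlt hp u (ball x₀ (ρ j))
    have hI : ∫⁻ x in ball x₀ (ρ j), ENNReal.ofReal (trunc (κ (j + 1)) (u x) ^ p) ≤ Y j := by
      refine lintegral_mono fun x => ?_
      beta_reduce
      gcongr
      · exact trunc_nonneg _ _
      · exact trunc_anti hκlt.le
    rw [hκΔ] at hV hJ
    change volume _ ≤ ENNReal.ofReal (Δ ^ (-p)) * Y j at hV
    change _ ≤ ENNReal.ofReal (Δ ^ (1 - p)) * Y j at hJ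
    have h2 : Y (j + 1) ≤ ENNReal.ofReal (C * (r / δ) ^ ((n : ℝ) + p) * (M / m) / r ^ (s * p)) *
        (ENNReal.ofReal (Δ ^ (-p)) * Y j) ^ θ *
        (Y j + ENNReal.ofReal (k ^ (p - 1)) * (ENNReal.ofReal (Δ ^ (1 - p)) * Y j)) := by
      refine h1.trans ?_
      gcongr
    have hyj := hy0 j
    rw [hyY, hyY j, ← ENNReal.ofReal_mul (by positivity), ← ENNReal.ofReal_mul (by positivity),
      ← ENNReal.ofReal_mul (by positivity), ← ENNReal.ofReal_add (by positivity) (by positivity),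
      ENNReal.ofReal_rpow_of_nonneg (by positivity) hθ0.le, ← ENNReal.ofReal_mul (by positivity),
      ← ENNReal.ofReal_mul (by positivity), ENNReal.ofReal_le_ofReal_iff (by positivity)] at h2
    refine h2.trans ?_
    exact deGiorgi_factor_le hp hθ0 hC.le hMm.le (by positivity) hr hk hyj n j
  have hinit : C₀ * y 0 ^ θ ≤ b₀ ^ (-(1 / θ)) := by
    rw [hy0eq]
    exact deGiorgi_initial_le hn hs hp0 hK0 hMm hωpos hb₀0 hr hk hμ0 hmean
  have hdecay := geometric_decay hC₀0 hb₀0 hθ0 hy0 hiter hinit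
  have hq1 : b₀ ^ (-(1 / θ)) < 1 :=
    Real.rpow_lt_one_of_one_lt_of_neg hb₀1 (by have := one_div_pos.mpr hθ0; linarith)
  have hlim : Filter.Tendsto (fun j : ℕ => ENNReal.ofReal ((b₀ ^ (-(1 / θ))) ^ j * y 0)) Filter.atTop
      (nhds 0) := by
    have := (tendsto_pow_atTop_nhds_zero_of_lt_one (by positivity) hq1).mul_const (y 0)
    rw [zero_mul] at this
    simpa using ENNReal.tendsto_ofReal this
  -- Every `Y j` dominates this integral: its ball contains `B_{r/2}` and its level lies below `k`.
  have hzero : ∫⁻ x in ball x₀ (r / 2), ENNReal.ofReal (trunc k (u x) ^ p) = 0 := by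
    refine le_antisymm (ge_of_tendsto' hlim fun j => ?_) zero_le
    refine le_trans ?_ (ENNReal.ofReal_le_ofReal (hdecay j))
    rw [← hyY j]
    refine (lintegral_mono_set (ball_subset_ball (?_ : r / 2 ≤ ρ j))).trans
      (lintegral_mono fun x => ?_)
    · have := mul_pos (by positivity : 0 < r / 2) (hhalf j)
      simp only [hρ]; linarith
    · beta_reduce
      gcongr
      · exact trunc_nonneg _ _
      · refine trunc_anti ?_
        have := mul_pos hk (hhalf j)
        simp only [hκ]; linarith
  have hmeas : AEMeasurable (fun x => ENNReal.ofReal (trunc k (u x) ^ p))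
      (volume.restrict (ball x₀ (r / 2))) :=
    (((measurable_trunc k).comp_aemeasurable hu.1.1).pow_const p).ennreal_ofReal.restrict
  rw [lintegral_eq_zero_iff' hmeas, Filter.EventuallyEq, ae_restrict_iff' measurableSet_ball] at hzero
  filter_upwards [hzero] with x hx hxB
  have := hx hxB
  by_contra hc
  push Not at hc
  have hpos : 0 < trunc k (u x) := by rw [trunc_of_ge hc.le]; linarith
  have : ENNReal.ofReal (trunc k (u x) ^ p) ≠ 0 := by simpa using Real.rpow_pos_of_pos hpos p
  exact this (hx hxB)

end DeGiorgi

/-! ### From the iteration to the first estimate, and from subsolutions to solutions. -/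

section Subsolutions

variable {n : ℕ} {s t p ν L : ℝ} {a b Ks Kt : Rn n → Rn n → ℝ} {Ω : Set (Rn n)}

theorem nonlocalTail_mono (ha : IsCoefficient a) (hb : IsCoefficient b) (hp : 1 ≤ p)
    {f g : Rn n → ℝ} (hfg : ∀ x, |f x| ≤ |g x|) (x₀ : Rn n) (r ρ : ℝ) :
    nonlocalTail s t p a b f x₀ r ρ ≤ nonlocalTail s t p a b g x₀ r ρ := by
  refine essSup_mono_ae (Filter.Eventually.of_forall fun x => lintegral_mono fun y => ?_)
  have h1 := ha.nonneg x y
  have h2 := hb.nonneg x y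
  have h3 : |f y| ^ (p - 1) ≤ |g y| ^ (p - 1) :=
    Real.rpow_le_rpow (abs_nonneg _) (hfg y) (by linarith)
  beta_reduce
  gcongr

theorem abs_positivePart_le (u : Rn n → ℝ) (x : Rn n) : |positivePart u x| ≤ |u x| := by
  rw [positivePart, abs_of_nonneg (le_max_right _ _)]
  exact max_le (le_abs_self _) (abs_nonneg _)

theorem meanLp_positivePart_le (hp : 1 < p) {u v : Rn n → ℝ} (hv : ∀ x, |v x| = |u x|)
    (hu : MemLp u (ENNReal.ofReal p) (volume.restrict Ω)) (hum : AEMeasurable v) {x₀ : Rn n} {r : ℝ}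
    (hB : ball x₀ r ⊆ Ω) :
    meanLp p (positivePart v) x₀ r ≤ meanLp p (fun x => |u x|) x₀ r := by
  have hint : IntegrableOn (fun x => |u x| ^ p) (ball x₀ r) := by
    have h := hu.integrable_norm_rpow (by simpa using (by linarith : 0 < p)) ENNReal.ofReal_ne_top
    rw [ENNReal.toReal_ofReal (by linarith)] at h
    exact IntegrableOn.mono_set h hB
  have hv' : MemLp v (ENNReal.ofReal p) (volume.restrict Ω) :=
    hu.mono hum.aestronglyMeasurable.restrict
      (Filter.Eventually.of_forall fun x => by simp [hv])
  have hint' := integrableOn_positivePart_rpow hp hv' hum hB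
  unfold meanLp
  refine Real.rpow_le_rpow ?_ ?_ (by positivity)
  · rw [setAverage_eq]
    exact smul_nonneg (by positivity) (integral_nonneg fun x => by positivity)
  · rw [setAverage_eq, setAverage_eq]
    refine smul_le_smul_of_nonneg_left (integral_mono hint' ?_ fun x => ?_)
      (by positivity)
    · simp only [abs_abs]
      exact hint
    beta_reduce
    rw [abs_abs, ← hv]
    exact Real.rpow_le_rpow (abs_nonneg _) (abs_positivePart_le v x) (by linarith)

theorem weakForm_neg (u φ : Rn n → ℝ) :
    weakForm p a b Ks Kt Ω (fun x => -u x) φ = -weakForm p a b Ks Kt Ω u φ := by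
  simp only [weakForm]
  rw [neg_add, ← integral_neg, ← integral_neg]
  have h : ∀ x y : Rn n, |-u x - -u y| ^ (p - 2) * (-u x - -u y) =
      -(|u x - u y| ^ (p - 2) * (u x - u y)) := fun x y => by
    rw [show -u x - -u y = -(u x - u y) by ring, abs_neg]; ring
  simp only [h]
  congr 2 <;> · ext z; ring

theorem IsWeakSolution.isWeakSubsolution {u : Rn n → ℝ}
    (h : IsWeakSolution s t p a b Ks Kt Ω u) : IsWeakSubsolution s t p a b Ks Kt Ω u :=
  ⟨h.1, fun φ hφ _ h0 => (h.2 φ hφ h0).le⟩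

theorem IsWeakSolution.neg_isWeakSubsolution {u : Rn n → ℝ}
    (h : IsWeakSolution s t p a b Ks Kt Ω u) :
    IsWeakSubsolution s t p a b Ks Kt Ω (fun x => -u x) := by
  refine ⟨⟨h.1.1.neg, h.1.2.1.neg, ?_⟩, fun φ hφ _ h0 => ?_⟩
  · have he : ∀ x y : Rn n, |-u x - -u y| = |u x - u y| := fun x y => by
      rw [neg_sub_neg, abs_sub_comm]
    simpa only [he] using h.1.2.2
  · rw [weakForm_neg, h.2 φ hφ h0, neg_zero]

theorem essSupOn_le_of_ae {U : Set (Rn n)} (hU : MeasurableSet U) {f : Rn n → ℝ} {c : ℝ}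
    (h : ∀ᵐ x, x ∈ U → f x ≤ c) : essSupOn U f ≤ (c : EReal) := by
  refine essSup_le_of_ae_le _ ?_
  rw [Filter.EventuallyLE, ae_restrict_iff' hU]
  filter_upwards [h] with x hx hxU
  exact EReal.coe_le_coe_iff.mpr (hx hxU)

/-- The level `k` is taken as the sum of the two terms that it must dominate. The freedom `M' ≤ M`
allows a simpler factor in front of the tail, since `M' k^{p-1} ≤ M k^{p-1}`. -/
theorem ae_le_mean_add_tail (hn : 1 ≤ n) (hs : 0 < s) (hst : s < t) (ht1 : t < 1) (hp : 1 < p)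
    (hν : 0 < ν) (hL : 0 < L) : ∃ c : ℝ, 0 < c ∧ ∀ {Ω : Set (Rn n)}
      {a b Ks Kt : Rn n → Rn n → ℝ} (_ : MeasurableSet Ω) (_ : IsData s t p ν L a b Ks Kt)
      {u : Rn n → ℝ} (_ : IsWeakSubsolution s t p a b Ks Kt Ω u) {x₀ : Rn n}
      {r m M M' : ℝ}, 0 < r → ball x₀ r ⊆ Ω → 0 < m → m ≤ M → 0 < M' → M' ≤ M →
      (∀ᵐ z : Rn n × Rn n, z ∈ ball x₀ r ×ˢ ball x₀ r →
        m ≤ scaledCoeff s t p a b r z ∧ scaledCoeff s t p a b r z ≤ M) →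
      nonlocalTail s t p a b (positivePart u) x₀ (r / 2) r < ∞ →
      ∀ᵐ x, x ∈ ball x₀ (r / 2) → u x ≤
        c * (M / m) ^ (n / (s * p * p)) * meanLp p (positivePart u) x₀ r +
        (1 / M' * (nonlocalTail s t p a b (positivePart u) x₀ (r / 2) r).toReal) ^ (1 / (p - 1)) := by
  obtain ⟨c, hc, hDG⟩ := ae_le_of_deGiorgi (ν := ν) hn hs hst ht1 hp hν hL
  refine ⟨c, hc, ?_⟩
  intro Ω a b Ks Kt hΩ h u hu x₀ r m M M' hr hB hm hmM hM' hM'M hcoeff htail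
  set T := nonlocalTail s t p a b (positivePart u) x₀ (r / 2) r with hT
  have hM : 0 < M := hm.trans_le hmM
  have hA : 0 ≤ c * (M / m) ^ (n / (s * p * p)) * meanLp p (positivePart u) x₀ r :=
    mul_nonneg (by positivity) (meanLp_nonneg _ _ _)
  set A := c * (M / m) ^ (n / (s * p * p)) * meanLp p (positivePart u) x₀ r
  have hT0 : 0 ≤ 1 / M' * T.toReal := by positivity
  set B := (1 / M' * T.toReal) ^ (1 / (p - 1)) with hBdef
  have hB0 : 0 ≤ B := by positivity
  have hBp : T.toReal = M' * B ^ (p - 1) := by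
    rw [hBdef, ← Real.rpow_mul hT0, one_div_mul_cancel (by linarith), Real.rpow_one]
    field_simp
  -- The iteration needs `k > 0`, whereas `A + B` may vanish; the excess `1 / (j + 1)` is removed in
  -- the limit.
  have hε : ∀ j : ℕ, ∀ᵐ x, x ∈ ball x₀ (r / 2) → u x ≤ A + B + 1 / ((j : ℝ) + 1) := by
    intro j
    have hj : 0 < 1 / ((j : ℝ) + 1) := Nat.one_div_pos_of_nat
    refine hDG hΩ h hu hr hB (by linarith) hm hmM hcoeff ?_ (by linarith)
    rw [← hT, ← ENNReal.ofReal_toReal htail.ne]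
    apply ENNReal.ofReal_le_ofReal
    rw [hBp]
    have : B ≤ A + B + 1 / ((j : ℝ) + 1) := by linarith
    gcongr
  filter_upwards [ae_all_iff.mpr hε] with x hx hxB
  have hlim := (tendsto_one_div_add_atTop_nhds_zero_nat (𝕜 := ℝ)).const_add (A + B)
  rw [add_zero] at hlim
  exact ge_of_tendsto' hlim fun j => hx j hxB

theorem nonlocalTail_positivePart_lt_top (ha : IsCoefficient a) (hb : IsCoefficient b) (hp : 1 ≤ p)
    {u : Rn n → ℝ} (hu : u ∈ tailSpace s t p a b) (x₀ : Rn n) {r ρ : ℝ} (hr : 0 < r) (hρ : 0 < ρ) :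
    nonlocalTail s t p a b (positivePart u) x₀ r ρ < ∞ :=
  (nonlocalTail_mono ha hb hp (abs_positivePart_le u) x₀ r ρ).trans_lt (hu.2 x₀ r ρ hr hρ)

theorem neg_mem_tailSpace {u : Rn n → ℝ} (hu : u ∈ tailSpace s t p a b) :
    (fun x => -u x) ∈ tailSpace s t p a b := by
  refine ⟨fun K hK => (hu.1 K hK).neg, fun x₀ r ρ hr hρ => ?_⟩
  simpa only [nonlocalTail, abs_neg] using hu.2 x₀ r ρ hr hρ

/-- A bound for all subsolutions gives the corresponding bound for the modulus of solutions. -/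
theorem ae_abs_le_of_forall_subsolution (h : IsData s t p ν L a b Ks Kt) (hp : 1 < p)
    {x₀ : Rn n} {r c κ : ℝ} (hr : 0 < r) (hB : ball x₀ r ⊆ Ω) (hc : 0 ≤ c) (hκ : 0 ≤ κ)
    (hsub : ∀ v ∈ tailSpace s t p a b, IsWeakSubsolution s t p a b Ks Kt Ω v →
      ∀ᵐ x, x ∈ ball x₀ (r / 2) → v x ≤ c * meanLp p (positivePart v) x₀ r +
        (κ * (nonlocalTail s t p a b (positivePart v) x₀ (r / 2) r).toReal) ^ (1 / (p - 1)))
    {u : Rn n → ℝ} (hu : u ∈ tailSpace s t p a b) (hsol : IsWeakSolution s t p a b Ks Kt Ω u) :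
    ∀ᵐ x, x ∈ ball x₀ (r / 2) → |u x| ≤ c * meanLp p (fun x => |u x|) x₀ r +
        (κ * (nonlocalTail s t p a b (fun x => |u x|) x₀ (r / 2) r).toReal) ^ (1 / (p - 1)) := by
  -- Stated for every `v` with `|v| = |u|`, so that it serves both `u` and `-u`.
  have key : ∀ v : Rn n → ℝ, AEMeasurable v → (∀ x, |v x| = |u x|) →
      c * meanLp p (positivePart v) x₀ r +
        (κ * (nonlocalTail s t p a b (positivePart v) x₀ (r / 2) r).toReal) ^ (1 / (p - 1)) ≤
      c * meanLp p (fun x => |u x|) x₀ r +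
        (κ * (nonlocalTail s t p a b (fun x => |u x|) x₀ (r / 2) r).toReal) ^ (1 / (p - 1)) := by
    intro v hvm hv
    have h1 := meanLp_positivePart_le hp hv hsol.1.2.1 hvm hB
    have h2 : nonlocalTail s t p a b (positivePart v) x₀ (r / 2) r ≤
        nonlocalTail s t p a b (fun x => |u x|) x₀ (r / 2) r :=
      nonlocalTail_mono h.coeff_a h.coeff_b hp.le (fun x => by
        rw [abs_abs, ← hv]; exact abs_positivePart_le v x) _ _ _
    have h3 : nonlocalTail s t p a b (fun x => |u x|) x₀ (r / 2) r < ∞ := by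
      simpa only [nonlocalTail, abs_abs] using hu.2 x₀ (r / 2) r (by positivity) hr
    have h4 := ENNReal.toReal_mono h3.ne h2
    have h5 : 0 ≤ 1 / (p - 1) := one_div_nonneg.mpr (by linarith)
    gcongr
  filter_upwards [hsub u hu hsol.isWeakSubsolution,
    hsub _ (neg_mem_tailSpace hu) hsol.neg_isWeakSubsolution] with x h1 h2 hxB
  exact abs_le'.mpr ⟨(h1 hxB).trans (key u hsol.1.1 fun _ => rfl),
    (h2 hxB).trans (key _ hsol.1.1.neg fun _ => abs_neg _)⟩

/-- Since `r ≤ 1`, the ellipticity of `a + b` gives `m = ν r^{-sp}` and `M = L r^{-tp}`. The choice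
`M' = r^{-sp}` yields the factor `r^{sp}` of the tail. -/
theorem exists_estimate₁ (hn : 1 ≤ n) (hs : 0 < s) (hst : s < t) (ht1 : t < 1) (hp : 1 < p)
    (hν : 0 < ν) (hν1 : ν ≤ 1) (hL : 1 ≤ L) : ∃ c : ℝ, 0 < c ∧
      ∀ (Ω : Set (Rn n)) (a b Ks Kt : Rn n → Rn n → ℝ), IsBoundedDomain Ω →
        IsData s t p ν L a b Ks Kt →
        ∀ (x₀ : Rn n) (r : ℝ), 0 < r → r ≤ 1 → closedBall x₀ r ⊆ Ω →
        ∀ u ∈ tailSpace s t p a b, IsWeakSubsolution s t p a b Ks Kt Ω u →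
          ∀ᵐ x, x ∈ ball x₀ (r / 2) → u x ≤
            c * r ^ (-(t - s) / min (s * p / n) (p - 1)) * meanLp p (positivePart u) x₀ r +
            (r ^ (s * p) * (nonlocalTail s t p a b (positivePart u) x₀ (r / 2) r).toReal)
              ^ (1 / (p - 1)) := by
  have hL0 : 0 < L := by linarith
  obtain ⟨c, hc, hmain⟩ := ae_le_mean_add_tail (ν := ν) hn hs hst ht1 hp hν hL0
  have hn0 : (0 : ℝ) < n := by exact_mod_cast hn
  refine ⟨c * (L / ν) ^ (n / (s * p * p)), by positivity, ?_⟩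
  intro Ω a b Ks Kt hΩ h x₀ r hr hr1 hB u hu hsub
  have hB' : ball x₀ r ⊆ Ω := ball_subset_closedBall.trans hB
  have hpow : r ^ (t * p) ≤ r ^ (s * p) :=
    Real.rpow_le_rpow_of_exponent_ge hr hr1 (by nlinarith)
  have hrs : 0 < r ^ (s * p) := by positivity
  have hrt : 0 < r ^ (t * p) := by positivity
  have hcoeff : ∀ᵐ z : Rn n × Rn n, z ∈ ball x₀ r ×ˢ ball x₀ r →
      ν / r ^ (s * p) ≤ scaledCoeff s t p a b r z ∧
        scaledCoeff s t p a b r z ≤ L / r ^ (t * p) := by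
    filter_upwards [h.bounds] with z hz _
    have ha0 := h.coeff_a.nonneg z.1 z.2
    have hb0 := h.coeff_b.nonneg z.1 z.2
    constructor
    · calc ν / r ^ (s * p) ≤ (a z.1 z.2 + b z.1 z.2) / r ^ (s * p) := by gcongr; exact hz.1
        _ = a z.1 z.2 / r ^ (s * p) + b z.1 z.2 / r ^ (s * p) := add_div _ _ _
        _ ≤ _ := by unfold scaledCoeff; gcongr
    · calc _ ≤ a z.1 z.2 / r ^ (t * p) + b z.1 z.2 / r ^ (t * p) := by unfold scaledCoeff; gcongr
        _ = (a z.1 z.2 + b z.1 z.2) / r ^ (t * p) := (add_div _ _ _).symm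
        _ ≤ _ := by gcongr; exact hz.2
  have hM' : 1 / r ^ (s * p) ≤ L / r ^ (t * p) := by gcongr
  have hmM : ν / r ^ (s * p) ≤ L / r ^ (t * p) := by
    have : ν ≤ L := hν1.trans hL
    gcongr
  have := hmain hΩ.isOpen.measurableSet h hsub hr hB' (by positivity) hmM (by positivity) hM' hcoeff
    (nonlocalTail_positivePart_lt_top h.coeff_a h.coeff_b hp.le hu x₀ (by positivity) hr)
  filter_upwards [this] with x hx hxB
  refine (hx hxB).trans ?_
  rw [one_div_one_div]
  have hμ := meanLp_nonneg (p := p) (positivePart u) x₀ r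
  gcongr ?_ * _ + _
  have hratio : L / r ^ (t * p) / (ν / r ^ (s * p)) = L / ν * r ^ (-((t - s) * p)) := by
    rw [show -((t - s) * p) = s * p - t * p by ring, Real.rpow_sub hr]
    field_simp
  rw [hratio, Real.mul_rpow (by positivity) (by positivity), ← mul_assoc, ← Real.rpow_mul hr.le]
  gcongr ?_ * ?_
  apply Real.rpow_le_rpow_of_exponent_ge hr hr1
  have hmin : 0 < min (s * p / n) (p - 1) := lt_min (by positivity) (by linarith)
  -- The iteration yields the exponent with `sp/n`. For `r ≤ 1`, replacing `sp/n` by the smaller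
  -- minimum only enlarges the bound.
  have hexp : -((t - s) * p) * (n / (s * p * p)) = -(t - s) / (s * p / n) := by
    field_simp
  rw [hexp, neg_div, neg_div, neg_le_neg_iff]
  have : 0 ≤ t - s := by linarith
  gcongr
  exact min_le_left _ _

end Subsolutions

/-! ### The Hölder case, the functions `G` and `g`, and local boundedness. -/

section Estimates

variable {n : ℕ} {s t p ν L : ℝ} {a b Ks Kt : Rn n → Rn n → ℝ} {Ω : Set (Rn n)}

theorem essSup_scaledCoeff_ne_top (hab : ∀ᵐ z : Rn n × Rn n, a z.1 z.2 ≤ L ∧ b z.1 z.2 ≤ L)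
    (x₀ : Rn n) {r : ℝ} (hr : 0 < r) :
    essSup (fun z : Rn n × Rn n => ENNReal.ofReal (scaledCoeff s t p a b r z))
      (volume.restrict (ball x₀ r ×ˢ ball x₀ r)) ≠ ∞ := by
  have : essSup (fun z : Rn n × Rn n => ENNReal.ofReal (scaledCoeff s t p a b r z))
      (volume.restrict (ball x₀ r ×ˢ ball x₀ r)) ≤
        ENNReal.ofReal (L / r ^ (s * p) + L / r ^ (t * p)) := by
    refine essSup_le_of_ae_le _ (ae_restrict_of_ae ?_)
    filter_upwards [hab] with z hz
    apply ENNReal.ofReal_le_ofReal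
    unfold scaledCoeff
    gcongr
    · exact hz.1
    · exact hz.2
  exact (this.trans_lt ENNReal.ofReal_lt_top).ne

theorem bigG_one_eq (s t p : ℝ) (a b : Rn n → Rn n → ℝ) (x₀ : Rn n) (r : ℝ) :
    bigG s t p a b x₀ r 1 = (essSup (fun z : Rn n × Rn n =>
      ENNReal.ofReal (scaledCoeff s t p a b r z))
        (volume.restrict (ball x₀ r ×ˢ ball x₀ r))).toReal := by
  simp only [bigG, scaledCoeff, Real.one_rpow, mul_one_div]

theorem bigG_eq (s t p : ℝ) (a b : Rn n → Rn n → ℝ) (x₀ : Rn n) (r : ℝ) {τ : ℝ} (hτ : 0 ≤ τ) :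
    bigG s t p a b x₀ r τ = τ ^ p * bigG s t p a b x₀ r 1 := by
  rw [bigG_one_eq, bigG, ← ENNReal.toReal_ofReal (by positivity : 0 ≤ τ ^ p), ← ENNReal.toReal_mul,
    ← ENNReal.essSup_const_mul]
  congr 2
  ext z
  rw [ENNReal.toReal_ofReal (by positivity), ← ENNReal.ofReal_mul (by positivity)]
  congr 1
  simp only [scaledCoeff]
  ring

theorem ae_scaledCoeff_le_bigG (hab : ∀ᵐ z : Rn n × Rn n, a z.1 z.2 ≤ L ∧ b z.1 z.2 ≤ L)
    (x₀ : Rn n) {r : ℝ} (hr : 0 < r) :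
    ∀ᵐ z : Rn n × Rn n, z ∈ ball x₀ r ×ˢ ball x₀ r →
      scaledCoeff s t p a b r z ≤ bigG s t p a b x₀ r 1 := by
  have h := ENNReal.ae_le_essSup (μ := volume.restrict (ball x₀ r ×ˢ ball x₀ r))
    (fun z : Rn n × Rn n => ENNReal.ofReal (scaledCoeff s t p a b r z))
  rw [ae_restrict_iff' (measurableSet_ball.prod measurableSet_ball)] at h
  filter_upwards [h] with z hz hzB
  rw [bigG_one_eq]
  exact (ENNReal.ofReal_le_iff_le_toReal (essSup_scaledCoeff_ne_top hab x₀ hr)).mp (hz hzB)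

theorem bigG_one_le_of_ae_le {x₀ : Rn n} {r M : ℝ} (hM : 0 ≤ M)
    (h : ∀ᵐ z : Rn n × Rn n, z ∈ ball x₀ r ×ˢ ball x₀ r → scaledCoeff s t p a b r z ≤ M) :
    bigG s t p a b x₀ r 1 ≤ M := by
  rw [bigG_one_eq]
  refine ENNReal.toReal_le_of_le_ofReal hM (essSup_le_of_ae_le _ ?_)
  rw [Filter.EventuallyLE, ae_restrict_iff' (measurableSet_ball.prod measurableSet_ball)]
  filter_upwards [h] with z hz hzB
  exact ENNReal.ofReal_le_ofReal (hz hzB)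

/-- Under the Hölder condition on `b` the scaled coefficients on `B_r × B_r` are comparable. -/
theorem scaledCoeff_le_mul {α H r : ℝ} {x₀ : Rn n} {z z' : Rn n × Rn n} (hν : 0 < ν)
    (hL : 0 ≤ L) (hst : s ≤ t) (hp : 0 ≤ p) (hα : 0 < α) (hstα : (t - s) * p ≤ α) (hH : 0 ≤ H)
    (hr : 0 < r) (hr1 : r ≤ 1) (ha : IsCoefficient a) (hb : IsCoefficient b)
    (hhol : IsHolderCoeff α H b) (hz : z ∈ ball x₀ r ×ˢ ball x₀ r)
    (hz' : z' ∈ ball x₀ r ×ˢ ball x₀ r) (hzν : ν ≤ a z.1 z.2 + b z.1 z.2)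
    (hzL : a z'.1 z'.2 + b z'.1 z'.2 ≤ L) :
    scaledCoeff s t p a b r z' ≤ (1 + 2 / ν * (L + H * 4 ^ α)) * scaledCoeff s t p a b r z := by
  have ha0 := ha.nonneg z.1 z.2
  have hb0 := hb.nonneg z.1 z.2
  have ha0' := ha.nonneg z'.1 z'.2
  have hb0' := hb.nonneg z'.1 z'.2
  have hrs : 0 < r ^ (s * p) := by positivity
  have hrt : 0 < r ^ (t * p) := by positivity
  have hpow : r ^ (t * p) ≤ r ^ (s * p) :=
    Real.rpow_le_rpow_of_exponent_ge hr hr1 (mul_le_mul_of_nonneg_right hst hp)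
  have hsc0 : 0 ≤ scaledCoeff s t p a b r z := by unfold scaledCoeff; positivity
  have hH4 : 0 ≤ H * 4 ^ α := by positivity
  -- If `b ≥ ν/2` at `z`, then `r^{-tp}`, the largest possible order, is already present at `z`.
  -- Otherwise `a ≥ ν/2` at `z`, and the oscillation of `b` costs `H (4r)^α r^{-tp}`, which `(t-s)p
  -- ≤ α` and `r ≤ 1` reduce to a multiple of `r^{-sp}`.
  rcases le_total (ν / 2) (b z.1 z.2) with hcase | hcase
  · have h1 : ν / 2 / r ^ (t * p) ≤ scaledCoeff s t p a b r z := by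
      calc _ ≤ b z.1 z.2 / r ^ (t * p) := by gcongr
        _ ≤ _ := by unfold scaledCoeff; exact le_add_of_nonneg_left (by positivity)
    calc scaledCoeff s t p a b r z' ≤ a z'.1 z'.2 / r ^ (t * p) + b z'.1 z'.2 / r ^ (t * p) := by
          unfold scaledCoeff; gcongr
      _ = (a z'.1 z'.2 + b z'.1 z'.2) / r ^ (t * p) := (add_div _ _ _).symm
      _ ≤ L / r ^ (t * p) := by gcongr
      _ = 2 / ν * L * (ν / 2 / r ^ (t * p)) := by field_simp
      _ ≤ (1 + 2 / ν * (L + H * 4 ^ α)) * scaledCoeff s t p a b r z := by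
        have : 2 / ν * L ≤ 1 + 2 / ν * (L + H * 4 ^ α) := by
          rw [mul_add]
          have : 0 ≤ 2 / ν * (H * 4 ^ α) := by positivity
          linarith
        gcongr
  · have h1 : ν / 2 / r ^ (s * p) ≤ a z.1 z.2 / r ^ (s * p) := by
      gcongr; linarith
    have hdist : ‖z'.1 - z.1‖ + ‖z'.2 - z.2‖ ≤ 4 * r := by
      have e1 := mem_ball.mp hz.1
      have e2 := mem_ball.mp hz.2
      have e3 := mem_ball.mp hz'.1
      have e4 := mem_ball.mp hz'.2
      rw [← dist_eq_norm, ← dist_eq_norm]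
      have e5 := dist_triangle_right z'.1 z.1 x₀
      have e6 := dist_triangle_right z'.2 z.2 x₀
      linarith
    have hosc : b z'.1 z'.2 ≤ b z.1 z.2 + H * (4 ^ α * r ^ α) := by
      have e1 := (le_abs_self _).trans (hhol z'.1 z'.2 z.1 z.2)
      have e2 : H * (‖z'.1 - z.1‖ + ‖z'.2 - z.2‖) ^ α ≤ H * (4 * r) ^ α := by gcongr
      rw [Real.mul_rpow (by norm_num) hr.le] at e2
      linarith
    have hrα : r ^ α / r ^ (t * p) ≤ 1 / r ^ (s * p) := by
      rw [div_le_div_iff₀ hrt hrs, ← Real.rpow_add hr, one_mul]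
      apply Real.rpow_le_rpow_of_exponent_ge hr hr1
      linarith
    calc scaledCoeff s t p a b r z' ≤
          L / r ^ (s * p) + (b z.1 z.2 + H * (4 ^ α * r ^ α)) / r ^ (t * p) := by
          unfold scaledCoeff
          gcongr
          linarith
      _ = L / r ^ (s * p) + b z.1 z.2 / r ^ (t * p) + H * 4 ^ α * (r ^ α / r ^ (t * p)) := by
        ring
      _ ≤ L / r ^ (s * p) + b z.1 z.2 / r ^ (t * p) + H * 4 ^ α * (1 / r ^ (s * p)) := by gcongr
      _ = 2 / ν * (L + H * 4 ^ α) * (ν / 2 / r ^ (s * p)) + b z.1 z.2 / r ^ (t * p) := by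
        field_simp
        ring
      _ ≤ 2 / ν * (L + H * 4 ^ α) * scaledCoeff s t p a b r z + scaledCoeff s t p a b r z := by
        have h2 : a z.1 z.2 / r ^ (s * p) ≤ scaledCoeff s t p a b r z := by
          unfold scaledCoeff; exact le_add_of_nonneg_right (by positivity)
        have h3 : b z.1 z.2 / r ^ (t * p) ≤ scaledCoeff s t p a b r z := by
          unfold scaledCoeff; exact le_add_of_nonneg_left (by positivity)
        have h4 := h1.trans h2
        gcongr
      _ = _ := by ring

/-- `B_r × B_r` has positive measure, hence contains a point at which all almost-everywhere bounds
hold; there `a + b ≥ ν > 0`. -/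
theorem bigG_one_pos (hν : 0 < ν) (h : IsData s t p ν L a b Ks Kt) (x₀ : Rn n) {r : ℝ}
    (hr : 0 < r) : 0 < bigG s t p a b x₀ r 1 := by
  have hpos : (volume : Measure (Rn n × Rn n)) (ball x₀ r ×ˢ ball x₀ r) ≠ 0 := by
    rw [Measure.volume_eq_prod, Measure.prod_prod]
    exact mul_ne_zero (measure_ball_pos _ _ hr).ne' (measure_ball_pos _ _ hr).ne'
  have hfreq : ∃ᶠ z in ae (volume : Measure (Rn n × Rn n)), z ∈ ball x₀ r ×ˢ ball x₀ r :=
    frequently_ae_iff.mpr hpos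
  obtain ⟨z, hzB, hz, hzν⟩ := (hfreq.and_eventually
    ((ae_scaledCoeff_le_bigG (s := s) (t := t) (p := p) (ae_coeff_le h) x₀ hr).and
      h.bounds)).exists
  refine lt_of_lt_of_le ?_ (hz hzB)
  have ha0 := h.coeff_a.nonneg z.1 z.2
  have hb0 := h.coeff_b.nonneg z.1 z.2
  unfold scaledCoeff
  rcases ha0.eq_or_lt with h0 | h0
  · have : 0 < b z.1 z.2 := by linarith [hzν.1]
    positivity
  · positivity

/-- By homogeneity `g` is a multiple of `τ ^ (p - 1)`. Its bijectivity and its inverse are read off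
from this; the value at `τ = 0` agrees because division by zero gives `0`. -/
theorem smallG_eq (hp : 1 < p) (x₀ : Rn n) (r : ℝ) {τ : ℝ} (hτ : 0 ≤ τ) :
    smallG s t p a b x₀ r τ = bigG s t p a b x₀ r 1 * τ ^ (p - 1) := by
  rw [smallG, bigG_eq s t p a b x₀ r hτ]
  rcases hτ.eq_or_lt with rfl | h
  · rw [Real.zero_rpow (by linarith : p - 1 ≠ 0)]; simp
  · rw [Real.rpow_sub_one h.ne']; ring

theorem bijOn_smallG (hp : 1 < p) {x₀ : Rn n} {r : ℝ} (hG : 0 < bigG s t p a b x₀ r 1) :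
    BijOn (smallG s t p a b x₀ r) (Ici 0) (Ici 0) := by
  refine ⟨fun τ hτ => ?_, fun τ hτ σ hσ h => ?_, fun y hy => ?_⟩
  · rw [mem_Ici] at hτ ⊢
    rw [smallG_eq hp x₀ r hτ]
    positivity
  · rw [smallG_eq hp x₀ r hτ, smallG_eq hp x₀ r hσ] at h
    exact Real.rpow_left_injOn (by linarith : p - 1 ≠ 0) hτ hσ (mul_left_cancel₀ hG.ne' h)
  · rw [mem_Ici] at hy
    have h0 : 0 ≤ 1 / bigG s t p a b x₀ r 1 * y := by positivity
    refine ⟨(1 / bigG s t p a b x₀ r 1 * y) ^ (1 / (p - 1)), Real.rpow_nonneg h0 _, ?_⟩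
    rw [smallG_eq hp x₀ r (Real.rpow_nonneg h0 _), ← Real.rpow_mul h0,
      one_div_mul_cancel (by linarith), Real.rpow_one]
    field_simp

theorem smallGInv_eq (hp : 1 < p) {x₀ : Rn n} {r y : ℝ} (hG : 0 < bigG s t p a b x₀ r 1)
    (hy : 0 ≤ y) :
    smallGInv s t p a b x₀ r y = (1 / bigG s t p a b x₀ r 1 * y) ^ (1 / (p - 1)) := by
  have h0 : 0 ≤ 1 / bigG s t p a b x₀ r 1 * y := by positivity
  have hmem : (1 / bigG s t p a b x₀ r 1 * y) ^ (1 / (p - 1)) ∈ Ici (0 : ℝ) :=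
    Real.rpow_nonneg h0 _
  have hval : smallG s t p a b x₀ r ((1 / bigG s t p a b x₀ r 1 * y) ^ (1 / (p - 1))) = y := by
    rw [smallG_eq hp x₀ r hmem, ← Real.rpow_mul h0, one_div_mul_cancel (by linarith),
      Real.rpow_one]
    field_simp
  have := (bijOn_smallG hp hG).injOn.leftInvOn_invFunOn hmem
  rwa [hval] at this

/-- Here `M = M' = G_{B_r}(1)` and `m = G_{B_r}(1) / D`, so that `M / m = D` does not depend on `r`.
-/
theorem exists_estimate₂ (hn : 1 ≤ n) (hs : 0 < s) (hst : s < t) (ht1 : t < 1) (hp : 1 < p)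
    (hν : 0 < ν) (hL : 0 < L) {α H : ℝ} (hα : 0 < α) (hH : 0 ≤ H) (hstα : (t - s) * p ≤ α) :
    ∃ c : ℝ, 0 < c ∧
      ∀ (Ω : Set (Rn n)) (a b Ks Kt : Rn n → Rn n → ℝ), IsBoundedDomain Ω →
        IsData s t p ν L a b Ks Kt → IsHolderCoeff α H b →
        ∀ (x₀ : Rn n) (r : ℝ), 0 < r → r ≤ 1 → closedBall x₀ r ⊆ Ω →
        ∀ u ∈ tailSpace s t p a b, IsWeakSubsolution s t p a b Ks Kt Ω u →
          ∀ᵐ x, x ∈ ball x₀ (r / 2) → u x ≤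
            c * meanLp p (positivePart u) x₀ r +
            (1 / bigG s t p a b x₀ r 1 *
              (nonlocalTail s t p a b (positivePart u) x₀ (r / 2) r).toReal) ^ (1 / (p - 1)) := by
  obtain ⟨c, hc, hmain⟩ := ae_le_mean_add_tail (ν := ν) hn hs hst ht1 hp hν hL
  set D : ℝ := 1 + 2 / ν * (L + H * 4 ^ α) with hD
  have hD1 : 1 ≤ D := le_add_of_nonneg_right (by positivity)
  have hD0 : 0 < D := by linarith
  refine ⟨c * D ^ (n / (s * p * p)), by positivity, ?_⟩
  intro Ω a b Ks Kt hΩ h hhol x₀ r hr hr1 hB u hu hsub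
  have hB' : ball x₀ r ⊆ Ω := ball_subset_closedBall.trans hB
  have hG := bigG_one_pos hν h x₀ hr
  set G := bigG s t p a b x₀ r 1 with hGdef
  have hcoeff : ∀ᵐ z : Rn n × Rn n, z ∈ ball x₀ r ×ˢ ball x₀ r →
      G / D ≤ scaledCoeff s t p a b r z ∧ scaledCoeff s t p a b r z ≤ G := by
    filter_upwards [h.bounds, ae_scaledCoeff_le_bigG (ae_coeff_le h) x₀ hr] with z hz hz2 hzB
    refine ⟨?_, hz2 hzB⟩
    rw [div_le_iff₀' hD0]
    have ha0 := h.coeff_a.nonneg z.1 z.2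
    have hb0 := h.coeff_b.nonneg z.1 z.2
    -- The point `z` is kept fixed while the essential supremum runs over `z'`.
    refine bigG_one_le_of_ae_le (mul_nonneg hD0.le (by unfold scaledCoeff; positivity)) ?_
    filter_upwards [h.bounds] with z' hz' hzB'
    exact scaledCoeff_le_mul hν hL.le hst.le (by linarith) hα hstα hH hr hr1 h.coeff_a h.coeff_b hhol
      hzB hzB' hz.1 hz'.2
  have hmM : G / D ≤ G := div_le_self hG.le hD1
  have := hmain hΩ.isOpen.measurableSet h hsub hr hB' (by positivity) hmM hG le_rfl hcoeff
    (nonlocalTail_positivePart_lt_top h.coeff_a h.coeff_b hp.le hu x₀ (by positivity) hr)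
  rwa [show G / (G / D) = D by field_simp] at this

theorem isLocallyBounded_of_ae_abs_le {u : Rn n → ℝ} (hu : AEMeasurable u)
    (h : ∀ x ∈ Ω, ∃ r > 0, ∃ C : ℝ, ∀ᵐ y, y ∈ ball x r → |u y| ≤ C) :
    IsLocallyBounded Ω u := by
  intro K hKΩ hK
  have hbdd : ∃ C : ℝ, ∀ᵐ y, y ∈ K → |u y| ≤ C := by
    refine hK.induction_on (p := fun S => ∃ C : ℝ, ∀ᵐ y, y ∈ S → |u y| ≤ C) ⟨0, by simp⟩ ?_ ?_ ?_
    · rintro S S' hSS' ⟨C, hC⟩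
      exact ⟨C, hC.mono fun y hy hyS => hy (hSS' hyS)⟩
    · rintro S S' ⟨C, hC⟩ ⟨C', hC'⟩
      refine ⟨max C C', ?_⟩
      filter_upwards [hC, hC'] with y h1 h2 hy
      rcases hy with hy | hy
      · exact (h1 hy).trans (le_max_left _ _)
      · exact (h2 hy).trans (le_max_right _ _)
    · intro x hx
      obtain ⟨r, hr, C, hC⟩ := h x (hKΩ hx)
      exact ⟨ball x r, mem_nhdsWithin_of_mem_nhds (ball_mem_nhds x hr), C, hC⟩
  obtain ⟨C, hC⟩ := hbdd
  refine memLp_top_of_bound hu.aestronglyMeasurable.restrict C ?_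
  exact (ae_restrict_iff' hK.measurableSet).mpr hC

end Estimates

/-! ### The theorem. -/

theorem theorem1p1 (n : ℕ) (hn : 1 ≤ n) (s t p ν L : ℝ) (hs : 0 < s) (hst : s < t) (ht : t < 1)
    (hp : 1 < p) (hν : 0 < ν) (hν1 : ν ≤ 1) (hL : 1 ≤ L) :
    -- part (1), for subsolutions and for solutions, with the same constant
    (∃ c : ℝ, 0 < c ∧
      ∀ (Ω : Set (Rn n)) (a b Ks Kt : Rn n → Rn n → ℝ), IsBoundedDomain Ω →
        IsData s t p ν L a b Ks Kt →
        ∀ (x₀ : Rn n) (r : ℝ), 0 < r → r ≤ 1 → closedBall x₀ r ⊆ Ω →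
        ∀ u ∈ tailSpace s t p a b,
          (IsWeakSubsolution s t p a b Ks Kt Ω u →
            Estimate₁ s t p a b c x₀ r u (positivePart u)) ∧
          (IsWeakSolution s t p a b Ks Kt Ω u →
            Estimate₁ s t p a b c x₀ r (fun x => |u x|) (fun x => |u x|))) ∧
    -- part (2), for subsolutions and for solutions, with the same constant
    (∀ α H : ℝ, 0 < α → α ≤ 1 → 0 ≤ H → (t - s) * p ≤ α →
      ∃ c : ℝ, 0 < c ∧
        ∀ (Ω : Set (Rn n)) (a b Ks Kt : Rn n → Rn n → ℝ), IsBoundedDomain Ω →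
          IsData s t p ν L a b Ks Kt → IsHolderCoeff α H b →
          ∀ R₀ : ℝ, 0 < R₀ → R₀ < 1 → H * (2 * R₀) ^ α ≤ ν / 8 →
          ∀ (x₀ : Rn n) (r : ℝ), 0 < r → r ≤ R₀ → closedBall x₀ r ⊆ Ω →
          ∀ u ∈ tailSpace s t p a b,
            (IsWeakSubsolution s t p a b Ks Kt Ω u →
              Estimate₂ s t p a b c x₀ r u (positivePart u)) ∧
            (IsWeakSolution s t p a b Ks Kt Ω u →
              Estimate₂ s t p a b c x₀ r (fun x => |u x|) (fun x => |u x|))) ∧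
    -- local boundedness of solutions
    (∀ (Ω : Set (Rn n)) (a b Ks Kt : Rn n → Rn n → ℝ), IsBoundedDomain Ω →
      IsData s t p ν L a b Ks Kt →
      ∀ u ∈ tailSpace s t p a b, IsWeakSolution s t p a b Ks Kt Ω u →
        IsLocallyBounded Ω u) := by
  have hL0 : 0 < L := by linarith
  obtain ⟨c₁, hc₁, h₁⟩ := exists_estimate₁ (ν := ν) hn hs hst ht hp hν hν1 hL
  have habs₁ : ∀ (Ω : Set (Rn n)) (a b Ks Kt : Rn n → Rn n → ℝ), IsBoundedDomain Ω →
      IsData s t p ν L a b Ks Kt → ∀ (x₀ : Rn n) (r : ℝ), 0 < r → r ≤ 1 → closedBall x₀ r ⊆ Ω →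
      ∀ u ∈ tailSpace s t p a b, IsWeakSolution s t p a b Ks Kt Ω u →
        ∀ᵐ x, x ∈ ball x₀ (r / 2) → |u x| ≤
          c₁ * r ^ (-(t - s) / min (s * p / n) (p - 1)) * meanLp p (fun x => |u x|) x₀ r +
          (r ^ (s * p) * (nonlocalTail s t p a b (fun x => |u x|) x₀ (r / 2) r).toReal)
            ^ (1 / (p - 1)) := by
    intro Ω a b Ks Kt hΩ h x₀ r hr hr1 hB u hu hsol
    exact ae_abs_le_of_forall_subsolution h hp hr (ball_subset_closedBall.trans hB) (by positivity)
      (by positivity) (fun v hv hsub => h₁ Ω a b Ks Kt hΩ h x₀ r hr hr1 hB v hv hsub) hu hsol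
  refine ⟨⟨c₁, hc₁, ?_⟩, ?_, ?_⟩
  · intro Ω a b Ks Kt hΩ h x₀ r hr hr1 hB u hu
    exact ⟨fun hsub => essSupOn_le_of_ae measurableSet_ball
        (h₁ Ω a b Ks Kt hΩ h x₀ r hr hr1 hB u hu hsub),
      fun hsol => essSupOn_le_of_ae measurableSet_ball
        (habs₁ Ω a b Ks Kt hΩ h x₀ r hr hr1 hB u hu hsol)⟩
  · intro α H hα _ hH hstα
    obtain ⟨c₂, hc₂, h₂⟩ := exists_estimate₂ (ν := ν) hn hs hst ht hp hν hL0 hα hH hstα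
    refine ⟨c₂, hc₂, ?_⟩
    intro Ω a b Ks Kt hΩ h hhol R₀ _ hR₀1 _ x₀ r hr hrR hB u hu
    have hr1 : r ≤ 1 := hrR.trans hR₀1.le
    have hG := bigG_one_pos hν h x₀ hr
    refine ⟨fun hsub => ⟨essSupOn_le_of_ae measurableSet_ball
        (h₂ Ω a b Ks Kt hΩ h hhol x₀ r hr hr1 hB u hu hsub), bijOn_smallG hp hG, ?_⟩,
      fun hsol => ⟨essSupOn_le_of_ae measurableSet_ball
        (ae_abs_le_of_forall_subsolution h hp hr (ball_subset_closedBall.trans hB) hc₂.le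
          (by positivity) (fun v hv hsub => h₂ Ω a b Ks Kt hΩ h hhol x₀ r hr hr1 hB v hv hsub)
          hu hsol), bijOn_smallG hp hG, ?_⟩⟩
    · rw [smallGInv_eq hp hG ENNReal.toReal_nonneg]
    · rw [smallGInv_eq hp hG ENNReal.toReal_nonneg]
  · intro Ω a b Ks Kt hΩ h u hu hsol
    refine isLocallyBounded_of_ae_abs_le hsol.1.1 fun x hx => ?_
    obtain ⟨ε, hε, hεΩ⟩ := nhds_basis_closedBall.mem_iff.mp (hΩ.isOpen.mem_nhds hx)
    -- The first estimate needs a radius at most `1` whose closed ball lies in `Ω`; it bounds `|u|`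
    -- on the ball of half that radius.
    have hr : 0 < min ε 1 := lt_min hε one_pos
    exact ⟨min ε 1 / 2, by positivity, _, habs₁ Ω a b Ks Kt hΩ h x (min ε 1) hr (min_le_right _ _)
      ((closedBall_subset_closedBall (min_le_left _ _)).trans hεΩ) u hu hsol⟩
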